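/- Fix a bijection $\nu:\mathbb N\to\mathbb Q$. A sequence $w\in\mathbb N^{\mathbb N}$ is a name of $x\in\mathbb R$ if $|\nu(w(i))-x|\le 2^{-i}$ for all $i$. Finite tuples of sequences are coded into one sequence by interleaving, $\langle w_0,\dots,w_{k-1}\rangle(ki+j)=w_j(i)$. For $n,m\ge 1$, a name of an $n\times m$ bimatrix game $(A,B)$ is $0^n1^m0\langle w^a,w^b\rangle$, where $w^a$ and $w^b$ are the codes of names of the entries of $A$ and of $B$, listed column by column. Pairs of vectors in $\mathbb R^n\times\mathbb R^m$ and single $n\times m$ matrices are named in the same fashion, with the same prefix $0^n1^m0$. A problem is a multi-valued function $P$ on $\mathbb N^{\mathbb N}$, assigning to each $w$ a set $P(w)\subseteq\mathbb N^{\mathbb N}$; its domain is $\operatorname{dom}P=\{w\mid P(w)\ne\emptyset\}$, and it is identified with its choice functions. Write $P\le_2 Q$ if there are continuous partial functions $F:\subseteq\mathbb N^{\mathbb N}\times\mathbb N^{\mathbb N}\to\mathbb N^{\mathbb N}$ and $G:\subseteq\mathbb N^{\mathbb N}\to\mathbb N^{\mathbb N}$ such that for each choice function $g$ of $Q$ the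 function $w\mapsto F(w,g(G(w)))$ is defined on $\operatorname{dom}P$ and is a choice function of $P$ there; $P\equiv_2 Q$ means $P\le_2Q$ and $Q\le_2P$. Put $\langle P,Q\rangle(\langle u,v\rangle)=\{\langle y,z\rangle\mid y\in P(u),\,z\in Q(v)\}$, $\langle P\rangle^1=P$, $\langle P\rangle^{n+1}=\langle P,\langle P\rangle^n\rangle$. For a sequence of problems $P_n$, the supremum $\lceil P_n\rceil_n$ has as instances an index $n$ followed by an instance $w$ of $P_n$, and as solutions the elements of $P_n(w)$. Let $\textsc{Nash}$ (resp. $\textsc{Corr}$) be the problem: given a name of a bimatrix game $(A,B)$ of any size, find a name of a Nash equilibrium (resp. of a correlated equilibrium). Let $\textsc{ZNash}$, $\textsc{ZCorr}$ be their restrictions to zero-sum games $(A,-A)$. Let $\textsc{rDiv}$ be robust division: given $\langle u,v\rangle$ with $u,v$ names of reals $a,b$, $0\le a\le b$, output a name of $a/b$ if $b>0$, and an arbitrary sequence if $b=0$. Then $$\textsc{ZCorr}\equiv_2\textsc{Corr}\equiv_2\textsc{ZNash}\equiv_2\textsc{Nash}\equiv_2\lceil\langle\textsc{rDiv}\rangle^n\rceil_{n\ge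 1}.$$ -/

import Mathlib

open scoped Matrix

namespace TypeTwo

/-! ### Multi-valued functions on Baire space and Type-2 reducibility -/

/-- Baire space `ℕ^ℕ`, with the product topology of the discrete topology on `ℕ`. -/
abbrev Baire : Type := ℕ → ℕ

/-- A (partial) multi-valued function on names: `P w` is the set of names of solutions to the
instance with name `w`. -/
abbrev MultiFun : Type := Baire → Set Baire

/-- The domain of a multi-valued function: the instances that possess a solution. -/
def dom (P : MultiFun) : Set Baire := {w | (P w).Nonempty}

/-- `g` is a choice function of `P`. Only its restriction to `dom P` is meaningful; the values
elsewhere are never used. -/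
def IsChoice (P : MultiFun) (g : Baire → Baire) : Prop :=
  ∀ w ∈ dom P, g w ∈ P w

/-- Type-2-reducibility `P ≤₂ Q`: there are continuous partial functions `F` (with domain `DF`)
and `G` (with domain `DG`) such that `w ↦ F (w, g (G w))` is, for every choice function `g` of `Q`,
a (well-defined) choice function of `P`. -/
def Reducible (P Q : MultiFun) : Prop :=
  ∃ (DF : Set (Baire × Baire)) (F : Baire × Baire → Baire)
    (DG : Set Baire) (G : Baire → Baire),
    ContinuousOn F DF ∧ ContinuousOn G DG ∧
      ∀ g : Baire → Baire, IsChoice Q g →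
        ∀ w ∈ dom P,
          w ∈ DG ∧ G w ∈ dom Q ∧ (w, g (G w)) ∈ DF ∧ F (w, g (G w)) ∈ P w

/-- Type-2-equivalence `P ≡₂ Q`. -/
def Equivalent (P Q : MultiFun) : Prop := Reducible P Q ∧ Reducible Q P

/-- The `j`-th component (`j < k`) of a sequence read as a `k`-tuple
`⟨w_0, …, w_{k-1}⟩` of interleaved sequences. -/
def component (k j : ℕ) (w : Baire) : Baire := fun i => w (k * i + j)

/-- The product `⟨P, Q⟩`: solve an instance of `P` and an instance of `Q` in parallel. -/
def prod (P Q : MultiFun) : MultiFun := fun w =>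
  {y | component 2 0 y ∈ P (component 2 0 w) ∧ component 2 1 y ∈ Q (component 2 1 w)}

/-- Parallel powers, starting with the first one: `power P n` is `⟨P⟩^(n+1)`, where
`⟨P⟩^1 = P` and `⟨P⟩^(k+1) = ⟨P, ⟨P⟩^k⟩`. -/
def power (P : MultiFun) : ℕ → MultiFun
  | 0 => P
  | n + 1 => prod P (power P n)

/-- The supremum `⌈P_n⌉_{n ∈ ℕ}` of a countable family: an instance is an index `n`
(the first symbol) together with an instance of `P n` (the remaining symbols). -/
def sup (P : ℕ → MultiFun) : MultiFun := fun w => P (w 0) (fun i => w (i + 1))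

/-! ### Names of real numbers, vectors, matrices and games -/

/-- `ρ(w) = x`, relative to the numbering `ν` of the rationals. -/
def IsRealName (ν : ℕ ≃ ℚ) (w : Baire) (x : ℝ) : Prop :=
  ∀ i : ℕ, |((ν (w i) : ℚ) : ℝ) - x| ≤ (1 / 2 : ℝ) ^ i

/-- `w = ⟨w_1, …, w_n⟩` with `ρ(w_i) = x_i`. -/
def IsVectorName (ν : ℕ ≃ ℚ) {n : ℕ} (w : Baire) (x : Fin n → ℝ) : Prop :=
  ∀ i : Fin n, IsRealName ν (component n i w) (x i)

/-- `w = ⟨w_11, …, w_n1, w_12, …, w_nm⟩` with `ρ(w_ij) = A_ij` (listed column by column). -/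
def IsMatrixName (ν : ℕ ≃ ℚ) {n m : ℕ} (w : Baire) (A : Matrix (Fin n) (Fin m) ℝ) : Prop :=
  ∀ (i : Fin n) (j : Fin m), IsRealName ν (component (n * m) (i + n * j) w) (A i j)

/-- `w` starts with `0^n 1^m 0`, where `n` and `m` are positive. -/
def HasHeader (n m : ℕ) (w : Baire) : Prop :=
  0 < n ∧ 0 < m ∧ (∀ i < n, w i = 0) ∧ (∀ i < m, w (n + i) = 1) ∧ w (n + m) = 0

/-- What follows the header `0^n 1^m 0`. -/
def payload (n m : ℕ) (w : Baire) : Baire := fun i => w (n + m + 1 + i)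

/-- `w = 0^n 1^m 0 ⟨w^a, w^b⟩` is a name of the `n × m` bimatrix game `(A, B)`. -/
def IsGameName (ν : ℕ ≃ ℚ) {n m : ℕ} (w : Baire) (A B : Matrix (Fin n) (Fin m) ℝ) : Prop :=
  HasHeader n m w ∧ IsMatrixName ν (component 2 0 (payload n m w)) A ∧
    IsMatrixName ν (component 2 1 (payload n m w)) B

/-- `w = 0^n 1^m 0 ⟨w^x, w^y⟩` is a name of the strategy profile `(x, y)`. -/
def IsProfileName (ν : ℕ ≃ ℚ) {n m : ℕ} (w : Baire) (x : Fin n → ℝ) (y : Fin m → ℝ) : Prop :=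
  HasHeader n m w ∧ IsVectorName ν (component 2 0 (payload n m w)) x ∧
    IsVectorName ν (component 2 1 (payload n m w)) y

/-- `w = 0^n 1^m 0 w'` is a name of the `n × m` matrix `C` (a joint distribution). -/
def IsJointName (ν : ℕ ≃ ℚ) {n m : ℕ} (w : Baire) (C : Matrix (Fin n) (Fin m) ℝ) : Prop :=
  HasHeader n m w ∧ IsMatrixName ν (payload n m w) C

/-! ### Equilibria of bimatrix games -/

/-- `(x, y)` is a Nash equilibrium of the bimatrix game `(A, B)`. -/
def IsNash {n m : ℕ} (A B : Matrix (Fin n) (Fin m) ℝ) (x : Fin n → ℝ) (y : Fin m → ℝ) : Prop :=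
  x ∈ stdSimplex ℝ (Fin n) ∧ y ∈ stdSimplex ℝ (Fin m) ∧
    (∀ x' ∈ stdSimplex ℝ (Fin n), x' ⬝ᵥ (A *ᵥ y) ≤ x ⬝ᵥ (A *ᵥ y)) ∧
    (∀ y' ∈ stdSimplex ℝ (Fin m), x ⬝ᵥ (B *ᵥ y') ≤ x ⬝ᵥ (B *ᵥ y))

/-- `C` is a correlated equilibrium of the bimatrix game `(A, B)`. -/
def IsCorrelated {n m : ℕ} (A B C : Matrix (Fin n) (Fin m) ℝ) : Prop :=
  (∀ i j, 0 ≤ C i j) ∧ ∑ i, ∑ j, C i j = 1 ∧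
    (∀ i l, ∑ j, A l j * C i j ≤ ∑ j, A i j * C i j) ∧
    (∀ j k, ∑ i, B i k * C i j ≤ ∑ i, B i j * C i j)

/-! ### The problems -/

/-- Robust division: given names of `a`, `b` with `0 ≤ a ≤ b`, produce a name of `a / b` if
`b > 0`; if `b = 0`, any output is accepted. -/
def rDiv (ν : ℕ ≃ ℚ) : MultiFun := fun w =>
  {d | ∃ a b : ℝ, IsRealName ν (component 2 0 w) a ∧ IsRealName ν (component 2 1 w) b ∧
    0 ≤ a ∧ a ≤ b ∧ (0 < b → IsRealName ν d (a / b))}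

/-- Find a Nash equilibrium of a bimatrix game. -/
def Nash (ν : ℕ ≃ ℚ) : MultiFun := fun w =>
  {z | ∃ (n m : ℕ) (A B : Matrix (Fin n) (Fin m) ℝ) (x : Fin n → ℝ) (y : Fin m → ℝ),
    IsGameName ν w A B ∧ IsNash A B x y ∧ IsProfileName ν z x y}

/-- Find a Nash equilibrium of a zero-sum bimatrix game. -/
def ZNash (ν : ℕ ≃ ℚ) : MultiFun := fun w =>
  {z | ∃ (n m : ℕ) (A : Matrix (Fin n) (Fin m) ℝ) (x : Fin n → ℝ) (y : Fin m → ℝ),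
    IsGameName ν w A (-A) ∧ IsNash A (-A) x y ∧ IsProfileName ν z x y}

/-- Find a correlated equilibrium of a bimatrix game. -/
def Corr (ν : ℕ ≃ ℚ) : MultiFun := fun w =>
  {z | ∃ (n m : ℕ) (A B C : Matrix (Fin n) (Fin m) ℝ),
    IsGameName ν w A B ∧ IsCorrelated A B C ∧ IsJointName ν z C}

/-- Find a correlated equilibrium of a zero-sum bimatrix game. -/
def ZCorr (ν : ℕ ≃ ℚ) : MultiFun := fun w =>
  {z | ∃ (n m : ℕ) (A C : Matrix (Fin n) (Fin m) ℝ),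
    IsGameName ν w A (-A) ∧ IsCorrelated A (-A) C ∧ IsJointName ν z C}

end TypeTwo

/-!
All reductions only have to be continuous, and every space of names is a subspace of Baire space,
hence zero-dimensional. On such spaces a continuous real function always has a continuous realizer
(`ZeroDim.exists_realName`) and Michael's selection theorem holds without convexity
(`ZeroDim.exists_selection`). The five problems are linked in a cycle.

* Restricting a problem to zero-sum games makes it easier; the product of the strategies in a Nash
  equilibrium is a correlated equilibrium; in a zero-sum game the marginals of a correlated
  equilibrium are a Nash equilibrium. Instances of `Nash` are solvable because bimatrix games have
  equilibria (`exists_isNash`), which is proved by the parity argument of Lemke and Howson: generic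
  perturbations of the complementarity problem of the game have evenly many complementary feasible
  bases, and the trivial one is among them.
* `n + 1` divisions `a k / b k` are performed by one zero-sum game, the sum of the games with rows
  `(b k - a k, a k - b k)` and `(-a k, a k)`: if `b k > 0`, the row player must choose the first row
  of the `k`-th game with probability `a k / b k` (`IsNash.division`).
* Conversely, the Nash equilibria of a game of fixed size can be found by finitely many parallel
  divisions. By Krein-Milman and Cramer's rule the set of equilibria varies lower hemicontinuously
  as long as the zero pattern of finitely many minors of the payoffs is preserved
  (`eventually_exists_near_nash`). Let `b s` be a continuous function that is positive exactly where
  at most `s` of these minors vanish. On `{b s > 0}` there is a continuous set-valued map `P s` that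
  contains the set of equilibria everywhere and equals it where exactly `s` minors vanish
  (`outerHull`). It is coded by a continuous function `x` into the Cantor set in the unit interval
  (`exists_real_code`), so dividing `x * b s` by `b s` recovers it, and the decoding yields a
  continuous set-valued map even from a wrong answer. All these divisions are independent of each
  other. Starting from an arbitrary profile, the answers with `s = 0, 1, 2, …` are used in turn to
  move the profile into `P s`, without touching it where it is already there. If exactly `t` minors
  vanish, the profile is an equilibrium after step `t`, and as it then belongs to all later `P s`,
  it is not moved any more (`exists_parallel_divisions`).
-/

namespace TypeTwo

open Topology TopologicalSpace Set Filter

/-! ### Selections over zero-dimensional spaces -/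

/-- A space is called zero-dimensional here if its clopen sets form a basis. -/
def ZeroDim (X : Type*) [TopologicalSpace X] : Prop :=
  IsTopologicalBasis {s : Set X | IsClopen s}

lemma zeroDim_of_nhds {X : Type*} [TopologicalSpace X]
    (h : ∀ (x : X) (u : Set X), x ∈ u → IsOpen u → ∃ v, IsClopen v ∧ x ∈ v ∧ v ⊆ u) :
    ZeroDim X :=
  isTopologicalBasis_of_isOpen_of_nhds (fun _ hu => IsClopen.isOpen hu) h

lemma ZeroDim.exists_clopen {X : Type*} [TopologicalSpace X] (h : ZeroDim X) {x : X} {u : Set X}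
    (hx : x ∈ u) (hu : IsOpen u) : ∃ v, IsClopen v ∧ x ∈ v ∧ v ⊆ u :=
  h.exists_subset_of_mem_open hx hu

lemma ZeroDim.of_isInducing {X Y : Type*} [TopologicalSpace X] [TopologicalSpace Y]
    (hY : ZeroDim Y) {f : X → Y} (hf : IsInducing f) : ZeroDim X := by
  refine zeroDim_of_nhds fun x u hx hu => ?_
  obtain ⟨t, ht, rfl⟩ := hf.isOpen_iff.1 hu
  obtain ⟨v, hv, hxv, hvt⟩ := hY.exists_clopen hx ht
  exact ⟨f ⁻¹' v, hv.preimage hf.continuous, hxv, preimage_mono hvt⟩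

lemma ZeroDim.subtype {X : Type*} [TopologicalSpace X] (hX : ZeroDim X) (p : X → Prop) :
    ZeroDim {x // p x} :=
  hX.of_isInducing IsInducing.subtypeVal

lemma ZeroDim.prodMk {X Y : Type*} [TopologicalSpace X] [TopologicalSpace Y]
    (hX : ZeroDim X) (hY : ZeroDim Y) : ZeroDim (X × Y) := by
  refine zeroDim_of_nhds fun x u hx hu => ?_
  obtain ⟨s, t, hs, ht, hxs, hxt, hst⟩ := isOpen_prod_iff.1 hu x.1 x.2 hx
  obtain ⟨v, hv, hxv, hvs⟩ := hX.exists_clopen hxs hs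
  obtain ⟨w, hw, hxw, hwt⟩ := hY.exists_clopen hxt ht
  exact ⟨v ×ˢ w, hv.prod hw, ⟨hxv, hxw⟩, (prod_mono hvs hwt).trans hst⟩

lemma ZeroDim.pi {ι : Type*} {X : Type*} [TopologicalSpace X] (hX : ZeroDim X) :
    ZeroDim (ι → X) := by
  refine zeroDim_of_nhds fun x u hx hu => ?_
  obtain ⟨I, t, ht, htu⟩ := isOpen_pi_iff.1 hu x hx
  choose! v hv hxv hvt using fun i (hi : i ∈ I) => hX.exists_clopen (ht i hi).2 (ht i hi).1
  refine ⟨(I : Set ι).pi v, ?_, fun i hi => hxv i hi, ?_⟩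
  · have : (I : Set ι).pi v = ⋂ i ∈ I, (fun y : ι → X => y i) ⁻¹' v i := by
      ext y; simp [Set.mem_pi]
    rw [this]
    exact isClopen_biInter_finset fun i hi => (hv i hi).preimage (continuous_apply i)
  · exact (Set.pi_mono fun i hi => hvt i hi).trans htu

lemma zeroDim_of_discrete (X : Type*) [TopologicalSpace X] [DiscreteTopology X] : ZeroDim X :=
  zeroDim_of_nhds fun x u hx _ => ⟨{x}, isClopen_discrete _, rfl, by simpa using hx⟩

lemma zeroDim_baire : ZeroDim Baire := (zeroDim_of_discrete ℕ).pi

/-- Mathlib has this for coercions of sets to types, which need not unify with predicates. -/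
instance secondCountableTopology_subtype {X : Type*} [TopologicalSpace X]
    [SecondCountableTopology X] (p : X → Prop) : SecondCountableTopology {x // p x} :=
  IsInducing.subtypeVal.secondCountableTopology

/-- Countable open covers of a second countable zero-dimensional space admit continuous choices of
a member of the cover: refine the cover by countably many clopen sets and take the first one. -/
lemma ZeroDim.exists_continuous_index {X : Type*} [TopologicalSpace X] [SecondCountableTopology X]
    (hX : ZeroDim X) (U : ℕ → Set X) (hU : ∀ i, IsOpen (U i)) (hc : ∀ x, ∃ i, x ∈ U i) :
    ∃ φ : X → ℕ, Continuous φ ∧ ∀ x, x ∈ U (φ x) := by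
  classical
  rcases isEmpty_or_nonempty X with hE | hE
  · exact ⟨fun _ => 0, continuous_const, fun x => (hE.false x).elim⟩
  choose i hi using hc
  choose v hv hxv hvU using fun x => hX.exists_clopen (hi x) (hU (i x))
  obtain ⟨T, hT, hTu⟩ := isOpen_iUnion_countable v fun x => (hv x).isOpen
  have hcov : ⋃ x ∈ T, v x = univ := by
    rw [hTu]; exact eq_univ_of_forall fun x => mem_iUnion.2 ⟨x, hxv x⟩
  have hTne : T.Nonempty := by
    obtain ⟨x⟩ := hE
    obtain ⟨y, hy, -⟩ := mem_iUnion₂.1 (hcov ▸ mem_univ x : x ∈ ⋃ x ∈ T, v x)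
    exact ⟨y, hy⟩
  obtain ⟨e, he⟩ := hT.exists_eq_range hTne
  have hex : ∀ x, ∃ n, x ∈ v (e n) := by
    intro x
    obtain ⟨y, hy, hxy⟩ := mem_iUnion₂.1 (hcov ▸ mem_univ x : x ∈ ⋃ x ∈ T, v x)
    rw [he] at hy
    obtain ⟨n, rfl⟩ := hy
    exact ⟨n, hxy⟩
  have hN : Continuous fun x => Nat.find (hex x) := by
    rw [continuous_discrete_rng]
    intro n
    have : (fun x => Nat.find (hex x)) ⁻¹' {n} = v (e n) ∩ ⋂ m ∈ Finset.range n, (v (e m))ᶜ := by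
      ext x
      simp [Nat.find_eq_iff]
    rw [this]
    exact ((hv _).inter (isClopen_biInter_finset fun m _ => (hv _).compl)).isOpen
  refine ⟨fun x => i (e (Nat.find (hex x))), ?_, fun x => hvU _ (Nat.find_spec (hex x))⟩
  exact (continuous_of_discreteTopology (f := fun n => i (e n))).comp hN

lemma lhc_iff_ball {X Z : Type*} [TopologicalSpace X] [PseudoMetricSpace Z] {P : X → Set Z} :
    LowerHemicontinuous P ↔
      ∀ x, ∀ z ∈ P x, ∀ ε > 0, ∀ᶠ y in 𝓝 x, ∃ z' ∈ P y, dist z' z < ε := by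
  constructor
  · intro h x z hz ε hε
    exact lowerHemicontinuousAt_iff.1 (h x) (Metric.ball z ε) Metric.isOpen_ball
      ⟨z, hz, Metric.mem_ball_self hε⟩
  · intro h x
    refine lowerHemicontinuousAt_iff.2 ?_
    rintro u hu ⟨z, hz, hzu⟩
    obtain ⟨ε, hε, hb⟩ := Metric.isOpen_iff.1 hu z hzu
    filter_upwards [h x z hz ε hε] with y ⟨z', hz', hd⟩
    exact ⟨z', hz', hb hd⟩

/-- Michael's selection theorem over a zero-dimensional base; no convexity is needed. The selection
is a uniform limit of locally constant functions with values in a dense sequence. -/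
theorem ZeroDim.exists_selection {X : Type*} [TopologicalSpace X] [SecondCountableTopology X]
    (hX : ZeroDim X) {Z : Type*} [MetricSpace Z] [CompleteSpace Z] [SeparableSpace Z] [Nonempty Z]
    (P : X → Set Z) (hne : ∀ x, (P x).Nonempty) (hcl : ∀ x, IsClosed (P x))
    (hl : LowerHemicontinuous P) :
    ∃ f : X → Z, Continuous f ∧ ∀ x, f x ∈ P x := by
  have hl' := lhc_iff_ball.1 hl
  let q := denseSeq Z
  -- One refinement step; `r` is the current precision.
  have step : ∀ (r s : ℝ), 0 < s → ∀ f : X → Z, Continuous f →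
      (∀ x, ∃ z ∈ P x, dist z (f x) < r) →
      ∃ g : X → Z, Continuous g ∧ (∀ x, ∃ z ∈ P x, dist z (g x) < s) ∧
        ∀ x, dist (f x) (g x) < r + s := by
    intro r s hs f hf hfr
    obtain ⟨φ, hφ, hφU⟩ := hX.exists_continuous_index
      (fun i => {x | ∃ z ∈ P x, dist z (f x) < r ∧ dist z (q i) < s}) (by
        intro i
        rw [isOpen_iff_mem_nhds]
        rintro x ⟨z, hz, h1, h2⟩
        obtain ⟨δ, hδ, hδ1, hδ2⟩ : ∃ δ > 0, dist z (f x) + δ + δ ≤ r ∧ dist z (q i) + δ ≤ s := by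
          refine ⟨min ((r - dist z (f x)) / 2) (s - dist z (q i)), ?_, ?_, ?_⟩
          · exact lt_min (by linarith) (by linarith)
          · linarith [min_le_left ((r - dist z (f x)) / 2) (s - dist z (q i))]
          · linarith [min_le_right ((r - dist z (f x)) / 2) (s - dist z (q i))]
        filter_upwards [hl' x z hz δ hδ, Metric.tendsto_nhds.1 hf.continuousAt δ hδ]
          with y ⟨z', hz', hd⟩ hfy
        refine ⟨z', hz', ?_, ?_⟩
        · have := dist_triangle4 z' z (f x) (f y)
          rw [dist_comm (f x)] at this
          linarith
        · linarith [dist_triangle z' z (q i)]) (by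
        intro x
        obtain ⟨z, hz, h1⟩ := hfr x
        obtain ⟨i, hi⟩ := (denseRange_denseSeq Z).exists_dist_lt z hs
        exact ⟨i, z, hz, h1, hi⟩)
    refine ⟨fun x => q (φ x), (continuous_of_discreteTopology (f := q)).comp hφ, ?_, ?_⟩
    · intro x
      obtain ⟨z, hz, -, h⟩ := hφU x
      exact ⟨z, hz, h⟩
    · intro x
      obtain ⟨z, hz, h1, h2⟩ := hφU x
      have := dist_triangle (f x) z (q (φ x))
      rw [dist_comm (f x) z] at this
      linarith
  let S : ℕ → Type _ := fun j =>
    {f : X → Z // Continuous f ∧ ∀ x, ∃ z ∈ P x, dist z (f x) < (1 / 2 : ℝ) ^ j}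
  have hpos : ∀ j : ℕ, (0 : ℝ) < (1 / 2) ^ j := fun j => by positivity
  have h0 : Nonempty (S 0) := by
    obtain ⟨φ, hφ, hφU⟩ := hX.exists_continuous_index
      (fun i => {x | ∃ z ∈ P x, dist z (q i) < 1}) (by
        intro i
        rw [isOpen_iff_mem_nhds]
        rintro x ⟨z, hz, h1⟩
        filter_upwards [hl' x z hz (1 - dist z (q i)) (by linarith)] with y ⟨z', hz', hd⟩
        exact ⟨z', hz', by linarith [dist_triangle z' z (q i)]⟩) (by
        intro x
        obtain ⟨z, hz⟩ := hne x
        obtain ⟨i, hi⟩ := (denseRange_denseSeq Z).exists_dist_lt z one_pos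
        exact ⟨i, z, hz, hi⟩)
    exact ⟨⟨fun x => q (φ x), (continuous_of_discreteTopology (f := q)).comp hφ,
      fun x => by simpa using hφU x⟩⟩
  choose! g hgc hg1 hg2 using step
  let F : (j : ℕ) → S j := fun j => Nat.rec h0.some
    (fun j f => ⟨g ((1 / 2) ^ j) ((1 / 2) ^ (j + 1)) f.1,
      hgc _ _ (hpos _) _ f.2.1 f.2.2, hg1 _ _ (hpos _) _ f.2.1 f.2.2⟩) j
  have hstep : ∀ j x, dist ((F j).1 x) ((F (j + 1)).1 x) ≤ 2 / 1 * (1 / 2 : ℝ) ^ j := by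
    intro j x
    have := hg2 _ _ (hpos (j + 1)) _ (F j).2.1 (F j).2.2 x
    have h2 : (1 / 2 : ℝ) ^ (j + 1) = (1 / 2) ^ j / 2 := by rw [pow_succ]; ring
    have := hpos j
    show dist ((F j).1 x) (g ((1 / 2) ^ j) ((1 / 2) ^ (j + 1)) (F j).1 x) ≤ _
    linarith
  have hcau : ∀ x, CauchySeq fun j => (F j).1 x := fun x =>
    cauchySeq_of_le_geometric (1 / 2) _ (by norm_num) (fun j => hstep j x)
  choose f hf using fun x => cauchySeq_tendsto_of_complete (hcau x)
  have hdist : ∀ j x, dist ((F j).1 x) (f x) ≤ 2 / 1 * (1 / 2 : ℝ) ^ j / (1 - 1 / 2) := fun j x =>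
    dist_le_of_le_geometric_of_tendsto (1 / 2) _ (by norm_num) (fun j => hstep j x) (hf x) j
  have hlim : Tendsto (fun j : ℕ => 2 / 1 * (1 / 2 : ℝ) ^ j / (1 - 1 / 2)) atTop (𝓝 0) := by
    have := ((tendsto_pow_atTop_nhds_zero_of_lt_one (r := (1 / 2 : ℝ)) (by norm_num)
      (by norm_num)).const_mul (2 / 1 : ℝ)).div_const (1 - 1 / 2)
    simpa using this
  have hunif : TendstoUniformly (fun j => (F j).1) f atTop := by
    rw [Metric.tendstoUniformly_iff]
    intro ε hε
    filter_upwards [hlim.eventually (gt_mem_nhds hε)] with j hj x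
    rw [dist_comm]
    exact (hdist j x).trans_lt hj
  refine ⟨f, hunif.continuous (Frequently.of_forall fun j => (F j).2.1), fun x => ?_⟩
  choose z hz hzd using fun j => (F j).2.2 x
  refine (hcl x).mem_of_tendsto (b := atTop) (f := z) ?_ (Eventually.of_forall hz)
  refine (hf x).congr_dist ?_
  refine squeeze_zero (fun _ => dist_nonneg) (fun j => ?_)
    (tendsto_pow_atTop_nhds_zero_of_lt_one (r := (1 / 2 : ℝ)) (by norm_num) (by norm_num))
  rw [dist_comm]
  exact (hzd j).le

/-- A set-valued map with nonempty values that is lower hemicontinuous and has closed graph.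
With values in a compact metric space this is continuity for the Hausdorff distance. -/
structure IsContinuousMulti {X Z : Type*} [TopologicalSpace X] [TopologicalSpace Z]
    (P : X → Set Z) : Prop where
  nonempty : ∀ x, (P x).Nonempty
  isClosed_graph : IsClosed {p : X × Z | p.2 ∈ P p.1}
  lower : LowerHemicontinuous P

lemma IsContinuousMulti.comp {X Y Z : Type*} [TopologicalSpace X] [TopologicalSpace Y]
    [TopologicalSpace Z] {P : Y → Set Z} (hP : IsContinuousMulti P) {f : X → Y}
    (hf : Continuous f) : IsContinuousMulti fun x => P (f x) where
  nonempty x := hP.nonempty _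
  isClosed_graph := hP.isClosed_graph.preimage (hf.prodMap continuous_id)
  lower x := by
    refine lowerHemicontinuousAt_iff.2 fun u hu h => ?_
    exact hf.continuousAt.eventually (lowerHemicontinuousAt_iff.1 (hP.lower (f x)) u hu h)

lemma isContinuousMulti_univ (X : Type*) {Z : Type*} [TopologicalSpace X] [TopologicalSpace Z]
    [Nonempty Z] : IsContinuousMulti (fun _ : X => (univ : Set Z)) where
  nonempty _ := univ_nonempty
  isClosed_graph := by simp
  lower := LowerHemicontinuous.const

lemma isClosed_fiber {X Z : Type*} [TopologicalSpace X] [TopologicalSpace Z] {P : X → Set Z}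
    (h : IsClosed {p : X × Z | p.2 ∈ P p.1}) (x : X) : IsClosed (P x) :=
  h.preimage (Continuous.prodMk_right x)

/-- A continuous function can be moved into a continuous set-valued map without touching it where
its value is already admissible: select from `{g x}` where `g x ∈ P x` and from `P x` elsewhere. -/
theorem ZeroDim.exists_correction {X : Type*} [TopologicalSpace X] [SecondCountableTopology X]
    (hX : ZeroDim X) {Z : Type*} [MetricSpace Z] [CompactSpace Z]
    {P : X → Set Z} (hP : IsContinuousMulti P) {g : X → Z} (hg : Continuous g) :
    ∃ f : X → Z, Continuous f ∧ (∀ x, f x ∈ P x) ∧ ∀ x, g x ∈ P x → f x = g x := by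
  classical
  rcases isEmpty_or_nonempty X with hE | ⟨⟨x₀⟩⟩
  · exact ⟨g, hg, fun x => (hE.false x).elim, fun x => (hE.false x).elim⟩
  have : Nonempty Z := ⟨g x₀⟩
  have hl := lhc_iff_ball.1 hP.lower
  obtain ⟨f, hf, hfP⟩ := hX.exists_selection (fun x => if g x ∈ P x then {g x} else P x)
    (fun x => by split_ifs; exacts [singleton_nonempty _, hP.nonempty x])
    (fun x => by split_ifs; exacts [isClosed_singleton, isClosed_fiber hP.isClosed_graph x])
    (by
      rw [lhc_iff_ball]
      intro x z hz ε hε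
      by_cases hx : g x ∈ P x
      · rw [if_pos hx, mem_singleton_iff] at hz
        subst hz
        filter_upwards [hl x _ hx ε hε, Metric.tendsto_nhds.1 hg.continuousAt ε hε]
          with y ⟨z', hz', hd⟩ hgy
        by_cases hy : g y ∈ P y
        · exact ⟨g y, by simp [hy], hgy⟩
        · exact ⟨z', by simpa [hy] using hz', hd⟩
      · rw [if_neg hx] at hz
        have hopen : IsOpen {y | g y ∉ P y} :=
          (hP.isClosed_graph.preimage (continuous_id.prodMk hg)).isOpen_compl
        filter_upwards [hl x z hz ε hε, hopen.mem_nhds hx] with y ⟨z', hz', hd⟩ hy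
        exact ⟨z', by simpa [show g y ∉ P y from hy] using hz', hd⟩)
  refine ⟨f, hf, fun x => ?_, fun x hx => ?_⟩
  · have := hfP x
    split_ifs at this with h
    · rw [mem_singleton_iff.1 this]; exact h
    · exact this
  · simpa [hx] using hfP x

/-! ### Names of reals, tuples and games -/

/-- The rational approximations read off from a sequence, each one truncated to within `2 · 2^-i` of
its predecessor. The truncation forces convergence for every sequence and is invisible on names. -/
noncomputable def approx (ν : ℕ ≃ ℚ) (w : Baire) : ℕ → ℝ
  | 0 => ν (w 0)
  | i + 1 => max (approx ν w i - 2 * (1 / 2) ^ i) (min (approx ν w i + 2 * (1 / 2) ^ i) (ν (w (i + 1))))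

lemma dist_approx_succ (ν : ℕ ≃ ℚ) (w : Baire) (i : ℕ) :
    dist (approx ν w i) (approx ν w (i + 1)) ≤ 2 * (1 / 2) ^ i := by
  have : (0 : ℝ) < (1 / 2) ^ i := by positivity
  rw [Real.dist_eq, abs_le, approx]
  constructor
  · have : max (approx ν w i - 2 * (1 / 2) ^ i) (min (approx ν w i + 2 * (1 / 2) ^ i) (ν (w (i + 1))))
        ≤ approx ν w i + 2 * (1 / 2) ^ i := max_le (by linarith) (min_le_left _ _)
    linarith
  · linarith [le_max_left (approx ν w i - 2 * (1 / 2) ^ i)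
      (min (approx ν w i + 2 * (1 / 2) ^ i) (ν (w (i + 1)) : ℝ))]

lemma cauchySeq_approx (ν : ℕ ≃ ℚ) (w : Baire) : CauchySeq (approx ν w) :=
  cauchySeq_of_le_geometric (1 / 2) 2 (by norm_num) (dist_approx_succ ν w)

/-- A total decoding of sequences as reals: the named real on names, some real elsewhere. -/
noncomputable def realVal (ν : ℕ ≃ ℚ) (w : Baire) : ℝ :=
  (cauchySeq_tendsto_of_complete (cauchySeq_approx ν w)).choose

lemma tendsto_approx (ν : ℕ ≃ ℚ) (w : Baire) :
    Tendsto (approx ν w) atTop (𝓝 (realVal ν w)) :=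
  (cauchySeq_tendsto_of_complete (cauchySeq_approx ν w)).choose_spec

lemma tendsto_half_pow : Tendsto (fun i : ℕ => (1 / 2 : ℝ) ^ i) atTop (𝓝 0) :=
  tendsto_pow_atTop_nhds_zero_of_lt_one (by norm_num) (by norm_num)

lemma IsRealName.realVal_eq {ν : ℕ ≃ ℚ} {w : Baire} {x : ℝ} (h : IsRealName ν w x) :
    realVal ν w = x := by
  have key : ∀ i, approx ν w i = ν (w i) := by
    intro i
    induction i with
    | zero => rfl
    | succ i ih =>
      have h1 := abs_le.1 (h i)
      have h2 := abs_le.1 (h (i + 1))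
      rw [pow_succ] at h2
      have h3 : (0 : ℝ) < (1 / 2) ^ i := by positivity
      rw [approx, ih, min_eq_right (by linarith), max_eq_right (by linarith)]
  refine tendsto_nhds_unique (tendsto_approx ν w) ?_
  rw [tendsto_iff_dist_tendsto_zero]
  refine squeeze_zero (fun _ => dist_nonneg) (fun i => ?_) tendsto_half_pow
  rw [key, Real.dist_eq]
  exact h i

lemma IsRealName.unique {ν : ℕ ≃ ℚ} {w : Baire} {x y : ℝ} (hx : IsRealName ν w x)
    (hy : IsRealName ν w y) : x = y :=
  hx.realVal_eq.symm.trans hy.realVal_eq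

lemma continuous_realVal (ν : ℕ ≃ ℚ) : Continuous (realVal ν) := by
  have hunif : TendstoUniformly (fun i w => approx ν w i) (realVal ν) atTop := by
    rw [Metric.tendstoUniformly_iff]
    intro ε hε
    have hlim : Tendsto (fun j : ℕ => 2 * (1 / 2 : ℝ) ^ j / (1 - 1 / 2)) atTop (𝓝 0) := by
      simpa using (tendsto_half_pow.const_mul (2 : ℝ)).div_const (1 - 1 / 2)
    filter_upwards [hlim.eventually (gt_mem_nhds hε)] with j hj w
    rw [dist_comm]
    exact (dist_le_of_le_geometric_of_tendsto (1 / 2) 2 (by norm_num) (dist_approx_succ ν w)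
      (tendsto_approx ν w) j).trans_lt hj
  refine hunif.continuous (Frequently.of_forall fun i => ?_)
  have hν : ∀ i, Continuous fun w : Baire => ((ν (w i) : ℚ) : ℝ) := fun i =>
    (continuous_of_discreteTopology (f := fun k : ℕ => ((ν k : ℚ) : ℝ))).comp (continuous_apply i)
  induction i with
  | zero => exact hν 0
  | succ i ih =>
    simp only [approx]
    exact (ih.sub continuous_const).max ((ih.add continuous_const).min (hν (i + 1)))

/-- Continuous real functions on a zero-dimensional space have continuous realizers. -/
lemma ZeroDim.exists_realName {X : Type*} [TopologicalSpace X] [SecondCountableTopology X]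
    (hX : ZeroDim X) (ν : ℕ ≃ ℚ) {f : X → ℝ} (hf : Continuous f) :
    ∃ g : X → Baire, Continuous g ∧ ∀ x, IsRealName ν (g x) (f x) := by
  have : ∀ i : ℕ, ∃ φ : X → ℕ, Continuous φ ∧ ∀ x, |((ν (φ x) : ℚ) : ℝ) - f x| < (1 / 2 : ℝ) ^ i := by
    intro i
    have hi : (0 : ℝ) < (1 / 2) ^ i := by positivity
    refine hX.exists_continuous_index (fun k => {x | |((ν k : ℚ) : ℝ) - f x| < (1 / 2 : ℝ) ^ i})
      (fun k => isOpen_lt (by fun_prop) continuous_const) fun x => ?_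
    obtain ⟨r, hr1, hr2⟩ := exists_rat_btwn (show f x < f x + (1 / 2 : ℝ) ^ i by linarith)
    refine ⟨ν.symm r, ?_⟩
    simp only [Equiv.apply_symm_apply, mem_ofPred_eq, abs_lt]
    constructor <;> linarith
  choose φ hφ h using this
  exact ⟨fun x i => φ i x, continuous_pi hφ, fun x i => (h i x).le⟩

lemma exists_realName (ν : ℕ ≃ ℚ) (x : ℝ) : ∃ w, IsRealName ν w x := by
  obtain ⟨g, -, hg⟩ := (zeroDim_of_discrete Unit).exists_realName ν
    (f := fun _ => x) continuous_const
  exact ⟨g (), hg ()⟩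

/-- The code `⟨w_0, …, w_{k-1}⟩` of a tuple; the entries from `k` on are ignored. -/
def interleave (k : ℕ) (w : ℕ → Baire) : Baire := fun i => w (i % k) (i / k)

lemma component_interleave {k j : ℕ} (hj : j < k) (w : ℕ → Baire) :
    component k j (interleave k w) = w j := by
  funext i
  simp only [component, interleave]
  rw [Nat.mul_add_mod, Nat.mod_eq_of_lt hj, Nat.mul_add_div (by omega), Nat.div_eq_of_lt hj,
    add_zero]

lemma continuous_interleave (k : ℕ) : Continuous (interleave k) := by
  refine continuous_pi fun i => ?_
  exact (continuous_apply (i / k)).comp (continuous_apply (i % k))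

lemma continuous_component (k j : ℕ) : Continuous (component k j) :=
  continuous_pi fun i => continuous_apply (k * i + j)

/-- The code `⟨u, v⟩` of a pair. -/
def pair (u v : Baire) : Baire := interleave 2 fun j => if j = 0 then u else v

@[simp] lemma component_zero_pair (u v : Baire) : component 2 0 (pair u v) = u :=
  component_interleave (by norm_num) _

@[simp] lemma component_one_pair (u v : Baire) : component 2 1 (pair u v) = v :=
  component_interleave (by norm_num) _

lemma Continuous.pair {X : Type*} [TopologicalSpace X] {u v : X → Baire} (hu : Continuous u)
    (hv : Continuous v) : Continuous fun x => pair (u x) (v x) := by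
  refine (continuous_interleave 2).comp (continuous_pi fun j => ?_)
  split_ifs
  exacts [hu, hv]

/-- Prefix the header `0^n 1^m 0`. -/
def withHeader (n m : ℕ) (u : Baire) : Baire := fun i =>
  if i < n then 0 else if i < n + m then 1 else if i = n + m then 0 else u (i - (n + m + 1))

lemma hasHeader_withHeader {n m : ℕ} (hn : 0 < n) (hm : 0 < m) (u : Baire) :
    HasHeader n m (withHeader n m u) := by
  refine ⟨hn, hm, fun i hi => ?_, fun i hi => ?_, ?_⟩ <;> simp [withHeader]
  · omega
  · omega

@[simp] lemma payload_withHeader (n m : ℕ) (u : Baire) : payload n m (withHeader n m u) = u := by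
  funext i
  simp only [payload, withHeader]
  rw [if_neg (by omega), if_neg (by omega), if_neg (by omega)]
  congr 1; omega

lemma continuous_withHeader (n m : ℕ) : Continuous (withHeader n m) := by
  refine continuous_pi fun i => ?_
  simp only [withHeader]
  split_ifs
  exacts [continuous_const, continuous_const, continuous_const, continuous_apply _]

lemma continuous_payload (n m : ℕ) : Continuous (payload n m) :=
  continuous_pi fun _ => continuous_apply _

lemma HasHeader.unique {n m n' m' : ℕ} {w : Baire} (h : HasHeader n m w)
    (h' : HasHeader n' m' w) : n = n' ∧ m = m' := by
  obtain ⟨-, hm, h0, h1, h2⟩ := h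
  obtain ⟨-, hm', h0', h1', h2'⟩ := h'
  have hn : n = n' := by
    rcases lt_trichotomy n n' with hlt | rfl | hlt
    · have := h1 0 hm
      rw [add_zero, h0' n hlt] at this
      omega
    · rfl
    · have := h1' 0 hm'
      rw [add_zero, h0 n' hlt] at this
      omega
  subst hn
  refine ⟨rfl, ?_⟩
  rcases lt_trichotomy m m' with hlt | rfl | hlt
  · have := h1' m hlt
    omega
  · rfl
  · have := h1 m' hlt
    omega

lemma isOpen_hasHeader (n m : ℕ) : IsOpen {w | HasHeader n m w} := by
  have h : ∀ i a : ℕ, IsOpen {w : Baire | w i = a} := fun i a =>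
    by
    have hc : Continuous fun w : Baire => w i := continuous_apply i
    exact (isOpen_discrete ({a} : Set ℕ)).preimage hc
  have : {w | HasHeader n m w} = {w | 0 < n ∧ 0 < m} ∩
      ((⋂ i ∈ Finset.range n, {w : Baire | w i = 0}) ∩
      ((⋂ i ∈ Finset.range m, {w : Baire | w (n + i) = 1}) ∩ {w | w (n + m) = 0})) := by
    ext w
    simp [HasHeader, and_assoc]
  rw [this]
  exact isOpen_const.inter ((isOpen_biInter_finset fun i _ => h i 0).inter
    ((isOpen_biInter_finset fun i _ => h (n + i) 1).inter (h (n + m) 0)))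

/-- The matrix coded by a sequence. -/
noncomputable def matrixVal (ν : ℕ ≃ ℚ) (n m : ℕ) (w : Baire) : Matrix (Fin n) (Fin m) ℝ :=
  fun i j => realVal ν (component (n * m) (i + n * j) w)

/-- The vector coded by a sequence. -/
noncomputable def vectorVal (ν : ℕ ≃ ℚ) (n : ℕ) (w : Baire) : Fin n → ℝ :=
  fun i => realVal ν (component n i w)

lemma IsMatrixName.matrixVal_eq {ν : ℕ ≃ ℚ} {n m : ℕ} {w : Baire} {A : Matrix (Fin n) (Fin m) ℝ}
    (h : IsMatrixName ν w A) : matrixVal ν n m w = A := by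
  ext i j
  exact (h i j).realVal_eq

lemma IsVectorName.vectorVal_eq {ν : ℕ ≃ ℚ} {n : ℕ} {w : Baire} {x : Fin n → ℝ}
    (h : IsVectorName ν w x) : vectorVal ν n w = x := by
  ext i
  exact (h i).realVal_eq

lemma continuous_matrixVal (ν : ℕ ≃ ℚ) (n m : ℕ) : Continuous (matrixVal ν n m) :=
  continuous_pi fun _ => continuous_pi fun _ => (continuous_realVal ν).comp (continuous_component _ _)

lemma continuous_vectorVal (ν : ℕ ≃ ℚ) (n : ℕ) : Continuous (vectorVal ν n) :=
  continuous_pi fun _ => (continuous_realVal ν).comp (continuous_component _ _)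

lemma matrix_index_lt {n m : ℕ} (i : Fin n) (j : Fin m) : (i : ℕ) + n * j < n * m := by
  have h1 := i.2
  have h2 := j.2
  calc (i : ℕ) + n * j < n + n * j := by omega
    _ = n * (j + 1) := by ring
    _ ≤ n * m := Nat.mul_le_mul_left n h2

lemma ZeroDim.exists_vectorName {X : Type*} [TopologicalSpace X] [SecondCountableTopology X]
    (hX : ZeroDim X) (ν : ℕ ≃ ℚ) {n : ℕ} {f : X → Fin n → ℝ} (hf : Continuous f) :
    ∃ g : X → Baire, Continuous g ∧ ∀ x, IsVectorName ν (g x) (f x) := by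
  choose g hg h using fun i => hX.exists_realName ν ((continuous_apply i).comp hf)
  refine ⟨fun x => interleave n fun k => if hk : k < n then g ⟨k, hk⟩ x else 0, ?_, fun x i => ?_⟩
  · refine (continuous_interleave n).comp (continuous_pi fun k => ?_)
    split_ifs
    exacts [hg _, continuous_const]
  · rw [component_interleave i.2]
    simpa using h i x

lemma ZeroDim.exists_matrixName {X : Type*} [TopologicalSpace X] [SecondCountableTopology X]
    (hX : ZeroDim X) (ν : ℕ ≃ ℚ) {n m : ℕ} {f : X → Matrix (Fin n) (Fin m) ℝ}
    (hf : Continuous f) :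
    ∃ g : X → Baire, Continuous g ∧ ∀ x, IsMatrixName ν (g x) (f x) := by
  choose g hg h using fun (i : Fin n) (j : Fin m) => hX.exists_realName ν (hf.matrix_elem i j)
  refine ⟨fun x => interleave (n * m) fun k => if hk : k % n < n ∧ k / n < m then
    g ⟨k % n, hk.1⟩ ⟨k / n, hk.2⟩ x else 0, ?_, fun x i j => ?_⟩
  · refine (continuous_interleave _).comp (continuous_pi fun k => ?_)
    split_ifs
    exacts [hg _ _, continuous_const]
  · have hn : 0 < n := i.pos
    have h1 : ((i : ℕ) + n * j) % n = i := by
      rw [Nat.add_mul_mod_self_left, Nat.mod_eq_of_lt i.2]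
    have h2 : ((i : ℕ) + n * j) / n = j := by
      rw [Nat.add_mul_div_left _ _ hn, Nat.div_eq_of_lt i.2, zero_add]
    rw [component_interleave (matrix_index_lt i j)]
    simp only [h1, h2]
    simpa using h i j x

lemma ZeroDim.exists_gameName {X : Type*} [TopologicalSpace X] [SecondCountableTopology X]
    (hX : ZeroDim X) (ν : ℕ ≃ ℚ) {n m : ℕ} (hn : 0 < n) (hm : 0 < m)
    {A B : X → Matrix (Fin n) (Fin m) ℝ} (hA : Continuous A) (hB : Continuous B) :
    ∃ g : X → Baire, Continuous g ∧ ∀ x, IsGameName ν (g x) (A x) (B x) := by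
  obtain ⟨a, ha, haA⟩ := hX.exists_matrixName ν hA
  obtain ⟨b, hb, hbB⟩ := hX.exists_matrixName ν hB
  exact ⟨fun x => withHeader n m (pair (a x) (b x)),
    (continuous_withHeader n m).comp (Continuous.pair ha hb), fun x =>
      ⟨hasHeader_withHeader hn hm _, by simpa using haA x, by simpa using hbB x⟩⟩

lemma ZeroDim.exists_profileName {X : Type*} [TopologicalSpace X] [SecondCountableTopology X]
    (hX : ZeroDim X) (ν : ℕ ≃ ℚ) {n m : ℕ} (hn : 0 < n) (hm : 0 < m)
    {x : X → Fin n → ℝ} {y : X → Fin m → ℝ} (hx : Continuous x) (hy : Continuous y) :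
    ∃ g : X → Baire, Continuous g ∧ ∀ t, IsProfileName ν (g t) (x t) (y t) := by
  obtain ⟨a, ha, haA⟩ := hX.exists_vectorName ν hx
  obtain ⟨b, hb, hbB⟩ := hX.exists_vectorName ν hy
  exact ⟨fun x => withHeader n m (pair (a x) (b x)),
    (continuous_withHeader n m).comp (Continuous.pair ha hb), fun x =>
      ⟨hasHeader_withHeader hn hm _, by simpa using haA x, by simpa using hbB x⟩⟩

lemma ZeroDim.exists_jointName {X : Type*} [TopologicalSpace X] [SecondCountableTopology X]
    (hX : ZeroDim X) (ν : ℕ ≃ ℚ) {n m : ℕ} (hn : 0 < n) (hm : 0 < m)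
    {C : X → Matrix (Fin n) (Fin m) ℝ} (hC : Continuous C) :
    ∃ g : X → Baire, Continuous g ∧ ∀ x, IsJointName ν (g x) (C x) := by
  obtain ⟨a, ha, haA⟩ := hX.exists_matrixName ν hC
  exact ⟨fun x => withHeader n m (a x), (continuous_withHeader n m).comp ha, fun x =>
      ⟨hasHeader_withHeader hn hm _, by simpa using haA x⟩⟩

/-- The first and second payoff matrix of the game coded by a sequence. -/
noncomputable def gameVal (ν : ℕ ≃ ℚ) (n m : ℕ) (w : Baire) :
    Matrix (Fin n) (Fin m) ℝ × Matrix (Fin n) (Fin m) ℝ :=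
  (matrixVal ν n m (component 2 0 (payload n m w)), matrixVal ν n m (component 2 1 (payload n m w)))

lemma continuous_gameVal (ν : ℕ ≃ ℚ) (n m : ℕ) : Continuous (gameVal ν n m) :=
  ((continuous_matrixVal ν n m).comp
    ((continuous_component 2 0).comp (continuous_payload n m))).prodMk
  ((continuous_matrixVal ν n m).comp
    ((continuous_component 2 1).comp (continuous_payload n m)))

lemma IsGameName.gameVal_eq {ν : ℕ ≃ ℚ} {n m : ℕ} {w : Baire} {A B : Matrix (Fin n) (Fin m) ℝ}
    (h : IsGameName ν w A B) : gameVal ν n m w = (A, B) :=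
  Prod.ext h.2.1.matrixVal_eq h.2.2.matrixVal_eq

/-- The pair of vectors coded by a sequence. -/
noncomputable def profileVal (ν : ℕ ≃ ℚ) (n m : ℕ) (w : Baire) : (Fin n → ℝ) × (Fin m → ℝ) :=
  (vectorVal ν n (component 2 0 (payload n m w)), vectorVal ν m (component 2 1 (payload n m w)))

lemma continuous_profileVal (ν : ℕ ≃ ℚ) (n m : ℕ) : Continuous (profileVal ν n m) :=
  ((continuous_vectorVal ν n).comp
    ((continuous_component 2 0).comp (continuous_payload n m))).prodMk
  ((continuous_vectorVal ν m).comp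
    ((continuous_component 2 1).comp (continuous_payload n m)))

lemma IsProfileName.profileVal_eq {ν : ℕ ≃ ℚ} {n m : ℕ} {w : Baire} {x : Fin n → ℝ}
    {y : Fin m → ℝ} (h : IsProfileName ν w x y) : profileVal ν n m w = (x, y) :=
  Prod.ext h.2.1.vectorVal_eq h.2.2.vectorVal_eq

/-- The matrix named by a sequence with header. -/
noncomputable def jointVal (ν : ℕ ≃ ℚ) (n m : ℕ) (w : Baire) : Matrix (Fin n) (Fin m) ℝ :=
  matrixVal ν n m (payload n m w)

lemma continuous_jointVal (ν : ℕ ≃ ℚ) (n m : ℕ) : Continuous (jointVal ν n m) :=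
  (continuous_matrixVal ν n m).comp (continuous_payload n m)

lemma IsJointName.jointVal_eq {ν : ℕ ≃ ℚ} {n m : ℕ} {w : Baire} {C : Matrix (Fin n) (Fin m) ℝ}
    (h : IsJointName ν w C) : jointVal ν n m w = C :=
  h.2.matrixVal_eq

/-! ### Parallel powers of a problem -/

/-- The `k`-th component, `k ≤ n`, of an instance or solution of `power P n`. -/
def part : ℕ → ℕ → Baire → Baire
  | 0, _, w => w
  | _ + 1, 0, w => component 2 0 w
  | n + 1, k + 1, w => part n k (component 2 1 w)

/-- The instance of `power P n` with prescribed components. -/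
def join : ℕ → (ℕ → Baire) → Baire
  | 0, v => v 0
  | n + 1, v => pair (v 0) (join n fun k => v (k + 1))

lemma part_join {n k : ℕ} (hk : k ≤ n) (v : ℕ → Baire) : part n k (join n v) = v k := by
  induction n generalizing k v with
  | zero => obtain rfl : k = 0 := by omega
            rfl
  | succ n ih =>
    cases k with
    | zero => simp [part, join]
    | succ k =>
      simp only [part, join, component_one_pair]
      exact ih (by omega) _

lemma mem_power_iff (P : MultiFun) (n : ℕ) (w z : Baire) :
    z ∈ power P n w ↔ ∀ k ≤ n, part n k z ∈ P (part n k w) := by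
  induction n generalizing w z with
  | zero => simp [power, part]
  | succ n ih =>
    constructor
    · rintro ⟨h1, h2⟩ k hk
      cases k with
      | zero => exact h1
      | succ k => exact (ih _ _).1 h2 k (by omega)
    · intro h
      exact ⟨h 0 (by omega), (ih _ _).2 fun k hk => h (k + 1) (by omega)⟩

lemma continuous_part (n k : ℕ) : Continuous (part n k) := by
  induction n generalizing k with
  | zero => exact continuous_id
  | succ n ih =>
    cases k with
    | zero => exact continuous_component 2 0
    | succ k => exact (ih k).comp (continuous_component 2 1)

lemma continuous_join (n : ℕ) : Continuous (join n) := by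
  induction n with
  | zero => exact continuous_apply 0
  | succ n ih =>
    exact Continuous.pair (continuous_apply 0)
      (ih.comp (continuous_pi fun k => continuous_apply (k + 1)))

lemma power_nonempty_iff (P : MultiFun) (n : ℕ) (w : Baire) :
    (power P n w).Nonempty ↔ ∀ k ≤ n, part n k w ∈ dom P := by
  constructor
  · rintro ⟨z, hz⟩ k hk
    exact ⟨_, (mem_power_iff P n w z).1 hz k hk⟩
  · intro h
    choose! z hz using h
    exact ⟨join n z, (mem_power_iff P n w _).2 fun k hk => by rw [part_join hk]; exact hz k hk⟩

/-! ### Reductions -/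

/-- Pointwise form of reducibility: the forward map only has to be continuous on instances, the
backward map only on pairs of an instance and a solution of its translation. -/
lemma reducible_of_continuousOn {P Q : MultiFun} (G : Baire → Baire) (F : Baire × Baire → Baire)
    (hG : ContinuousOn G (dom P)) (hGQ : ∀ w ∈ dom P, G w ∈ dom Q)
    (hF : ContinuousOn F {p | p.1 ∈ dom P ∧ p.2 ∈ Q (G p.1)})
    (hFP : ∀ w ∈ dom P, ∀ z ∈ Q (G w), F (w, z) ∈ P w) : Reducible P Q :=
  ⟨_, F, _, G, hF, hG, fun _ hg w hw =>
    ⟨hw, hGQ w hw, ⟨hw, hg _ (hGQ w hw)⟩, hFP w hw _ (hg _ (hGQ w hw))⟩⟩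

lemma Reducible.trans {P Q R : MultiFun} (h1 : Reducible P Q) (h2 : Reducible Q R) :
    Reducible P R := by
  obtain ⟨DF, F, DG, G, hF, hG, h⟩ := h1
  obtain ⟨DF', F', DG', G', hF', hG', h'⟩ := h2
  refine ⟨{p | p.1 ∈ DG ∧ (G p.1, p.2) ∈ DF' ∧ (p.1, F' (G p.1, p.2)) ∈ DF},
    fun p => F (p.1, F' (G p.1, p.2)), {w | w ∈ DG ∧ G w ∈ DG'}, fun w => G' (G w), ?_, ?_, ?_⟩
  · have hc : ContinuousOn (fun p : Baire × Baire => (G p.1, p.2))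
        {p | p.1 ∈ DG ∧ (G p.1, p.2) ∈ DF' ∧ (p.1, F' (G p.1, p.2)) ∈ DF} :=
      (hG.comp continuousOn_fst fun p hp => hp.1).prodMk continuousOn_snd
    exact hF.comp (continuousOn_fst.prodMk (hF'.comp hc fun p hp => hp.2.1)) fun p hp => hp.2.2
  · exact hG'.comp (hG.mono fun w hw => hw.1) fun w hw => hw.2
  · intro g hg w hw
    have hcomp : IsChoice Q fun u => F' (u, g (G' u)) := fun u hu => (h' g hg u hu).2.2.2
    obtain ⟨a1, a2, a3, a4⟩ := h _ hcomp w hw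
    obtain ⟨b1, b2, b3, b4⟩ := h' g hg _ a2
    exact ⟨⟨a1, b1⟩, b2, ⟨a1, b3, a3⟩, a4⟩

lemma reducible_of_restriction {P Q : MultiFun} (hd : dom P ⊆ dom Q)
    (h : ∀ w ∈ dom P, Q w ⊆ P w) : Reducible P Q :=
  reducible_of_continuousOn id Prod.snd continuousOn_id hd continuousOn_snd
    fun w hw _ hz => h w hw hz

/-- A reduction may be given separately on the pieces of a partition of the instances into
relatively open sets `{w | κ w = i}`. -/
lemma reducible_of_pieces {P Q : MultiFun} {ι : Type*} (κ : Baire → ι)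
    (hκ : ∀ w ∈ dom P, ∀ᶠ w' in 𝓝 w, κ w' = κ w)
    (h : ∀ i, ∃ G : {w // w ∈ dom P ∧ κ w = i} → Baire, Continuous G ∧ (∀ w, G w ∈ dom Q) ∧
      ∃ F : {p : {w // w ∈ dom P ∧ κ w = i} × Baire // p.2 ∈ Q (G p.1)} → Baire,
        Continuous F ∧ ∀ p, F p ∈ P p.1.1) : Reducible P Q := by
  classical
  choose G hG hGQ F hF hFP using h
  let G' : Baire → Baire := fun w => if hw : w ∈ dom P then G (κ w) ⟨w, hw, rfl⟩ else w
  have hG' : ∀ i (w : {w // w ∈ dom P ∧ κ w = i}), G' w.1 = G i w := by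
    rintro i ⟨w, hw, rfl⟩
    simp [G', hw]
  let F' : Baire × Baire → Baire := fun p =>
    if hp : p.1 ∈ dom P ∧ p.2 ∈ Q (G' p.1) then
      F (κ p.1) ⟨(⟨p.1, hp.1, rfl⟩, p.2), by
        have := hp.2; rwa [hG' _ ⟨p.1, hp.1, rfl⟩] at this⟩ else p.1
  have hF' : ∀ i (p : {p : {w // w ∈ dom P ∧ κ w = i} × Baire // p.2 ∈ Q (G i p.1)}),
      F' (p.1.1.1, p.1.2) = F i p := by
    rintro i ⟨⟨⟨w, hw, rfl⟩, z⟩, hp⟩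
    have : w ∈ dom P ∧ z ∈ Q (G' w) := ⟨hw, by rw [hG' _ ⟨w, hw, rfl⟩]; exact hp⟩
    simp only [F', dif_pos this]
  refine reducible_of_continuousOn G' F' ?_ ?_ ?_ ?_
  · intro w hw
    have h1 : ContinuousOn G' {v | v ∈ dom P ∧ κ v = κ w} := by
      rw [continuousOn_iff_continuous_domRestrict]
      exact (hG (κ w)).congr fun v => (hG' _ v).symm
    refine (h1 w ⟨hw, rfl⟩).mono_of_mem_nhdsWithin ?_
    filter_upwards [self_mem_nhdsWithin, nhdsWithin_le_nhds (hκ w hw)] with v h1 h2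
    exact ⟨h1, h2⟩
  · intro w hw
    rw [hG' (κ w) ⟨w, hw, rfl⟩]
    exact hGQ _ _
  · rintro ⟨w, z⟩ ⟨hw, hz⟩
    have h1 : ContinuousOn F' {p | (p.1 ∈ dom P ∧ κ p.1 = κ w) ∧ p.2 ∈ Q (G' p.1)} := by
      rw [continuousOn_iff_continuous_domRestrict]
      have hc : Continuous fun p : {p : Baire × Baire |
          (p.1 ∈ dom P ∧ κ p.1 = κ w) ∧ p.2 ∈ Q (G' p.1)} =>
          (⟨(⟨p.1.1, p.2.1⟩, p.1.2), by
            have := p.2.2; rwa [hG' _ ⟨p.1.1, p.2.1⟩] at this⟩ :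
            {p : {v // v ∈ dom P ∧ κ v = κ w} × Baire // p.2 ∈ Q (G (κ w) p.1)}) :=
        Continuous.subtype_mk (((continuous_fst.comp continuous_subtype_val).subtype_mk _).prodMk
          (continuous_snd.comp continuous_subtype_val)) _
      exact ((hF (κ w)).comp hc).congr fun p => (hF' _ _).symm
    refine (h1 (w, z) ⟨⟨hw, rfl⟩, hz⟩).mono_of_mem_nhdsWithin ?_
    filter_upwards [self_mem_nhdsWithin,
      nhdsWithin_le_nhds (continuous_fst.continuousAt.eventually (hκ w hw))] with p h1 h2
    exact ⟨⟨h1.1, h2⟩, h1.2⟩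
  · intro w hw z hz
    have hz' := hz
    rw [hG' _ ⟨w, hw, rfl⟩] at hz'
    have := hFP (κ w) ⟨(⟨w, hw, rfl⟩, z), hz'⟩
    rwa [← hF'] at this

/-! ### Coding continuous set-valued maps by reals -/

/-- A continuous set-valued map into a compact metric space factors through a closed subset of
Cantor space. The bit with index `⟨i, j⟩` records whether the value comes `2 · 2^-j`-close to the
`i`-th point of a dense sequence (`true`) or stays `2^-j`-away from it (`false`). -/
lemma exists_cantor_code {Y : Type*} [TopologicalSpace Y] [SecondCountableTopology Y]
    (hY : ZeroDim Y) {Z : Type*} [MetricSpace Z] [CompactSpace Z] [Nonempty Z] {P : Y → Set Z}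
    (hP : IsContinuousMulti P) :
    ∃ (B : Set (ℕ → Bool)) (θ : Y → B) (R : B → Set Z), IsClosed B ∧ Continuous θ ∧
      IsContinuousMulti R ∧ ∀ y, R (θ y) = P y := by
  let q : ℕ → Z := fun n => denseSeq Z n.unpair.1
  let r : ℕ → ℝ := fun n => (1 / 2) ^ n.unpair.2
  have hr : ∀ n, 0 < r n := fun n => by positivity
  have hqr : ∀ (z : Z) (j : ℕ), ∃ n, r n = (1 / 2) ^ j ∧ dist z (q n) < r n := by
    intro z j
    obtain ⟨i, hi⟩ := (denseRange_denseSeq Z).exists_dist_lt z (show (0 : ℝ) < (1 / 2) ^ j by positivity)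
    exact ⟨Nat.pair i j, by simp [r], by simpa [r, q] using hi⟩
  have hl := lhc_iff_ball.1 hP.lower
  have hbit : ∀ n, ∃ β : Y → Bool, Continuous β ∧
      (∀ y, β y = false → ∀ z ∈ P y, r n ≤ dist z (q n)) ∧
      (∀ y, β y = true → ∃ z ∈ P y, dist z (q n) < 2 * r n) := by
    intro n
    obtain ⟨φ, hφ, hφU⟩ := hY.exists_continuous_index
      (fun i => if i = 0 then {y | ∀ z ∈ P y, r n < dist z (q n)}
        else {y | ∃ z ∈ P y, dist z (q n) < 2 * r n}) (by
        intro i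
        split_ifs
        · have hc : IsClosed (Prod.fst '' ({p : Y × Z | p.2 ∈ P p.1} ∩
              {p | dist p.2 (q n) ≤ r n})) :=
            isClosedMap_fst_of_compactSpace _ (hP.isClosed_graph.inter
              (isClosed_le (by fun_prop) continuous_const))
          convert hc.isOpen_compl using 1
          ext y
          simp only [Set.mem_ofPred_eq, mem_compl_iff, mem_image, mem_inter_iff, Prod.exists,
            exists_and_right, exists_eq_right, not_exists, not_and, not_le]
        · rw [isOpen_iff_mem_nhds]
          rintro y ⟨z, hz, hd⟩
          filter_upwards [hl y z hz (2 * r n - dist z (q n)) (by linarith)] with y' ⟨z', hz', hd'⟩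
          exact ⟨z', hz', by linarith [dist_triangle z' z (q n)]⟩) (by
        intro y
        by_cases h : ∀ z ∈ P y, r n < dist z (q n)
        · exact ⟨0, by simpa using h⟩
        · push Not at h
          obtain ⟨z, hz, hd⟩ := h
          exact ⟨1, by simpa using ⟨z, hz, by linarith [hr n]⟩⟩)
    refine ⟨fun y => decide (φ y ≠ 0), (continuous_of_discreteTopology
      (f := fun k : ℕ => decide (k ≠ 0))).comp hφ, fun y hy z hz => ?_, fun y hy => ?_⟩
    · have := hφU y
      rw [if_pos (by simpa using hy)] at this
      exact (this z hz).le
    · have := hφU y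
      rwa [if_neg (by simpa using hy)] at this
  choose β hβ hβ0 hβ1 using hbit
  let θ : Y → ℕ → Bool := fun y n => β n y
  have hθ : Continuous θ := continuous_pi hβ
  let R : (ℕ → Bool) → Set Z := fun b => {z | ∀ n, b n = false → r n ≤ dist z (q n)}
  have hbc : ∀ (b : ℕ → Bool) (n : ℕ), ∀ᶠ b' in 𝓝 b, b' n = b n := fun b n =>
    (continuous_apply n).continuousAt.eventually ((isOpen_discrete {b n}).mem_nhds rfl)
  have hRcl : IsClosed {p : (ℕ → Bool) × Z | p.2 ∈ R p.1} := by
    rw [← isOpen_compl_iff, isOpen_iff_mem_nhds]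
    rintro ⟨b, z⟩ hz
    simp only [mem_compl_iff, Set.mem_ofPred_eq, R, not_forall, not_le] at hz
    obtain ⟨n, hn, hd⟩ := hz
    have h1 := (continuous_fst.tendsto (b, z)).eventually (hbc b n)
    have h2 := (continuous_snd.tendsto (b, z)).eventually
      ((isOpen_lt (continuous_id.dist continuous_const) continuous_const).mem_nhds hd)
    filter_upwards [h1, h2] with p hp1 hp2
    simp only [mem_compl_iff, Set.mem_ofPred_eq, R, not_forall, not_le]
    exact ⟨n, hp1.trans hn, hp2⟩
  have hRP : ∀ y, R (θ y) = P y := by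
    intro y
    refine Subset.antisymm (fun z hz => ?_) fun z hz n hn => hβ0 n y hn z hz
    refine (isClosed_fiber hP.isClosed_graph y).closure_subset (Metric.mem_closure_iff.2 fun ε hε => ?_)
    obtain ⟨j, hj⟩ := exists_pow_lt_of_lt_one (show 0 < ε / 3 by linarith)
      (show (1 / 2 : ℝ) < 1 by norm_num)
    obtain ⟨n, hn, hd⟩ := hqr z j
    have hb : θ y n = true := by
      by_contra h
      exact absurd (hz n (by simpa using h)) (not_le.2 hd)
    obtain ⟨z', hz', hd'⟩ := hβ1 n y hb
    refine ⟨z', hz', ?_⟩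
    have := dist_triangle_right z z' (q n)
    linarith
  -- Admissible points persist in the closure of the set of codes, by compactness.
  have hlim : ∀ b ∈ closure (range θ), ∀ s : Set Z, IsClosed s →
      (∀ᶠ b' in 𝓝 b, b' ∈ range θ → (R b' ∩ s).Nonempty) → (R b ∩ s).Nonempty := by
    intro b hb s hs he
    have hc : IsClosed (Prod.fst '' ({p : (ℕ → Bool) × Z | p.2 ∈ R p.1} ∩ {p | p.2 ∈ s})) :=
      isClosedMap_fst_of_compactSpace _ (hRcl.inter (hs.preimage continuous_snd))
    have : b ∈ closure (Prod.fst '' ({p : (ℕ → Bool) × Z | p.2 ∈ R p.1} ∩ {p | p.2 ∈ s})) := by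
      rw [mem_closure_iff_frequently] at hb ⊢
      refine (hb.and_eventually he).mono fun b' hb' => ?_
      obtain ⟨z, hz, hzs⟩ := hb'.2 hb'.1
      exact ⟨(b', z), ⟨hz, hzs⟩, rfl⟩
    rw [hc.closure_eq] at this
    obtain ⟨⟨b', z⟩, ⟨hz, hzs⟩, rfl⟩ := this
    exact ⟨z, hz, hzs⟩
  refine ⟨closure (range θ), fun y => ⟨θ y, subset_closure ⟨y, rfl⟩⟩, fun b => R b.1,
    isClosed_closure, hθ.subtype_mk _, ⟨fun b => ?_, ?_, ?_⟩, hRP⟩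
  · obtain ⟨z, hz, -⟩ := hlim b.1 b.2 univ isClosed_univ (Eventually.of_forall fun b' ⟨y, hy⟩ => by
      rw [← hy, hRP, inter_univ]; exact hP.nonempty y)
    exact ⟨z, hz⟩
  · exact hRcl.preimage (continuous_subtype_val.prodMap continuous_id)
  · rw [lhc_iff_ball]
    intro b z hz ε hε
    obtain ⟨j, hj⟩ := exists_pow_lt_of_lt_one (show 0 < ε / 3 by linarith)
      (show (1 / 2 : ℝ) < 1 by norm_num)
    obtain ⟨n, hn, hd⟩ := hqr z j
    have hb : b.1 n = true := by
      by_contra h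
      exact absurd (hz n (by simpa using h)) (not_le.2 hd)
    filter_upwards [continuous_subtype_val.continuousAt.eventually (hbc b.1 n)] with b' hb'
    obtain ⟨z', hz', hd'⟩ := hlim b'.1 b'.2 (Metric.closedBall (q n) (2 * r n))
      Metric.isClosed_closedBall (by
        filter_upwards [hbc b'.1 n] with b'' hb'' ⟨y, hy⟩
        obtain ⟨z', hz', hd'⟩ := hβ1 n y (by
          show θ y n = true
          rw [hy, hb'', hb', hb])
        exact ⟨z', by rw [← hy, hRP]; exact hz', hd'.le⟩)
    refine ⟨z', hz', ?_⟩
    have := dist_triangle_right z' z (q n)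
    have h2 : dist z' (q n) ≤ 2 * r n := hd'
    linarith

/-- A continuous set-valued map into a compact metric space is coded by a continuous function into
the unit interval, in such a way that *every* sequence decodes continuously to a nonempty set: the
codes are points of the Cantor set, and sequences naming anything else are first retracted to the
closed set of names of codes. -/
lemma exists_real_code (ν : ℕ ≃ ℚ) {Y : Type*} [TopologicalSpace Y] [SecondCountableTopology Y]
    (hY : ZeroDim Y) {Z : Type*} [MetricSpace Z] [CompactSpace Z] [Nonempty Z] {P : Y → Set Z}
    (hP : IsContinuousMulti P) :
    ∃ (x : Y → ℝ) (R : Baire → Set Z), Continuous x ∧ (∀ y, x y ∈ Icc (0 : ℝ) 1) ∧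
      IsContinuousMulti R ∧ ∀ y d, IsRealName ν d (x y) → R d = P y := by
  rcases isEmpty_or_nonempty Y with hE | ⟨⟨y₀⟩⟩
  · exact ⟨fun _ => 0, fun _ => univ, continuous_const, fun y => (hE.false y).elim,
      isContinuousMulti_univ _, fun y => (hE.false y).elim⟩
  obtain ⟨B, θ, R, hB, hθ, hR, hRP⟩ := exists_cantor_code hY hP
  let ι : (ℕ → Bool) → ℝ := fun b => (cantorSetHomeomorphNatToBool.symm b : ℝ)
  have hι : Continuous ι := continuous_subtype_val.comp cantorSetHomeomorphNatToBool.symm.continuous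
  have hιe : IsClosedEmbedding fun b : B => ι b.1 := by
    refine (hι.isClosedEmbedding ?_).comp hB.isClosedEmbedding_subtypeVal
    exact Subtype.val_injective.comp cantorSetHomeomorphNatToBool.symm.injective
  have hcl : IsClosed {d : Baire | realVal ν d ∈ range fun b : B => ι b.1} :=
    hιe.isClosed_range.preimage (continuous_realVal ν)
  obtain ⟨d₀, hd₀⟩ := exists_realName ν (ι (θ y₀).1)
  obtain ⟨f, hfid, hfr, hf⟩ := PiNat.exists_retraction_of_isClosed hcl
    ⟨d₀, by rw [Set.mem_ofPred_eq, hd₀.realVal_eq]; exact ⟨θ y₀, rfl⟩⟩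
  have hfm : ∀ d, realVal ν (f d) ∈ range fun b : B => ι b.1 := fun d => by
    have : f d ∈ range f := ⟨d, rfl⟩
    rw [hfr] at this
    exact this
  let e := hιe.isEmbedding.toHomeomorph
  let dec : Baire → B := fun d => e.symm ⟨realVal ν (f d), hfm d⟩
  have hdec : Continuous dec :=
    e.symm.continuous.comp (((continuous_realVal ν).comp hf).subtype_mk _)
  refine ⟨fun y => ι (θ y).1, fun d => R (dec d), hι.comp (continuous_subtype_val.comp hθ),
    fun y => ?_, hR.comp hdec, fun y d hd => ?_⟩
  · exact cantorSet_subset_unitInterval (cantorSetHomeomorphNatToBool.symm (θ y).1).2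
  · have hd' := hd.realVal_eq
    have h1 : f d = d := hfid d (by rw [Set.mem_ofPred_eq, hd']; exact ⟨θ y, rfl⟩)
    have h2 : dec d = θ y := by
      refine e.symm_apply_eq.2 (Subtype.ext ?_)
      show realVal ν (f d) = ι (θ y).1
      rw [h1, hd']
    show R (dec d) = P y
    rw [h2, hRP]

/-! ### Outer approximation on strata -/

/-- The points that are limits of values of `Q` on every cylinder around `x` that meets `C`, and on
the whole space. Off the closure of `C` only finitely many cylinders count; at points of `C` all of
them do, and the hull is `Q x` if `Q` has closed graph. -/
def outerHull {D : Set Baire} {Z : Type*} [TopologicalSpace Z] (Q : D → Set Z) (C : Set D) (x : D) :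
    Set Z :=
  ⋂ k : ℕ, ⋂ _ : k = 0 ∨ ∃ c ∈ C, c.1 ∈ PiNat.cylinder x.1 k,
    closure (⋃ u ∈ {u : D | u.1 ∈ PiNat.cylinder x.1 k}, Q u)

lemma exists_cylinder_subset {D : Set Baire} {x : D} {V : Set D} (hV : V ∈ 𝓝 x) :
    ∃ k, ∀ u : D, u.1 ∈ PiNat.cylinder x.1 k → u ∈ V := by
  rw [nhds_subtype_eq_comap, mem_comap] at hV
  obtain ⟨t, ht, htV⟩ := hV
  obtain ⟨o, hot, ho, hxo⟩ := mem_nhds_iff.1 ht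
  obtain ⟨v, ⟨y, n, rfl⟩, hxv, hvo⟩ :=
    (PiNat.isTopologicalBasis_cylinders (fun _ : ℕ => ℕ)).exists_subset_of_mem_open hxo ho
  exact ⟨n, fun u hu => htV (hot (hvo (by rwa [PiNat.mem_cylinder_iff_eq.1 hxv] at hu)))⟩

lemma cylinder_mem_nhds {D : Set Baire} (x : D) (k : ℕ) :
    {u : D | u.1 ∈ PiNat.cylinder x.1 k} ∈ 𝓝 x :=
  ((PiNat.isOpen_cylinder _ x.1 k).preimage continuous_subtype_val).mem_nhds
    (PiNat.self_mem_cylinder x.1 k)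

lemma subset_outerHull {D : Set Baire} {Z : Type*} [TopologicalSpace Z] (Q : D → Set Z) (C : Set D)
    (x : D) : Q x ⊆ outerHull Q C x := by
  intro z hz
  simp only [outerHull, mem_iInter]
  exact fun k _ => subset_closure (mem_biUnion (PiNat.self_mem_cylinder x.1 k) hz)

/-- If `z` is not in `Q x`, then it stays away from the values of `Q` at all points near `x`. -/
lemma exists_cylinder_disjoint {D : Set Baire} {Z : Type*} [TopologicalSpace Z] {Q : D → Set Z}
    (hQ : IsClosed {p : D × Z | p.2 ∈ Q p.1}) {x : D} {z : Z} (hz : z ∉ Q x) :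
    ∃ (k : ℕ) (O : Set Z), IsOpen O ∧ z ∈ O ∧
      Disjoint O (closure (⋃ u ∈ {u : D | u.1 ∈ PiNat.cylinder x.1 k}, Q u)) := by
  obtain ⟨V, O, hV, hO, hxV, hzO, hVO⟩ := isOpen_prod_iff.1 hQ.isOpen_compl x z hz
  obtain ⟨k, hk⟩ := exists_cylinder_subset (hV.mem_nhds hxV)
  refine ⟨k, O, hO, hzO, Disjoint.closure_right ?_ hO⟩
  rw [disjoint_left]
  intro z' hz' h
  obtain ⟨u, hu, hz''⟩ := mem_iUnion₂.1 h
  exact hVO (show (u, z') ∈ V ×ˢ O from ⟨hk u hu, hz'⟩) hz''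

lemma outerHull_eq {D : Set Baire} {Z : Type*} [TopologicalSpace Z] {Q : D → Set Z}
    (hQ : IsClosed {p : D × Z | p.2 ∈ Q p.1}) {C : Set D} {x : D} (hx : x ∈ C) :
    outerHull Q C x = Q x := by
  refine Subset.antisymm (fun z hz => ?_) (subset_outerHull Q C x)
  by_contra h
  obtain ⟨k, O, -, hzO, hd⟩ := exists_cylinder_disjoint hQ h
  simp only [outerHull, mem_iInter] at hz
  exact disjoint_left.1 hd hzO (hz k (Or.inr ⟨x, hx, PiNat.self_mem_cylinder x.1 k⟩))

/-- If `C` is relatively closed in the open set `U` and `Q` is lower hemicontinuous along `C`, then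
the outer hull of `Q` is a continuous set-valued map on all of `U`. -/
lemma isContinuousMulti_outerHull {D : Set Baire} {Z : Type*} [MetricSpace Z] {Q : D → Set Z}
    (hne : ∀ x, (Q x).Nonempty) (hQ : IsClosed {p : D × Z | p.2 ∈ Q p.1}) {C U : Set D}
    (hUC : IsOpen (U \ C))
    (hl : ∀ x ∈ C, ∀ z ∈ Q x, ∀ ε > 0, ∀ᶠ y in 𝓝 x, y ∈ C → ∃ z' ∈ Q y, dist z' z < ε) :
    IsContinuousMulti fun x : U => outerHull Q C x.1 := by
  -- Off `C` the hull is locally constant.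
  have hconst : ∀ x ∈ U \ C, ∃ k, ∀ y : D, y.1 ∈ PiNat.cylinder x.1 k →
      y ∈ U \ C ∧ outerHull Q C y = outerHull Q C x := by
    intro x hx
    obtain ⟨k, hk⟩ := exists_cylinder_subset (hUC.mem_nhds hx)
    refine ⟨k, fun y hy => ⟨hk y hy, ?_⟩⟩
    have heq : ∀ j ≤ k, PiNat.cylinder y.1 j = PiNat.cylinder x.1 j := fun j hj =>
      PiNat.mem_cylinder_iff_eq.1 (PiNat.cylinder_anti x.1 hj hy)
    have hno : ∀ v : D, v.1 ∈ PiNat.cylinder x.1 k → ∀ j, k ≤ j →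
        ¬∃ c ∈ C, c.1 ∈ PiNat.cylinder v.1 j := by
      rintro v hv j hj ⟨c, hc, hcv⟩
      have := PiNat.cylinder_anti v.1 hj hcv
      rw [PiNat.mem_cylinder_iff_eq.1 hv] at this
      exact (hk c this).2 hc
    ext z
    simp only [outerHull, mem_iInter]
    refine forall_congr' fun j => ?_
    rcases le_total j k with hj | hj
    · rw [heq j hj]
    · rcases Nat.eq_zero_or_pos j with rfl | hj0
      · simp only [PiNat.cylinder_zero]
      · have h1 := hno y hy j hj
        have h2 := hno x (PiNat.self_mem_cylinder x.1 k) j hj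
        simp only [h1, h2, hj0.ne', or_self, false_imp_iff]
  refine ⟨fun x => (hne x.1).mono (subset_outerHull Q C x.1), ?_, ?_⟩
  · rw [← isOpen_compl_iff, isOpen_iff_mem_nhds]
    rintro ⟨x, z⟩ hz
    have hz : z ∉ outerHull Q C x.1 := hz
    by_cases hx : x.1 ∈ C
    · rw [outerHull_eq hQ hx] at hz
      obtain ⟨k, O, hO, hzO, hd⟩ := exists_cylinder_disjoint hQ hz
      have h1 : ∀ᶠ y in 𝓝 x, y.1.1 ∈ PiNat.cylinder x.1.1 k :=
        continuous_subtype_val.continuousAt.eventually (cylinder_mem_nhds x.1 k)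
      filter_upwards [(continuous_fst.tendsto (x, z)).eventually h1,
        (continuous_snd.tendsto (x, z)).eventually (hO.mem_nhds hzO)] with p hp1 hp2 hp
      have hp : p.2 ∈ outerHull Q C p.1.1 := hp
      simp only [outerHull, mem_iInter] at hp
      have := hp k (Or.inr ⟨x.1, hx, (PiNat.mem_cylinder_comm _ _ _).1 hp1⟩)
      rw [PiNat.mem_cylinder_iff_eq.1 hp1] at this
      exact disjoint_left.1 hd hp2 this
    · obtain ⟨k, hk⟩ := hconst x.1 ⟨x.2, hx⟩
      have h1 : ∀ᶠ y in 𝓝 x, y.1.1 ∈ PiNat.cylinder x.1.1 k :=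
        continuous_subtype_val.continuousAt.eventually (cylinder_mem_nhds x.1 k)
      have hcl : IsClosed (outerHull Q C x.1) :=
        isClosed_iInter fun _ => isClosed_iInter fun _ => isClosed_closure
      filter_upwards [(continuous_fst.tendsto (x, z)).eventually h1,
        (continuous_snd.tendsto (x, z)).eventually (hcl.isOpen_compl.mem_nhds hz)] with p hp1 hp2 hp
      have hp : p.2 ∈ outerHull Q C p.1.1 := hp
      rw [(hk _ hp1).2] at hp
      exact hp2 hp
  · rw [lhc_iff_ball]
    intro x z hz ε hε
    by_cases hx : x.1 ∈ C
    · rw [outerHull_eq hQ hx] at hz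
      obtain ⟨k, hk⟩ := exists_cylinder_subset (hl x.1 hx z hz ε hε)
      filter_upwards [continuous_subtype_val.continuousAt.eventually (cylinder_mem_nhds x.1 k)]
        with y hy
      have hy : y.1.1 ∈ PiNat.cylinder x.1.1 k := hy
      by_cases hyC : y.1 ∈ C
      · obtain ⟨z', hz', hd⟩ := hk y.1 hy hyC
        exact ⟨z', subset_outerHull Q C _ hz', hd⟩
      · -- The longest prefix of `y` shared with a point `c` of `C` reaches beyond `k`, so the
        -- hull at `y` contains `Q c`, and `c` is close to `x`.
        classical
        obtain ⟨j, hj⟩ := exists_cylinder_subset (hUC.mem_nhds ⟨y.2, hyC⟩)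
        let V : ℕ → Prop := fun i => ∃ c ∈ C, c.1 ∈ PiNat.cylinder y.1.1 i
        have hVlt : ∀ i, V i → i < j := by
          rintro i ⟨c, hc, hcy⟩
          by_contra hij
          exact (hj c (PiNat.cylinder_anti _ (not_lt.1 hij) hcy)).2 hc
        have hVk : V k := ⟨x.1, hx, (PiNat.mem_cylinder_comm _ _ _).1 hy⟩
        obtain ⟨c, hc, hcy⟩ : V (Nat.findGreatest V j) :=
          Nat.findGreatest_spec (hVlt k hVk).le hVk
        have hkle : k ≤ Nat.findGreatest V j := Nat.le_findGreatest (hVlt k hVk).le hVk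
        have hcx : c.1 ∈ PiNat.cylinder x.1.1 k := by
          rw [← PiNat.mem_cylinder_iff_eq.1 hy]
          exact PiNat.cylinder_anti _ hkle hcy
        obtain ⟨z', hz', hd⟩ := hk c hcx hc
        refine ⟨z', ?_, hd⟩
        simp only [outerHull, mem_iInter]
        intro i hi
        have hile : i ≤ Nat.findGreatest V j := by
          rcases hi with rfl | hi
          · exact Nat.zero_le _
          · exact Nat.le_findGreatest (hVlt i hi).le hi
        exact subset_closure (mem_biUnion (show c ∈ {u : D | u.1 ∈ PiNat.cylinder y.1.1 i} from
          PiNat.cylinder_anti _ hile hcy) hz')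
    · obtain ⟨k, hk⟩ := hconst x.1 ⟨x.2, hx⟩
      filter_upwards [continuous_subtype_val.continuousAt.eventually (cylinder_mem_nhds x.1 k)]
        with y hy
      refine ⟨z, ?_, by simpa using hε⟩
      rw [(hk y.1 hy).2]
      exact hz

/-! ### Solving stratified problems by parallel robust divisions -/

/-- A sum of products of absolute values that is positive if and only if at most `s` of the
numbers `f k` vanish. -/
noncomputable def nonvanishing {κ : Type*} [Fintype κ] [DecidableEq κ] (s : ℕ) (f : κ → ℝ) : ℝ :=
  ∑ T ∈ Finset.powersetCard s Finset.univ, ∏ k ∈ Tᶜ, |f k|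

lemma nonvanishing_nonneg {κ : Type*} [Fintype κ] [DecidableEq κ] (s : ℕ) (f : κ → ℝ) :
    0 ≤ nonvanishing s f :=
  Finset.sum_nonneg fun _ _ => Finset.prod_nonneg fun _ _ => abs_nonneg _

lemma nonvanishing_pos_iff {κ : Type*} [Fintype κ] [DecidableEq κ] {s : ℕ}
    (hs : s ≤ Fintype.card κ) (f : κ → ℝ) :
    0 < nonvanishing s f ↔ (Finset.univ.filter fun k => f k = 0).card ≤ s := by
  have hnn : ∀ T ∈ Finset.powersetCard s (Finset.univ : Finset κ), 0 ≤ ∏ k ∈ Tᶜ, |f k| :=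
    fun T _ => Finset.prod_nonneg fun _ _ => abs_nonneg _
  constructor
  · intro h
    obtain ⟨T, hT, hpos⟩ := (Finset.sum_pos_iff_of_nonneg hnn).1 h
    rw [Finset.mem_powersetCard] at hT
    rw [← hT.2]
    refine Finset.card_le_card fun k hk => ?_
    by_contra hkT
    have := Finset.prod_eq_zero (f := fun k => |f k|) (Finset.mem_compl.2 hkT)
      (abs_eq_zero.2 (Finset.mem_filter.1 hk).2)
    exact hpos.ne' this
  · intro h
    obtain ⟨T, hT1, -, hT2⟩ := Finset.exists_subsuperset_card_eq
      (Finset.subset_univ (Finset.univ.filter fun k => f k = 0)) h (by simpa using hs)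
    refine (Finset.sum_pos_iff_of_nonneg hnn).2 ⟨T, by simp [hT2], ?_⟩
    refine Finset.prod_pos fun k hk => abs_pos.2 fun h0 => ?_
    exact Finset.mem_compl.1 hk (hT1 (by simp [h0]))

/-- Multiplying by `b` extends a bounded continuous function from the open set `{b > 0}`. -/
lemma continuous_mul_extend {X : Type*} [TopologicalSpace X] {b : X → ℝ} (hb : Continuous b)
    (hb0 : ∀ x, 0 ≤ b x) {x : {x // 0 < b x} → ℝ} (hx : Continuous x)
    (hx1 : ∀ y, x y ∈ Icc (0 : ℝ) 1) :
    Continuous fun y => if h : 0 < b y then x ⟨y, h⟩ * b y else 0 := by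
  rw [continuous_iff_continuousAt]
  intro y
  by_cases h : 0 < b y
  · have ho : IsOpen {y | 0 < b y} := isOpen_lt continuous_const hb
    have : ContinuousOn (fun y => if h : 0 < b y then x ⟨y, h⟩ * b y else 0) {y | 0 < b y} := by
      rw [continuousOn_iff_continuous_domRestrict]
      refine (hx.mul (hb.comp continuous_subtype_val)).congr fun y => ?_
      have hy : 0 < b y.1 := y.2
      simp [hy]
    exact this.continuousAt (ho.mem_nhds h)
  · have hy : b y = 0 := le_antisymm (not_lt.1 h) (hb0 y)
    rw [ContinuousAt, dif_neg h]
    refine squeeze_zero (fun t => ?_) (fun t => ?_) (hy ▸ hb.tendsto y)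
    · split_ifs with ht
      exacts [mul_nonneg (hx1 _).1 ht.le, le_rfl]
    · split_ifs with ht
      exacts [mul_le_of_le_one_left ht.le (hx1 _).2, hb0 t]

/-- Let `Q` be a set-valued map with closed graph that is lower hemicontinuous along the sets on
which a prescribed subset of finitely many continuous functions `f k` vanishes. Then finitely many
parallel robust divisions `a s / b s` suffice to find a point of `Q w` continuously: whenever the
sequences `d s` are correct answers to these divisions, they determine a solution. -/
theorem exists_parallel_divisions (ν : ℕ ≃ ℚ) {D : Set Baire} {Z : Type*} [MetricSpace Z]
    [CompactSpace Z] [Nonempty Z] {κ : Type*} [Finite κ] (f : κ → D → ℝ)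
    (hf : ∀ k, Continuous (f k)) (Q : D → Set Z) (hne : ∀ x, (Q x).Nonempty)
    (hQ : IsClosed {p : D × Z | p.2 ∈ Q p.1})
    (hl : ∀ x, ∀ z ∈ Q x, ∀ ε > 0, ∀ᶠ y in 𝓝 x, (∀ k, f k x = 0 → f k y = 0) →
      ∃ z' ∈ Q y, dist z' z < ε) :
    ∃ (N : ℕ) (a b : ℕ → D → ℝ), (∀ s, Continuous (a s)) ∧ (∀ s, Continuous (b s)) ∧
      (∀ s x, 0 ≤ a s x ∧ a s x ≤ b s x) ∧
      ∀ (E : Type) [TopologicalSpace E] [SecondCountableTopology E], ZeroDim E →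
      ∀ (w : E → D) (d : ℕ → E → Baire), Continuous w → (∀ s, Continuous (d s)) →
        (∀ e, ∀ s ≤ N, 0 < b s (w e) → IsRealName ν (d s e) (a s (w e) / b s (w e))) →
        ∃ z : E → Z, Continuous z ∧ ∀ e, z e ∈ Q (w e) := by
  classical
  have := Fintype.ofFinite κ
  let zeros : D → ℕ := fun x => (Finset.univ.filter fun k => f k x = 0).card
  let b : ℕ → D → ℝ := fun s x => nonvanishing s fun k => f k x
  have hb : ∀ s, Continuous (b s) := fun s => by
    refine continuous_finsetSum _ fun T _ => continuous_finsetProd _ fun k _ => (hf k).abs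
  have hb0 : ∀ s x, 0 ≤ b s x := fun s x => nonvanishing_nonneg _ _
  have hbz : ∀ s ≤ Fintype.card κ, ∀ x, 0 < b s x ↔ zeros x ≤ s := fun s hs x =>
    nonvanishing_pos_iff hs _
  -- `P s` contains `Q`, agrees with it where exactly `s` functions vanish, and is continuous where
  -- at most `s` functions vanish.
  have hP : ∀ s, ∃ P : D → Set Z, (∀ x, Q x ⊆ P x) ∧ (∀ x, zeros x = s → P x = Q x) ∧
      (s ≤ Fintype.card κ → IsContinuousMulti fun x : {x // 0 < b s x} => P x.1) := by
    intro s
    refine ⟨outerHull Q {x | zeros x = s}, subset_outerHull Q _, fun x hx => outerHull_eq hQ hx,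
      fun hs => ?_⟩
    refine isContinuousMulti_outerHull (U := {x | 0 < b s x}) hne hQ ?_ ?_
    · rcases Nat.eq_zero_or_pos s with rfl | hs0
      · convert isOpen_empty
        ext x
        have h1 := hbz 0 hs x
        show (0 < b 0 x ∧ ¬zeros x = 0) ↔ False
        rw [h1, iff_false]
        omega
      · convert isOpen_lt continuous_const (hb (s - 1)) using 1
        ext x
        have h1 := hbz s hs x
        have h2 := hbz (s - 1) (by omega) x
        show (0 < b s x ∧ ¬zeros x = s) ↔ 0 < b (s - 1) x
        rw [h1, h2]
        omega
    · intro x hx z hz ε hε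
      have hx : zeros x = s := hx
      have hnz : ∀ᶠ y in 𝓝 x, ∀ k, f k x ≠ 0 → f k y ≠ 0 := by
        rw [eventually_all]
        intro k
        by_cases hk : f k x = 0
        · simp [hk]
        · filter_upwards [(hf k).continuousAt.eventually_ne hk] with y hy _
          exact hy
      filter_upwards [hl x z hz ε hε, hnz] with y hy hny hys
      have hys : zeros y = s := hys
      -- The zeros at `y` are among those at `x` and equally many.
      refine hy fun k hk => ?_
      have hsub : (Finset.univ.filter fun k => f k y = 0) ⊆ Finset.univ.filter fun k => f k x = 0 := by
        intro k hk
        simp only [Finset.mem_filter, Finset.mem_univ, true_and] at hk ⊢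
        by_contra h
        exact hny k h hk
      have heq := Finset.eq_of_subset_of_card_le hsub (by
        show zeros x ≤ zeros y
        omega)
      have : k ∈ Finset.univ.filter fun k => f k y = 0 := by
        rw [heq]; simpa using hk
      simpa using this
  choose P hPsub hPeq hPc using hP
  -- Where `b s` is positive, `x s` codes `P s`; the `s`-th division is `(x s * b s) / b s`.
  have hcode : ∀ s, ∃ (x : {x // 0 < b s x} → ℝ) (R : Baire → Set Z), Continuous x ∧
      (∀ y, x y ∈ Icc (0 : ℝ) 1) ∧ IsContinuousMulti R ∧
      (s ≤ Fintype.card κ → ∀ y d, IsRealName ν d (x y) → R d = P s y.1) := by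
    intro s
    by_cases hs : s ≤ Fintype.card κ
    · obtain ⟨x, R, h1, h2, h3, h4⟩ := exists_real_code ν
        ((zeroDim_baire.subtype (· ∈ D)).subtype fun x => 0 < b s x) (hPc s hs)
      exact ⟨x, R, h1, h2, h3, fun _ => h4⟩
    · exact ⟨fun _ => 0, fun _ => univ, continuous_const, by simp, isContinuousMulti_univ _,
        fun h => absurd h hs⟩
  choose x R hx hx1 hR hRP using hcode
  refine ⟨Fintype.card κ, fun s y => if h : 0 < b s y then x s ⟨y, h⟩ * b s y else 0, b,
    fun s => continuous_mul_extend (hb s) (hb0 s) (hx s) (hx1 s), hb, fun s y => ?_, ?_⟩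
  · dsimp only
    split_ifs with h
    · exact ⟨mul_nonneg (hx1 s _).1 h.le, mul_le_of_le_one_left h.le (hx1 s _).2⟩
    · exact ⟨le_rfl, hb0 s y⟩
  · intro E _ _ hE w d hw hd hname
    have hRe : ∀ e, ∀ s ≤ Fintype.card κ, zeros (w e) ≤ s → R s (d s e) = P s (w e) := by
      intro e s hs hz
      have hpos := (hbz s hs (w e)).2 hz
      refine hRP s hs ⟨w e, hpos⟩ _ ?_
      have := hname e s hs hpos
      dsimp only at this
      rwa [dif_pos hpos, mul_div_assoc, div_self hpos.ne', mul_one] at this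
    -- Correct a point successively into `P 0`, `P 1`, …; where it is already in `Q`, it stays.
    have key : ∀ s ≤ Fintype.card κ, ∃ z : E → Z, Continuous z ∧
        ∀ e, zeros (w e) ≤ s → z e ∈ Q (w e) := by
      intro s
      induction s with
      | zero =>
        intro hs
        obtain ⟨z, hz, hzR, -⟩ := hE.exists_correction ((hR 0).comp (hd 0))
          (g := fun _ => Classical.arbitrary Z) continuous_const
        refine ⟨z, hz, fun e he => ?_⟩
        have := hzR e
        rwa [hRe e 0 hs he, hPeq 0 _ (by omega)] at this
      | succ s ih =>
        intro hs
        obtain ⟨z, hz, hzQ⟩ := ih (by omega)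
        obtain ⟨z', hz', hzR, hzz⟩ := hE.exists_correction ((hR (s + 1)).comp (hd (s + 1))) hz
        refine ⟨z', hz', fun e he => ?_⟩
        rcases Nat.lt_or_ge s (zeros (w e)) with h | h
        · have := hzR e
          rwa [hRe e _ hs he, hPeq (s + 1) _ (by omega)] at this
        · rw [hzz e (by rw [hRe e _ hs he]; exact hPsub _ _ (hzQ e h))]
          exact hzQ e h
    obtain ⟨z, hz, hzQ⟩ := key _ le_rfl
    exact ⟨z, hz, fun e => hzQ e (Finset.card_le_univ _)⟩

/-! ### Polytopes depending on parameters -/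

section Polytope

variable {ι Φ : Type*} [Fintype ι]

/-- The linear form with index `φ`; the index `none` stands for the sum of the coordinates. -/
def extForm (g : Φ → ι → ℝ) : Option Φ → ι → ℝ
  | none => 1
  | some φ => g φ

/-- The determinant of a square system of linear forms. -/
def minor [DecidableEq ι] (g : Φ → ι → ℝ) (τ : ι → Option Φ) : ℝ :=
  Matrix.det (Matrix.of fun k => extForm g (τ k))

/-- The points with coordinate sum `1` at which the forms in `E` vanish and those in `I` are
nonnegative. -/
def poly (g : Φ → ι → ℝ) (E I : Set Φ) : Set (ι → ℝ) :=
  {y | 1 ⬝ᵥ y = 1 ∧ (∀ φ ∈ E, g φ ⬝ᵥ y = 0) ∧ ∀ φ ∈ I, 0 ≤ g φ ⬝ᵥ y}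

lemma convex_poly (g : Φ → ι → ℝ) (E I : Set Φ) : Convex ℝ (poly g E I) := by
  rintro y ⟨h1, h2, h3⟩ z ⟨k1, k2, k3⟩ a b ha hb hab
  refine ⟨?_, fun φ hφ => ?_, fun φ hφ => ?_⟩
  · rw [dotProduct_add, dotProduct_smul, dotProduct_smul, h1, k1]; simpa using hab
  · rw [dotProduct_add, dotProduct_smul, dotProduct_smul, h2 φ hφ, k2 φ hφ]; simp
  · rw [dotProduct_add, dotProduct_smul, dotProduct_smul]
    exact add_nonneg (mul_nonneg ha (h3 φ hφ)) (mul_nonneg hb (k3 φ hφ))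

variable [DecidableEq ι]

/-- At a vertex the tight forms, together with the coordinate sum, span the dual space: otherwise
the vertex could be moved both ways in a direction `v` annihilated by all of them. -/
lemma span_tight_eq_top [Finite Φ] {g : Φ → ι → ℝ} {E I : Set Φ} {y : ι → ℝ}
    (hy : y ∈ (poly g E I).extremePoints ℝ) :
    Submodule.span ℝ (insert 1 (g '' {φ | g φ ⬝ᵥ y = 0})) = ⊤ := by
  by_contra hne
  obtain ⟨f, hf0, hf⟩ := Submodule.exists_le_ker_of_lt_top _ (lt_top_iff_ne_top.2 hne)
  let v : ι → ℝ := fun i => f (Pi.single i 1)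
  have hv : ∀ w, f w = w ⬝ᵥ v := by
    intro w
    rw [LinearMap.pi_apply_eq_sum_univ f w]
    refine Finset.sum_congr rfl fun i _ => ?_
    simp only [v, smul_eq_mul]
    congr 2
    ext j
    simp [Pi.single_apply, eq_comm]
  have hv0 : v ≠ 0 := by
    intro h
    exact hf0 (LinearMap.ext fun w => by rw [hv, h]; simp)
  have hspan : ∀ w ∈ insert 1 (g '' {φ | g φ ⬝ᵥ y = 0}), w ⬝ᵥ v = 0 := fun w hw => by
    rw [← hv]; exact hf (Submodule.subset_span hw)
  have h1v : (1 : ι → ℝ) ⬝ᵥ v = 0 := hspan 1 (mem_insert _ _)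
  have htv : ∀ φ, g φ ⬝ᵥ y = 0 → g φ ⬝ᵥ v = 0 := fun φ hφ =>
    hspan _ (mem_insert_of_mem _ ⟨φ, hφ, rfl⟩)
  obtain ⟨hy1, hyE, hyI⟩ := hy.1
  have hev : ∀ᶠ t : ℝ in 𝓝 0, y + t • v ∈ poly g E I := by
    have : ∀ᶠ t : ℝ in 𝓝 0, ∀ φ, φ ∈ I → 0 ≤ g φ ⬝ᵥ (y + t • v) := by
      rw [eventually_all]
      intro φ
      by_cases hφ : g φ ⬝ᵥ y = 0
      · refine Eventually.of_forall fun t _ => ?_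
        rw [dotProduct_add, dotProduct_smul, hφ, htv φ hφ]; simp
      · by_cases hI : φ ∈ I
        · have hpos : 0 < g φ ⬝ᵥ (y + (0 : ℝ) • v) := by
            simpa using lt_of_le_of_ne (hyI φ hI) (Ne.symm hφ)
          have hc : Continuous fun t : ℝ => g φ ⬝ᵥ (y + t • v) := by fun_prop
          filter_upwards [hc.continuousAt.eventually (lt_mem_nhds hpos)] with t ht _
          exact ht.le
        · exact Eventually.of_forall fun t h => absurd h hI
    filter_upwards [this] with t ht
    refine ⟨?_, fun φ hφ => ?_, ht⟩
    · rw [dotProduct_add, dotProduct_smul, hy1, h1v]; simp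
    · rw [dotProduct_add, dotProduct_smul, hyE φ hφ, htv φ (hyE φ hφ)]; simp
  have hev' : ∀ᶠ t : ℝ in 𝓝 0, y + (-t) • v ∈ poly g E I := by
    have : Tendsto (fun t : ℝ => -t) (𝓝 0) (𝓝 0) := by simpa using (continuous_neg (G := ℝ)).tendsto 0
    exact this.eventually hev
  obtain ⟨t, ht0, ht1, ht2⟩ : ∃ t : ℝ, 0 < t ∧ y + t • v ∈ poly g E I ∧ y + (-t) • v ∈ poly g E I := by
    have := ((hev.and hev').filter_mono nhdsWithin_le_nhds).and
      (self_mem_nhdsWithin (a := (0 : ℝ)) (s := Ioi 0))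
    obtain ⟨t, ⟨h1, h2⟩, h3⟩ := this.exists
    exact ⟨t, h3, h1, h2⟩
  have hseg : y ∈ openSegment ℝ (y + t • v) (y + (-t) • v) := by
    refine ⟨1 / 2, 1 / 2, by norm_num, by norm_num, by norm_num, ?_⟩
    ext i
    simp only [Pi.add_apply, Pi.smul_apply, smul_eq_mul]
    ring
  have heq := hy.2 ht1 ht2 hseg
  have : t • v = 0 := by simpa using heq
  exact hv0 ((smul_eq_zero.1 this).resolve_left ht0.ne')

lemma exists_minor_ne_zero [Finite Φ] {g : Φ → ι → ℝ} {E I : Set Φ} {y : ι → ℝ}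
    (hy : y ∈ (poly g E I).extremePoints ℝ) :
    ∃ τ : ι → Option Φ, minor g τ ≠ 0 ∧ ∀ k φ, τ k = some φ → g φ ⬝ᵥ y = 0 := by
  have hspan := span_tight_eq_top hy
  obtain ⟨f, hf, -, hli⟩ := Submodule.exists_fun_fin_finrank_span_eq ℝ
    (insert 1 (g '' {φ | g φ ⬝ᵥ y = 0}))
  have hcard : Module.finrank ℝ (Submodule.span ℝ (insert 1 (g '' {φ | g φ ⬝ᵥ y = 0})))
      = Fintype.card ι := by
    rw [hspan, finrank_top, Module.finrank_fintype_fun_eq_card]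
  let e : ι ≃ Fin (Module.finrank ℝ (Submodule.span ℝ (insert 1 (g '' {φ | g φ ⬝ᵥ y = 0})))) :=
    (Fintype.equivFin ι).trans (finCongr hcard.symm)
  have : ∀ k, ∃ o : Option Φ, extForm g o = f (e k) ∧ ∀ φ, o = some φ → g φ ⬝ᵥ y = 0 := by
    intro k
    rcases hf (e k) with h | ⟨φ, hφ, h⟩
    · exact ⟨none, h.symm, by simp⟩
    · refine ⟨some φ, h, ?_⟩
      rintro ψ hψ
      rw [← Option.some.inj hψ]; exact hφ
  choose τ hτ hτt using this
  refine ⟨τ, ?_, hτt⟩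
  have hli' : LinearIndependent ℝ fun k => (Matrix.of fun k => extForm g (τ k)).row k := by
    have : (fun k => (Matrix.of fun k => extForm g (τ k)).row k) = f ∘ e := by
      ext k : 1
      exact hτ k
    rw [this]
    exact hli.comp _ e.injective
  have hu := Matrix.linearIndependent_rows_iff_isUnit.1 hli'
  exact ((Matrix.isUnit_iff_isUnit_det _).1 hu).ne_zero

/-- Vertices move continuously as long as no minor becomes nonzero: the vertex stays the solution of
the same linear system, and the vanishing of a form at it is the vanishing of a minor. -/
lemma eventually_exists_near_vertex [Finite Φ] {X : Type*} [TopologicalSpace X]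
    {g : X → Φ → ι → ℝ} (hg : ∀ φ, Continuous fun x => g x φ) {x₀ : X} {E I : Set Φ} {y : ι → ℝ}
    (hy : y ∈ (poly (g x₀) E I).extremePoints ℝ) {ε : ℝ} (hε : 0 < ε) :
    ∀ᶠ x in 𝓝 x₀, (∀ τ, minor (g x₀) τ = 0 → minor (g x) τ = 0) →
      ∃ y' ∈ poly (g x) E I, dist y' y < ε := by
  classical
  obtain ⟨τ, hτ, htight⟩ := exists_minor_ne_zero hy
  obtain ⟨hy1, hyE, hyI⟩ := hy.1
  have hy0 : y ≠ 0 := by rintro rfl; simp at hy1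
  let M : X → Matrix ι ι ℝ := fun x => Matrix.of fun k => extForm (g x) (τ k)
  let r : ι → ℝ := fun k => if τ k = none then 1 else 0
  have hM : Continuous M := by
    refine continuous_pi fun k => ?_
    show Continuous fun x => extForm (g x) (τ k)
    cases τ k with
    | none => exact continuous_const
    | some φ => exact hg φ
  have hMy : M x₀ *ᵥ y = r := by
    ext k
    show extForm (g x₀) (τ k) ⬝ᵥ y = if τ k = none then 1 else 0
    cases h : τ k with
    | none => simpa [extForm] using hy1
    | some φ => simpa [extForm] using htight k φ h
  have hnone : ∃ k, τ k = none := by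
    by_contra hno
    push Not at hno
    have : M x₀ *ᵥ y = 0 := by
      rw [hMy]; ext k; simp [r, hno k]
    exact hτ (Matrix.exists_mulVec_eq_zero_iff.1 ⟨y, hy0, this⟩)
  let y' : X → ι → ℝ := fun x => (M x).det⁻¹ • ((M x).adjugate *ᵥ r)
  have hy'M : ∀ x, (M x).det ≠ 0 → M x *ᵥ y' x = r := by
    intro x hx
    show M x *ᵥ ((M x).det⁻¹ • ((M x).adjugate *ᵥ r)) = r
    rw [Matrix.mulVec_smul, Matrix.mulVec_mulVec, Matrix.mul_adjugate, Matrix.smul_mulVec,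
      Matrix.one_mulVec, smul_smul, inv_mul_cancel₀ hx, one_smul]
  have hinj : ∀ x, (M x).det ≠ 0 → ∀ u v, M x *ᵥ u = M x *ᵥ v → u = v := by
    intro x hx u v huv
    by_contra hne
    refine hx (Matrix.exists_mulVec_eq_zero_iff.1 ⟨u - v, sub_ne_zero.2 hne, ?_⟩)
    rw [Matrix.mulVec_sub, huv, sub_self]
  have hy'₀ : y' x₀ = y := hinj x₀ hτ _ _ (by rw [hy'M x₀ hτ, hMy])
  have hcont : ContinuousAt y' x₀ := by
    refine ContinuousAt.smul (hM.matrix_det.continuousAt.inv₀ hτ) ?_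
    exact (hM.matrix_adjugate.matrix_mulVec continuous_const).continuousAt
  have hdet : ∀ᶠ x in 𝓝 x₀, (M x).det ≠ 0 := hM.matrix_det.continuousAt.eventually_ne hτ
  have hpos : ∀ᶠ x in 𝓝 x₀, ∀ φ, 0 < g x₀ φ ⬝ᵥ y → 0 < g x φ ⬝ᵥ y' x := by
    rw [eventually_all]
    intro φ
    by_cases h : 0 < g x₀ φ ⬝ᵥ y
    · have hc : ContinuousAt (fun x => g x φ ⬝ᵥ y' x) x₀ := by
        refine tendsto_finsetSum _ fun i _ => ?_
        exact ((continuous_apply i).comp (hg φ)).continuousAt.mul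
          ((continuous_apply i).continuousAt.comp hcont)
      have : 0 < g x₀ φ ⬝ᵥ y' x₀ := by rwa [hy'₀]
      filter_upwards [hc.eventually (lt_mem_nhds this)] with x hx _
      exact hx
    · simp [h]
  have hnear : ∀ᶠ x in 𝓝 x₀, dist (y' x) y < ε := by
    have := Metric.tendsto_nhds.1 hcont.tendsto ε hε
    rwa [hy'₀] at this
  filter_upwards [hdet, hpos, hnear] with x hx hxpos hxnear hmin
  have hzero : ∀ φ, g x₀ φ ⬝ᵥ y = 0 → g x φ ⬝ᵥ y' x = 0 := by
    intro φ hφ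
    -- Replace the coordinate sum in the system defining the vertex by the form `φ`.
    let τ' : ι → Option Φ := fun k => if τ k = none then some φ else τ k
    have h0 : minor (g x₀) τ' = 0 := by
      refine Matrix.exists_mulVec_eq_zero_iff.1 ⟨y, hy0, ?_⟩
      ext k
      show extForm (g x₀) (if τ k = none then some φ else τ k) ⬝ᵥ y = 0
      cases h : τ k with
      | none => simpa [extForm] using hφ
      | some ψ => simpa [extForm] using htight k ψ h
    obtain ⟨v, hv0, hv⟩ := Matrix.exists_mulVec_eq_zero_iff.2 (hmin τ' h0)
    have hvk : ∀ k, extForm (g x) (if τ k = none then some φ else τ k) ⬝ᵥ v = 0 := fun k =>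
      congrFun hv k
    have hφv : g x φ ⬝ᵥ v = 0 := by
      obtain ⟨k, hk⟩ := hnone
      simpa [hk, extForm] using hvk k
    have hvy : v = (1 ⬝ᵥ v) • y' x := by
      refine hinj x hx _ _ ?_
      rw [Matrix.mulVec_smul, hy'M x hx]
      ext k
      show extForm (g x) (τ k) ⬝ᵥ v = (1 ⬝ᵥ v) * (if τ k = none then 1 else 0)
      cases h : τ k with
      | none => simp [extForm]
      | some ψ => simpa [h, extForm] using hvk k
    have hc : (1 : ι → ℝ) ⬝ᵥ v ≠ 0 := by
      intro h
      rw [h, zero_smul] at hvy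
      exact hv0 hvy
    rw [hvy, dotProduct_smul, smul_eq_mul] at hφv
    exact (mul_eq_zero.1 hφv).resolve_left hc
  refine ⟨y' x, ⟨?_, fun φ hφ => hzero φ (hyE φ hφ), fun φ hφ => ?_⟩, hxnear⟩
  · obtain ⟨k, hk⟩ := hnone
    have : extForm (g x) (τ k) ⬝ᵥ y' x = if τ k = none then 1 else 0 := congrFun (hy'M x hx) k
    rwa [hk, if_pos rfl] at this
  · rcases (hyI φ hφ).eq_or_lt with h | h
    · exact (hzero φ h.symm).ge
    · exact (hxpos φ h).le

/-- A bounded polytope varies lower hemicontinuously along parameters at which all minors vanishing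
at the base point still vanish: the limits of points of nearby polytopes form a closed convex set
containing the vertices, so the Krein-Milman theorem applies. -/
theorem eventually_exists_near_poly [Finite Φ] {X : Type*} [TopologicalSpace X]
    {g : X → Φ → ι → ℝ} (hg : ∀ φ, Continuous fun x => g x φ) {x₀ : X} {E I : Set Φ}
    (hc : IsCompact (poly (g x₀) E I)) {y : ι → ℝ} (hy : y ∈ poly (g x₀) E I) {ε : ℝ}
    (hε : 0 < ε) :
    ∀ᶠ x in 𝓝 x₀, (∀ τ, minor (g x₀) τ = 0 → minor (g x) τ = 0) →
      ∃ y' ∈ poly (g x) E I, dist y' y < ε := by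
  let R : Set (ι → ℝ) := {y | ∀ ε > 0, ∀ᶠ x in 𝓝 x₀,
    (∀ τ, minor (g x₀) τ = 0 → minor (g x) τ = 0) → ∃ y' ∈ poly (g x) E I, dist y' y < ε}
  have hRc : IsClosed R := by
    refine isClosed_of_closure_subset fun y hy ε hε => ?_
    obtain ⟨z, hz, hyz⟩ := Metric.mem_closure_iff.1 hy (ε / 2) (half_pos hε)
    filter_upwards [hz (ε / 2) (half_pos hε)] with x hx hm
    obtain ⟨y', hy', hd⟩ := hx hm
    refine ⟨y', hy', ?_⟩
    have := dist_triangle_right y' y z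
    linarith
  have hRconv : Convex ℝ R := by
    intro y hy z hz a b ha hb hab ε hε
    filter_upwards [hy ε hε, hz ε hε] with x h1 h2 hm
    obtain ⟨y', hy', hd⟩ := h1 hm
    obtain ⟨z', hz', hd'⟩ := h2 hm
    refine ⟨a • y' + b • z', convex_poly _ _ _ hy' hz' ha hb hab, ?_⟩
    have hsub := convex_ball (0 : ι → ℝ) ε (x := y' - y) (y := z' - z)
      (by simpa [dist_eq_norm] using hd) (by simpa [dist_eq_norm] using hd') ha hb hab
    rw [mem_ball_zero_iff] at hsub
    rw [dist_eq_norm, show a • y' + b • z' - (a • y + b • z) = a • (y' - y) + b • (z' - z) by module]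
    exact hsub
  have hsub : poly (g x₀) E I ⊆ R := by
    rw [← closure_convexHull_extremePoints hc (convex_poly _ _ _)]
    refine closure_minimal (convexHull_min (fun z hz ε hε => ?_) hRconv) hRc
    exact eventually_exists_near_vertex hg hz hε
  exact hsub hy ε hε

end Polytope

/-! ### Equilibria -/

/-- A mixed strategy is a best response to the payoff vector `c` if and only if it is supported on
the pure best responses. -/
lemma isMax_iff_support {ι : Type*} [Fintype ι] [DecidableEq ι] {x : ι → ℝ}
    (hx : x ∈ stdSimplex ℝ ι) (c : ι → ℝ) :
    (∀ x' ∈ stdSimplex ℝ ι, x' ⬝ᵥ c ≤ x ⬝ᵥ c) ↔ ∀ i, x i ≠ 0 → ∀ l, c l ≤ c i := by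
  constructor
  · intro h i hi l
    have hle : ∀ l, c l ≤ x ⬝ᵥ c := fun l => by
      simpa using h (Pi.single l 1) (single_mem_stdSimplex ℝ l)
    have h0 : ∑ k, x k * (x ⬝ᵥ c - c k) = 0 := by
      simp only [mul_sub, Finset.sum_sub_distrib, ← Finset.sum_mul, hx.2, one_mul]
      simp [dotProduct]
    have := (Finset.sum_eq_zero_iff_of_nonneg fun k _ =>
      mul_nonneg (hx.1 k) (sub_nonneg.2 (hle k))).1 h0 i (Finset.mem_univ i)
    rcases mul_eq_zero.1 this with h | h
    · exact absurd h hi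
    · linarith [hle l]
  · intro h x' hx'
    obtain ⟨i, hi⟩ : ∃ i, x i ≠ 0 := by
      by_contra hno
      push Not at hno
      have := hx.2
      simp [hno] at this
    have h1 : x ⬝ᵥ c = c i := by
      have : ∀ k, x k * c k = x k * c i := fun k => by
        by_cases hk : x k = 0
        · simp [hk]
        · rw [le_antisymm (h i hi k) (h k hk i)]
      simp only [dotProduct, this, ← Finset.sum_mul, hx.2, one_mul]
    have h2 : x' ⬝ᵥ c ≤ ∑ k, x' k * c i :=
      Finset.sum_le_sum fun k _ => mul_le_mul_of_nonneg_left (h i hi k) (hx'.1 k)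
    rw [← Finset.sum_mul, hx'.2, one_mul] at h2
    rw [h1]; exact h2

lemma isNash_iff {n m : ℕ} {A B : Matrix (Fin n) (Fin m) ℝ} {x : Fin n → ℝ} {y : Fin m → ℝ} :
    IsNash A B x y ↔ x ∈ stdSimplex ℝ (Fin n) ∧ y ∈ stdSimplex ℝ (Fin m) ∧
      (∀ i, x i ≠ 0 → ∀ l, (A *ᵥ y) l ≤ (A *ᵥ y) i) ∧
      ∀ j, y j ≠ 0 → ∀ k, (Bᵀ *ᵥ x) k ≤ (Bᵀ *ᵥ x) j := by
  unfold IsNash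
  refine and_congr_right fun hx => and_congr_right fun hy => and_congr (isMax_iff_support hx _) ?_
  rw [← isMax_iff_support hy]
  have : ∀ y', x ⬝ᵥ (B *ᵥ y') = y' ⬝ᵥ (Bᵀ *ᵥ x) := fun y' => by
    rw [Matrix.dotProduct_mulVec, ← Matrix.mulVec_transpose, dotProduct_comm]
  simp only [this]

/-- The linear forms deciding which strategies of the second player make which strategies of the
first player optimal: the coordinates and the differences of rows of the payoff matrix. -/
def payoffForms {n m : ℕ} (A : Matrix (Fin n) (Fin m) ℝ) : Fin m ⊕ Fin n × Fin n → Fin m → ℝ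
  | .inl j => Pi.single j 1
  | .inr (i, l) => A i - A l

lemma mem_poly_payoffForms {n m : ℕ} {A : Matrix (Fin n) (Fin m) ℝ} {S : Set (Fin n)}
    {T : Set (Fin m)} {y : Fin m → ℝ} :
    y ∈ poly (payoffForms A) {φ | ∃ j ∉ T, φ = .inl j}
        {φ | (∃ j, φ = .inl j) ∨ ∃ i ∈ S, ∃ l, φ = .inr (i, l)} ↔
      y ∈ stdSimplex ℝ (Fin m) ∧ (∀ j ∉ T, y j = 0) ∧ ∀ i ∈ S, ∀ l, (A *ᵥ y) l ≤ (A *ᵥ y) i := by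
  have h1 : ∀ i l, (A i - A l) ⬝ᵥ y = (A *ᵥ y) i - (A *ᵥ y) l := fun i l => sub_dotProduct _ _ _
  constructor
  · rintro ⟨ha, hb, hc⟩
    refine ⟨⟨fun j => ?_, by simpa [dotProduct] using ha⟩, fun j hj => ?_, fun i hi l => ?_⟩
    · simpa [payoffForms] using hc (.inl j) (Or.inl ⟨j, rfl⟩)
    · simpa [payoffForms] using hb (.inl j) ⟨j, hj, rfl⟩
    · have := hc (.inr (i, l)) (Or.inr ⟨i, hi, l, rfl⟩)
      rw [payoffForms, h1] at this
      linarith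
  · rintro ⟨⟨ha, ha'⟩, hb, hc⟩
    refine ⟨by simpa [dotProduct] using ha', ?_, ?_⟩
    · rintro _ ⟨j, hj, rfl⟩
      simpa [payoffForms] using hb j hj
    · rintro _ (⟨j, rfl⟩ | ⟨i, hi, l, rfl⟩)
      · simpa [payoffForms] using ha j
      · rw [payoffForms, h1]
        linarith [hc i hi l]

lemma continuous_payoffForms {X : Type*} [TopologicalSpace X] {n m : ℕ}
    {A : X → Matrix (Fin n) (Fin m) ℝ} (hA : Continuous A) (φ : Fin m ⊕ Fin n × Fin n) :
    Continuous fun x => payoffForms (A x) φ := by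
  rcases φ with j | ⟨i, l⟩
  · exact continuous_const
  · exact ((continuous_apply i).comp hA).sub ((continuous_apply l).comp hA)

/-- The strategies of the second player that are supported in `T` and make all strategies in `S`
optimal vary lower hemicontinuously where the zero pattern of the minors does not grow. -/
lemma eventually_exists_near_strategy {X : Type*} [TopologicalSpace X] {n m : ℕ}
    {A : X → Matrix (Fin n) (Fin m) ℝ} (hA : Continuous A) {x₀ : X} {S : Set (Fin n)}
    {T : Set (Fin m)} {y : Fin m → ℝ} (hy : y ∈ stdSimplex ℝ (Fin m)) (hyT : ∀ j ∉ T, y j = 0)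
    (hyS : ∀ i ∈ S, ∀ l, (A x₀ *ᵥ y) l ≤ (A x₀ *ᵥ y) i) {ε : ℝ} (hε : 0 < ε) :
    ∀ᶠ x in 𝓝 x₀,
      (∀ τ, minor (payoffForms (A x₀)) τ = 0 → minor (payoffForms (A x)) τ = 0) →
      ∃ y', (y' ∈ stdSimplex ℝ (Fin m) ∧ (∀ j ∉ T, y' j = 0) ∧
        ∀ i ∈ S, ∀ l, (A x *ᵥ y') l ≤ (A x *ᵥ y') i) ∧ dist y' y < ε := by
  have hc : IsCompact (poly (payoffForms (A x₀)) {φ | ∃ j ∉ T, φ = .inl j}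
      {φ | (∃ j, φ = .inl j) ∨ ∃ i ∈ S, ∃ l, φ = .inr (i, l)}) := by
    refine (isCompact_stdSimplex ℝ (Fin m)).of_isClosed_subset ?_
      fun y hy => (mem_poly_payoffForms.1 hy).1
    have hd : ∀ c : Fin m → ℝ, Continuous fun y : Fin m → ℝ => c ⬝ᵥ y := fun c => by fun_prop
    simp only [poly, ofPred_and, ofPred_forall]
    exact (isClosed_eq (hd _) continuous_const).inter
      ((isClosed_biInter fun φ _ => isClosed_eq (hd _) continuous_const).inter
        (isClosed_biInter fun φ _ => isClosed_le continuous_const (hd _)))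
  filter_upwards [eventually_exists_near_poly (continuous_payoffForms hA) hc
    (mem_poly_payoffForms.2 ⟨hy, hyT, hyS⟩) hε] with x hx hm
  obtain ⟨y', hy', hd⟩ := hx hm
  exact ⟨y', mem_poly_payoffForms.1 hy', hd⟩

/-- The Nash equilibria of a game as a subset of the compact space of strategy profiles. -/
def nashSet {n m : ℕ} (G : Matrix (Fin n) (Fin m) ℝ × Matrix (Fin n) (Fin m) ℝ) :
    Set (stdSimplex ℝ (Fin n) × stdSimplex ℝ (Fin m)) :=
  {z | IsNash G.1 G.2 z.1.1 z.2.1}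

lemma isClosed_graph_nashSet (n m : ℕ) :
    IsClosed {p : (Matrix (Fin n) (Fin m) ℝ × Matrix (Fin n) (Fin m) ℝ) ×
      (stdSimplex ℝ (Fin n) × stdSimplex ℝ (Fin m)) | p.2 ∈ nashSet p.1} := by
  have : {p : (Matrix (Fin n) (Fin m) ℝ × Matrix (Fin n) (Fin m) ℝ) ×
      (stdSimplex ℝ (Fin n) × stdSimplex ℝ (Fin m)) | p.2 ∈ nashSet p.1} =
      (⋂ x' ∈ stdSimplex ℝ (Fin n),
        {p | x' ⬝ᵥ (p.1.1 *ᵥ p.2.2.1) ≤ p.2.1.1 ⬝ᵥ (p.1.1 *ᵥ p.2.2.1)}) ∩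
      ⋂ y' ∈ stdSimplex ℝ (Fin m),
        {p | p.2.1.1 ⬝ᵥ (p.1.2 *ᵥ y') ≤ p.2.1.1 ⬝ᵥ (p.1.2 *ᵥ p.2.2.1)} := by
    ext p
    simp only [nashSet, IsNash, Set.mem_ofPred_eq, mem_inter_iff, mem_iInter]
    exact ⟨fun h => h.2.2, fun h => ⟨p.2.1.2, p.2.2.2, h⟩⟩
  rw [this]
  refine (isClosed_biInter fun x' _ => isClosed_le ?_ ?_).inter
    (isClosed_biInter fun y' _ => isClosed_le ?_ ?_)
  · fun_prop
  · fun_prop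
  · fun_prop
  · fun_prop

/-- The Nash equilibria vary lower hemicontinuously where the zero patterns of the minors of both
payoff matrices do not grow. -/
lemma eventually_exists_near_nash {X : Type*} [TopologicalSpace X] {n m : ℕ}
    {G : X → Matrix (Fin n) (Fin m) ℝ × Matrix (Fin n) (Fin m) ℝ} (hG : Continuous G) {x₀ : X}
    {z : stdSimplex ℝ (Fin n) × stdSimplex ℝ (Fin m)} (hz : z ∈ nashSet (G x₀)) {ε : ℝ}
    (hε : 0 < ε) :
    ∀ᶠ x in 𝓝 x₀,
      ((∀ τ, minor (payoffForms (G x₀).1) τ = 0 → minor (payoffForms (G x).1) τ = 0) ∧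
        ∀ τ, minor (payoffForms (G x₀).2ᵀ) τ = 0 → minor (payoffForms (G x).2ᵀ) τ = 0) →
      ∃ z' ∈ nashSet (G x), dist z' z < ε := by
  obtain ⟨hx, hy, h1, h2⟩ := isNash_iff.1 (show IsNash _ _ _ _ from hz)
  filter_upwards [
    eventually_exists_near_strategy (S := {i | z.1.1 i ≠ 0}) (T := {j | z.2.1 j ≠ 0})
      (continuous_fst.comp hG) hy (fun j hj => not_not.1 hj) (fun i hi => h1 i hi) hε,
    eventually_exists_near_strategy (S := {j | z.2.1 j ≠ 0}) (T := {i | z.1.1 i ≠ 0})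
      (continuous_snd.comp hG).matrix_transpose hx (fun j hj => not_not.1 hj)
      (fun i hi => h2 i hi) hε] with x hA hB hm
  obtain ⟨y', ⟨hy', hyT, hyS⟩, hyd⟩ := hA hm.1
  obtain ⟨x', ⟨hx', hxT, hxS⟩, hxd⟩ := hB hm.2
  refine ⟨(⟨x', hx'⟩, ⟨y', hy'⟩), isNash_iff.2 ⟨hx', hy', fun i hi l => ?_, fun j hj k => ?_⟩,
    max_lt hxd hyd⟩
  · exact hyS i (fun h => hi (hxT i fun h' => h' h)) l
  · exact hxS j (fun h => hj (hyT j fun h' => h' h)) k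

/-! ### Existence of Nash equilibria -/

section Complementarity

variable {ι C : Type*} [Fintype C]

/-- `β` is the support of a positive solution of the linear system `∑ l c • col c = q`. -/
def IsFeasible (col : C → ι → ℝ) (q : ι → ℝ) (β : Finset C) : Prop :=
  ∃ l : C → ℝ, (∀ c ∈ β, 0 < l c) ∧ (∀ c ∉ β, l c = 0) ∧ ∑ c, l c • col c = q

variable [Fintype ι] [DecidableEq C]

/-- A door-in door-out principle: if the solution sets are bounded and `q` is generic, then a
feasible basis inside a set of one more column has exactly one feasible neighbour there. -/
lemma exists_unique_neighbour {col : C → ι → ℝ} {q : ι → ℝ}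
    (hgen : ∀ l : C → ℝ, ∑ c, l c • col c = q →
      Fintype.card ι ≤ (Finset.univ.filter fun c => l c ≠ 0).card)
    (hbd : ∀ v : C → ℝ, (∀ c, 0 ≤ v c) → ∑ c, v c • col c = 0 → v = 0)
    {γ : Finset C} (hγ : γ.card = Fintype.card ι + 1) {c₁ : C} (hc₁ : c₁ ∈ γ)
    (h₁ : IsFeasible col q (γ.erase c₁)) :
    ∃ c₂ ∈ γ, c₂ ≠ c₁ ∧ IsFeasible col q (γ.erase c₂) ∧
      ∀ c ∈ γ, IsFeasible col q (γ.erase c) → c = c₁ ∨ c = c₂ := by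
  obtain ⟨l, hl1, hl0, hlq⟩ := h₁
  have hsum : ∀ (v : C → ℝ) (t : ℝ), ∑ c, v c • col c = 0 →
      ∑ c, (l c + t * v c) • col c = q := by
    intro v t hv
    simp only [add_smul, Finset.sum_add_distrib, mul_smul, ← Finset.smul_sum, hlq, hv]
    simp
  have hsupp : ∀ (l' : C → ℝ) (β : Finset C), (∀ c ∉ β, l' c = 0) → ∑ c, l' c • col c = q →
      Fintype.card ι ≤ β.card := by
    intro l' β h0 hq
    refine (hgen l' hq).trans (Finset.card_le_card fun c hc => ?_)
    by_contra h
    exact (Finset.mem_filter.1 hc).2 (h0 c h)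
  have hcard : ∀ c ∈ γ, (γ.erase c).card = Fintype.card ι := fun c hc => by
    rw [Finset.card_erase_of_mem hc, hγ]; rfl
  -- The columns of a feasible basis are independent.
  have hker : ∀ v : C → ℝ, (∀ c ∉ γ.erase c₁, v c = 0) → ∑ c, v c • col c = 0 → v = 0 := by
    intro v hv0 hv
    by_contra hne
    obtain ⟨c, hc⟩ := Function.ne_iff.1 hne
    have hc : v c ≠ 0 := hc
    have hcβ : c ∈ γ.erase c₁ := by
      by_contra h; exact hc (hv0 c h)
    have := hsupp (fun d => l d + -(l c / v c) * v d) ((γ.erase c₁).erase c) (by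
      intro d hd
      rw [Finset.mem_erase, not_and_or, not_not] at hd
      rcases hd with rfl | hd
      · field_simp; ring
      · simp [hl0 d hd, hv0 d hd]) (hsum v _ hv)
    rw [Finset.card_erase_of_mem hcβ, hcard c₁ hc₁] at this
    have : 0 < Fintype.card ι := by
      rw [← hcard c₁ hc₁]; exact Finset.card_pos.2 ⟨c, hcβ⟩
    omega
  -- The solutions supported in `γ` form the line `l + t • v`.
  obtain ⟨v, hvγ, hv, hv1⟩ : ∃ v : C → ℝ, (∀ c ∉ γ, v c = 0) ∧ ∑ c, v c • col c = 0 ∧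
      v c₁ = 1 := by
    have hdep : ¬LinearIndependent ℝ fun c : γ => col c := by
      intro h
      have := h.fintype_card_le_finrank
      rw [Module.finrank_fintype_fun_eq_card, Fintype.card_coe, hγ] at this
      omega
    obtain ⟨g, hg, c, hgc⟩ := Fintype.not_linearIndependent_iff.1 hdep
    let u : C → ℝ := fun c => if h : c ∈ γ then g ⟨c, h⟩ else 0
    have hu0 : ∀ c ∉ γ, u c = 0 := fun c hc => by simp [u, hc]
    have hu : ∑ c, u c • col c = 0 := by
      rw [← Finset.sum_subset (Finset.subset_univ γ) (fun c _ hc => by rw [hu0 c hc, zero_smul]),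
        ← Finset.sum_coe_sort]
      rw [← hg]
      exact Finset.sum_congr rfl fun c _ => by simp [u]
    have hu1 : u c₁ ≠ 0 := by
      intro h
      have : u = 0 := hker u (fun d hd => by
        rw [Finset.mem_erase, not_and_or, not_not] at hd
        rcases hd with rfl | hd
        exacts [h, hu0 d hd]) hu
      apply hgc
      have := congrFun this c
      simpa [u] using this
    refine ⟨fun c => (u c₁)⁻¹ * u c, fun c hc => by simp [hu0 c hc], ?_, inv_mul_cancel₀ hu1⟩
    simp only [mul_smul, ← Finset.smul_sum, hu, smul_zero]
  have hl1c : l c₁ = 0 := hl0 c₁ (Finset.notMem_erase _ _)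
  have hline : ∀ l' : C → ℝ, (∀ c ∉ γ, l' c = 0) → ∑ c, l' c • col c = q →
      ∀ c, l' c = l c + l' c₁ * v c := by
    intro l' h0 hq c
    have := hker (fun c => l' c - (l c + l' c₁ * v c)) (fun d hd => by
      rw [Finset.mem_erase, not_and_or, not_not] at hd
      rcases hd with rfl | hd
      · simp [hl1c, hv1]
      · rw [h0 d hd, hvγ d hd, hl0 d (fun h => hd (Finset.mem_of_mem_erase h))]; simp) (by
      simp only [sub_smul, Finset.sum_sub_distrib, hq, hsum v _ hv, sub_self])
    have := congrFun this c
    simp only [Pi.zero_apply] at this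
    linarith
  have hlpos : ∀ c ∈ γ, c ≠ c₁ → 0 < l c := fun c hc hne => hl1 c (Finset.mem_erase.2 ⟨hne, hc⟩)
  have hl_nonneg : ∀ c, 0 ≤ l c := fun c => by
    by_cases hc : c ∈ γ.erase c₁
    exacts [(hl1 c hc).le, (hl0 c hc).ge]
  have hneg : (Finset.univ.filter fun c => v c < 0).Nonempty := by
    by_contra hno
    rw [Finset.not_nonempty_iff_eq_empty, Finset.filter_eq_empty_iff] at hno
    have := hbd v (fun c => not_lt.1 (hno (Finset.mem_univ c))) hv
    rw [this] at hv1
    simp at hv1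
  -- The ratio test: moving along the line, the coordinate of `c₂` is the first to vanish.
  obtain ⟨c₂, hc₂, hmin⟩ := Finset.exists_min_image _ (fun c => l c / -v c) hneg
  have hvc₂ : v c₂ < 0 := (Finset.mem_filter.1 hc₂).2
  have hc₂γ : c₂ ∈ γ := by
    by_contra h; rw [hvγ c₂ h] at hvc₂; exact lt_irrefl _ hvc₂
  have hne : c₂ ≠ c₁ := by
    rintro rfl; rw [hv1] at hvc₂; linarith
  have ht : 0 < l c₂ / -v c₂ := div_pos (hlpos c₂ hc₂γ hne) (neg_pos.2 hvc₂)
  refine ⟨c₂, hc₂γ, hne, ?_, ?_⟩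
  · let l' : C → ℝ := fun c => l c + l c₂ / -v c₂ * v c
    have hl'q : ∑ c, l' c • col c = q := hsum v _ hv
    have hl'0 : ∀ c ∉ γ.erase c₂, l' c = 0 := by
      intro c hc
      rw [Finset.mem_erase, not_and_or, not_not] at hc
      rcases hc with rfl | hc
      · show l c + l c / -v c * v c = 0
        have := hvc₂.ne
        field_simp
        ring
      · simp only [l']
        rw [hvγ c hc, hl0 c (fun h => hc (Finset.mem_of_mem_erase h))]; simp
    have hl'n : ∀ c, 0 ≤ l' c := by
      intro c
      simp only [l']
      rcases lt_or_ge (v c) 0 with h | h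
      · have := hmin c (by simpa using h)
        rw [le_div_iff₀ (neg_pos.2 h)] at this
        linarith
      · exact add_nonneg (hl_nonneg c) (mul_nonneg ht.le h)
    -- No other coordinate vanishes at the same time, by genericity.
    refine ⟨l', fun c hc => lt_of_le_of_ne (hl'n c) fun h => ?_, hl'0, hl'q⟩
    have := hsupp l' ((γ.erase c₂).erase c) (fun d hd => by
      rw [Finset.mem_erase, not_and_or, not_not] at hd
      rcases hd with rfl | hd
      exacts [h.symm, hl'0 d hd]) hl'q
    have h2 := Finset.card_pos.2 ⟨c, hc⟩
    rw [Finset.card_erase_of_mem hc, hcard c₂ hc₂γ] at this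
    rw [hcard c₂ hc₂γ] at h2
    omega
  · rintro c hc ⟨l', hl'1, hl'0, hl'q⟩
    by_cases hcc : c = c₁
    · exact Or.inl hcc
    right
    have hl'γ := hline l' (fun d hd => hl'0 d fun h => hd (Finset.mem_of_mem_erase h)) hl'q
    have ht' : 0 < l' c₁ := hl'1 c₁ (Finset.mem_erase.2 ⟨Ne.symm hcc, hc₁⟩)
    have hl'n : ∀ d, 0 ≤ l' d := fun d => by
      by_cases hd : d ∈ γ.erase c
      exacts [(hl'1 d hd).le, (hl'0 d hd).ge]
    have h0 := hl'γ c
    rw [hl'0 c (Finset.notMem_erase _ _)] at h0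
    have hlc := hlpos c hc hcc
    have hvc : v c < 0 := by
      by_contra h
      have := mul_nonneg ht'.le (not_lt.1 h)
      linarith
    have h1 := hmin c (by simpa using hvc)
    have h2 : l c / -v c = l' c₁ := by
      rw [div_eq_iff (by linarith)]; linarith
    rw [h2] at h1
    have h3 : l c₂ + l' c₁ * v c₂ ≤ 0 := by
      rw [div_le_iff₀ (neg_pos.2 hvc₂)] at h1
      linarith
    rw [← hl'γ c₂] at h3
    by_contra hcne
    exact absurd (hl'1 c₂ (Finset.mem_erase.2 ⟨fun h => hcne h.symm, hc₂γ⟩)) (not_lt.2 h3)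

/-- The number of feasible bases obtained from `γ` by removing a column is `0` or `2`; counted in
`ZMod 2`. -/
lemma even_card_feasible {col : C → ι → ℝ} {q : ι → ℝ}
    (hgen : ∀ l : C → ℝ, ∑ c, l c • col c = q →
      Fintype.card ι ≤ (Finset.univ.filter fun c => l c ≠ 0).card)
    (hbd : ∀ v : C → ℝ, (∀ c, 0 ≤ v c) → ∑ c, v c • col c = 0 → v = 0)
    {γ : Finset C} (hγ : γ.card = Fintype.card ι + 1)
    [DecidablePred fun c => IsFeasible col q (γ.erase c)] :
    ∑ c ∈ γ, (if IsFeasible col q (γ.erase c) then 1 else 0 : ZMod 2) = 0 := by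
  rw [← Finset.sum_filter]
  by_cases hno : ∃ c₁ ∈ γ, IsFeasible col q (γ.erase c₁)
  · obtain ⟨c₁, hc₁, h₁⟩ := hno
    obtain ⟨c₂, hc₂, hne, h₂, huniq⟩ := exists_unique_neighbour hgen hbd hγ hc₁ h₁
    have : γ.filter (fun c => IsFeasible col q (γ.erase c)) = {c₁, c₂} := by
      ext c
      simp only [Finset.mem_filter, Finset.mem_insert, Finset.mem_singleton]
      constructor
      · rintro ⟨hc, h⟩; exact huniq c hc h
      · rintro (rfl | rfl)
        exacts [⟨hc₁, h₁⟩, ⟨hc₂, h₂⟩]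
    rw [this, Finset.sum_pair hne.symm]
    decide
  · push Not at hno
    rw [Finset.filter_eq_empty_iff.2 (fun c hc => hno c hc), Finset.sum_empty]

end Complementarity

section LemkeHowson

variable {ι : Type*}

/-- The columns of the system `∑ z k • P k + s = q` in the variables `z` and `s`. -/
def slackCol [DecidableEq ι] (P : ι → ι → ℝ) : ι ⊕ ι → ι → ℝ
  | .inl k => P k
  | .inr k => Pi.single k 1

/-- The column with index `i` selected by `σ`: the variable `z i` or the slack `s i`. -/
def sel (σ : ι → Bool) (i : ι) : ι ⊕ ι := if σ i then .inl i else .inr i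

lemma sel_injective (σ : ι → Bool) : Function.Injective (sel σ) := by
  intro i j h
  unfold sel at h
  split_ifs at h <;> simpa using h

variable [Fintype ι] [DecidableEq ι]

/-- One column from each complementary pair. -/
def selSet (σ : ι → Bool) : Finset (ι ⊕ ι) := Finset.univ.image (sel σ)

lemma mem_selSet_inl {σ : ι → Bool} {i : ι} : Sum.inl i ∈ selSet σ ↔ σ i = true := by
  simp only [selSet, Finset.mem_image, Finset.mem_univ, true_and, sel]
  constructor
  · rintro ⟨j, hj⟩
    split_ifs at hj with h
    rw [← Sum.inl.inj hj]; exact h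
  · intro h
    exact ⟨i, by simp [h]⟩

lemma mem_selSet_inr {σ : ι → Bool} {i : ι} : Sum.inr i ∈ selSet σ ↔ σ i = false := by
  simp only [selSet, Finset.mem_image, Finset.mem_univ, true_and, sel]
  constructor
  · rintro ⟨j, hj⟩
    split_ifs at hj with h
    rw [← Sum.inr.inj hj]; simpa using h
  · intro h
    exact ⟨i, by simp [h]⟩

lemma card_selSet (σ : ι → Bool) : (selSet σ).card = Fintype.card ι := by
  rw [selSet, Finset.card_image_of_injective _ (sel_injective σ), Finset.card_univ]

/-- The number of complementary feasible bases is even: count the pairs of an almost complementary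
set `γ`, containing both columns with index `k`, and a column whose removal leaves a feasible
basis. -/
lemma sum_feasible_selSet {P : ι → ι → ℝ} {q : ι → ℝ}
    (hgen : ∀ l : ι ⊕ ι → ℝ, ∑ c, l c • slackCol P c = q →
      Fintype.card ι ≤ (Finset.univ.filter fun c => l c ≠ 0).card)
    (hbd : ∀ v : ι ⊕ ι → ℝ, (∀ c, 0 ≤ v c) → ∑ c, v c • slackCol P c = 0 → v = 0) (k : ι)
    [DecidablePred (IsFeasible (slackCol P) q)] :
    ∑ σ : ι → Bool, (if IsFeasible (slackCol P) q (selSet σ) then 1 else 0 : ZMod 2) = 0 := by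
  let φ : Finset (ι ⊕ ι) → ZMod 2 := fun β => if IsFeasible (slackCol P) q β then 1 else 0
  let T : Finset (ι → Bool) := Finset.univ.filter fun σ => σ k = false
  let γ : (ι → Bool) → Finset (ι ⊕ ι) := fun σ => insert (.inl k) (selSet σ)
  have hk : ∀ σ ∈ T, σ k = false := fun σ hσ => (Finset.mem_filter.1 hσ).2
  have hnot : ∀ σ ∈ T, Sum.inl k ∉ selSet σ := fun σ hσ => by
    rw [mem_selSet_inl, hk σ hσ]; simp
  have hselk : ∀ σ ∈ T, sel σ k = .inr k := fun σ hσ => by simp [sel, hk σ hσ]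
  -- Removing one of the two columns with index `k` gives all complementary sets.
  have hfirst : ∑ σ ∈ T, (φ ((γ σ).erase (.inl k)) + φ ((γ σ).erase (.inr k))) =
      ∑ σ : ι → Bool, φ (selSet σ) := by
    have h1 : ∀ σ ∈ T, (γ σ).erase (.inl k) = selSet σ := fun σ hσ =>
      Finset.erase_insert (hnot σ hσ)
    have h2 : ∀ σ ∈ T, (γ σ).erase (.inr k) = selSet (Function.update σ k true) := by
      intro σ hσ
      ext c
      rcases c with i | i
      · simp only [γ, Finset.mem_erase, Finset.mem_insert, mem_selSet_inl, Sum.inl.injEq]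
        by_cases hi : i = k
        · subst hi; simp
        · simp [hi]
      · simp only [γ, Finset.mem_erase, Finset.mem_insert, mem_selSet_inr]
        by_cases hi : i = k
        · subst hi; simp
        · simp [hi]
    have h3 : ∑ σ ∈ T, φ ((γ σ).erase (.inl k)) = ∑ σ ∈ T, φ (selSet σ) :=
      Finset.sum_congr rfl fun σ hσ => by rw [h1 σ hσ]
    have h4 : ∑ σ ∈ T, φ ((γ σ).erase (.inr k)) = ∑ σ ∈ T, φ (selSet (Function.update σ k true)) :=
      Finset.sum_congr rfl fun σ hσ => by rw [h2 σ hσ]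
    rw [Finset.sum_add_distrib, h3, h4,
      ← Finset.sum_filter_add_sum_filter_not Finset.univ (fun σ : ι → Bool => σ k = false)]
    congr 1
    refine Finset.sum_bij' (fun σ _ => Function.update σ k true)
      (fun σ _ => Function.update σ k false) ?_ ?_ ?_ ?_ ?_
    · intro σ _; simp
    · intro σ _; simp [T]
    · intro σ hσ; simp [← hk σ hσ]
    · intro σ hσ
      have : σ k = true := by simpa using hσ
      simp [← this]
    · intro σ _; rfl
  -- The remaining removals cancel in pairs.
  have hrest : ∀ i, i ≠ k → ∑ σ ∈ T, φ ((γ σ).erase (sel σ i)) = 0 := by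
    intro i hi
    refine Finset.sum_involution (fun σ _ => Function.update σ i (!σ i)) ?_ ?_ ?_ ?_
    · intro σ hσ
      have : (γ σ).erase (sel σ i) =
          (γ (Function.update σ i (!σ i))).erase (sel (Function.update σ i (!σ i)) i) := by
        ext c
        rcases c with j | j
        · simp only [γ, Finset.mem_erase, Finset.mem_insert, mem_selSet_inl, Sum.inl.injEq, sel]
          by_cases hj : j = i
          · subst hj; cases h : σ j <;> simp [hi]
          · cases h : σ i <;> simp [hj]
        · simp only [γ, Finset.mem_erase, Finset.mem_insert, mem_selSet_inr, sel]
          by_cases hj : j = i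
          · subst hj; cases h : σ j <;> simp
          · cases h : σ i <;> simp [hj]
      rw [← this]
      exact CharTwo.add_self_eq_zero _
    · intro σ _ _ h
      have := congrFun h i
      simp at this
    · intro σ hσ
      simp only [T, Finset.mem_filter, Finset.mem_univ, true_and]
      rw [Function.update_of_ne (Ne.symm hi)]
      exact hk σ hσ
    · intro σ _; simp
  have htotal : ∀ σ ∈ T, ∑ c ∈ γ σ, φ ((γ σ).erase c) = 0 := by
    intro σ hσ
    refine even_card_feasible hgen hbd ?_
    rw [Finset.card_insert_of_notMem (hnot σ hσ), card_selSet]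
  have hsplit : ∀ σ ∈ T, ∑ c ∈ γ σ, φ ((γ σ).erase c) =
      (φ ((γ σ).erase (.inl k)) + φ ((γ σ).erase (.inr k))) +
        ∑ i ∈ Finset.univ.erase k, φ ((γ σ).erase (sel σ i)) := by
    intro σ hσ
    rw [Finset.sum_insert (hnot σ hσ), selSet, Finset.sum_image fun _ _ _ _ h => sel_injective σ h,
      ← Finset.add_sum_erase _ _ (Finset.mem_univ k), hselk σ hσ, add_assoc]
  have h0 := Finset.sum_congr rfl hsplit
  rw [Finset.sum_congr rfl htotal, Finset.sum_const_zero, Finset.sum_add_distrib, hfirst,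
    Finset.sum_comm, Finset.sum_eq_zero (fun i hi => hrest i (Finset.ne_of_mem_erase hi)),
    add_zero] at h0
  exact h0.symm

/-- A generic linear complementarity problem with nonnegative nonzero columns has a nontrivial
solution: the slack variables alone form a complementary feasible basis, so by parity there is
another one. -/
lemma exists_complementary_of_generic [Nonempty ι] {P : ι → ι → ℝ} (hP : ∀ k i, 0 ≤ P k i)
    (hP0 : ∀ k, ∃ i, 0 < P k i) {q : ι → ℝ} (hq : ∀ i, 0 < q i)
    (hgen : ∀ l : ι ⊕ ι → ℝ, ∑ c, l c • slackCol P c = q →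
      Fintype.card ι ≤ (Finset.univ.filter fun c => l c ≠ 0).card) :
    ∃ z s : ι → ℝ, (∀ i, 0 ≤ z i) ∧ (∀ i, 0 ≤ s i) ∧ (∀ i, z i = 0 ∨ s i = 0) ∧
      (∃ i, 0 < z i) ∧ ∑ k, z k • P k + s = q := by
  classical
  obtain ⟨k⟩ := ‹Nonempty ι›
  have hcol : ∀ c i, 0 ≤ slackCol P c i := by
    rintro (c | c) i
    · exact hP c i
    · by_cases h : i = c
      · subst h; simp [slackCol]
      · simp [slackCol, h]
  have hcol0 : ∀ c, ∃ i, 0 < slackCol P c i := by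
    rintro (c | c)
    · exact hP0 c
    · exact ⟨c, by simp [slackCol]⟩
  have hbd : ∀ v : ι ⊕ ι → ℝ, (∀ c, 0 ≤ v c) → ∑ c, v c • slackCol P c = 0 → v = 0 := by
    intro v hv h
    ext c
    obtain ⟨i, hi⟩ := hcol0 c
    have h1 := congrFun h i
    rw [Finset.sum_apply] at h1
    have := (Finset.sum_eq_zero_iff_of_nonneg fun c _ => mul_nonneg (hv c) (hcol c i)).1 h1 c
      (Finset.mem_univ c)
    exact (mul_eq_zero.1 this).resolve_right hi.ne'
  have hsum := sum_feasible_selSet hgen hbd k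
  have h0 : IsFeasible (slackCol P) q (selSet fun _ => false) := by
    refine ⟨Sum.elim 0 q, ?_, ?_, ?_⟩
    · rintro (c | c) hc
      · simp [mem_selSet_inl] at hc
      · exact hq c
    · rintro (c | c) hc
      · rfl
      · simp [mem_selSet_inr] at hc
    · ext i
      simp [Fintype.sum_sum_type, slackCol, Finset.sum_apply, Pi.single_apply]
  obtain ⟨σ, hσ, hf⟩ : ∃ σ, σ ≠ (fun _ => false) ∧ IsFeasible (slackCol P) q (selSet σ) := by
    by_contra hno
    push Not at hno
    rw [Finset.sum_eq_single (fun _ => false) (fun σ _ hσ => if_neg (hno σ hσ)) (by simp),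
      if_pos h0] at hsum
    exact one_ne_zero hsum
  obtain ⟨l, hl1, hl0, hlq⟩ := hf
  have hnn : ∀ c, 0 ≤ l c := fun c => by
    by_cases hc : c ∈ selSet σ
    exacts [(hl1 c hc).le, (hl0 c hc).ge]
  refine ⟨fun i => l (.inl i), fun i => l (.inr i), fun i => hnn _, fun i => hnn _, fun i => ?_,
    ?_, ?_⟩
  · cases h : σ i
    · exact Or.inl (hl0 _ (by rw [mem_selSet_inl, h]; simp))
    · exact Or.inr (hl0 _ (by rw [mem_selSet_inr, h]; simp))
  · obtain ⟨i, hi⟩ := Function.ne_iff.1 hσ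
    exact ⟨i, hl1 _ (by rw [mem_selSet_inl]; simpa using hi)⟩
  · rw [← hlq, Fintype.sum_sum_type]
    congr 1
    ext i
    simp [slackCol, Finset.sum_apply, Pi.single_apply]

end LemkeHowson

/-- Right-hand sides outside the finitely many proper subspaces spanned by few columns are dense. -/
lemma dense_generic {ι C : Type*} [Fintype ι] [Fintype C] (col : C → ι → ℝ) :
    Dense {q : ι → ℝ | ∀ l : C → ℝ, ∑ c, l c • col c = q →
      Fintype.card ι ≤ (Finset.univ.filter fun c => l c ≠ 0).card} := by
  classical
  have hT : ∀ T : Finset C, Dense {q : ι → ℝ | T.card < Fintype.card ι →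
      q ∉ Submodule.span ℝ (col '' T)} ∧ IsOpen {q : ι → ℝ | T.card < Fintype.card ι →
      q ∉ Submodule.span ℝ (col '' T)} := by
    intro T
    by_cases h : T.card < Fintype.card ι
    · have hne : Submodule.span ℝ (col '' T) ≠ ⊤ := by
        intro htop
        have h1 := finrank_span_finset_le_card (R := ℝ) (T.image col)
        rw [Finset.coe_image, Set.finrank, htop, finrank_top,
          Module.finrank_fintype_fun_eq_card] at h1
        exact absurd (h1.trans Finset.card_image_le) (not_le.2 h)
      have hcl : IsClosed (Submodule.span ℝ (col '' T) : Set (ι → ℝ)) :=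
        Submodule.closed_of_finiteDimensional _
      have heq : {q : ι → ℝ | T.card < Fintype.card ι → q ∉ Submodule.span ℝ (col '' T)} =
          (Submodule.span ℝ (col '' T) : Set (ι → ℝ))ᶜ := by
        ext q; simp [h]
      rw [heq]
      refine ⟨?_, hcl.isOpen_compl⟩
      rw [← interior_eq_empty_iff_dense_compl]
      by_contra hint
      exact hne (Submodule.eq_top_of_nonempty_interior' _ (nonempty_iff_ne_empty.2 hint))
    · simp [h]
  have hd : Dense (⋂ T : Finset C, {q : ι → ℝ | T.card < Fintype.card ι →
      q ∉ Submodule.span ℝ (col '' T)}) :=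
    dense_iInter_of_isOpen (fun T => (hT T).2) fun T => (hT T).1
  refine hd.mono fun q hq l hl => ?_
  by_contra hlt
  refine mem_iInter.1 hq (Finset.univ.filter fun c => l c ≠ 0) (not_le.1 hlt) ?_
  rw [← hl]
  refine Submodule.sum_mem _ fun c _ => ?_
  by_cases hc : l c = 0
  · simp [hc]
  · exact Submodule.smul_mem _ _ (Submodule.subset_span ⟨c, by simpa using hc, rfl⟩)

/-- The complementarity conditions of a game with right-hand side `(p, r)`, for unnormalized
strategies `x` and `y`. The last two conditions keep `x` and `y` away from zero in the limit. -/
def IsComplementary {n m : ℕ} (A B : Matrix (Fin n) (Fin m) ℝ) (p : Fin n → ℝ) (r : Fin m → ℝ)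
    (x : Fin n → ℝ) (y : Fin m → ℝ) : Prop :=
  (∀ i, (A *ᵥ y) i ≤ p i ∧ x i * (p i - (A *ᵥ y) i) = 0) ∧
    (∀ j, (Bᵀ *ᵥ x) j ≤ r j ∧ y j * (r j - (Bᵀ *ᵥ x) j) = 0) ∧
    1 / 2 ≤ ∑ i, (A *ᵥ y) i ∧ 1 / 2 ≤ ∑ j, (Bᵀ *ᵥ x) j

lemma exists_isComplementary_of_generic {n m : ℕ} (hn : 0 < n) (hm : 0 < m)
    {A B : Matrix (Fin n) (Fin m) ℝ} (hA : ∀ i j, 1 ≤ A i j) (hB : ∀ i j, 1 ≤ B i j)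
    {q : Fin n ⊕ Fin m → ℝ} (hq1 : ∀ k, 1 / 2 ≤ q k) (hq2 : ∀ k, q k ≤ 2)
    (hgen : ∀ l : (Fin n ⊕ Fin m) ⊕ (Fin n ⊕ Fin m) → ℝ, ∑ c, l c • slackCol
      (Sum.elim (fun i => Sum.elim 0 (B i)) fun j => Sum.elim (fun i => A i j) 0) c = q →
      Fintype.card (Fin n ⊕ Fin m) ≤ (Finset.univ.filter fun c => l c ≠ 0).card) :
    ∃ x ∈ Icc (0 : Fin n → ℝ) 2, ∃ y ∈ Icc (0 : Fin m → ℝ) 2,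
      IsComplementary A B (fun i => q (.inl i)) (fun j => q (.inr j)) x y := by
  have : Nonempty (Fin n) := ⟨⟨0, hn⟩⟩
  have : Nonempty (Fin m) := ⟨⟨0, hm⟩⟩
  obtain ⟨z, s, hz, hs, hzs, ⟨k, hk⟩, hsum⟩ := exists_complementary_of_generic
    (P := Sum.elim (fun i => Sum.elim 0 (B i)) fun j => Sum.elim (fun i => A i j) 0)
    (by
      rintro (k | k) (i | i)
      · exact le_rfl
      · exact zero_le_one.trans (hB k i)
      · exact zero_le_one.trans (hA i k)
      · exact le_rfl)
    (by
      rintro (k | k)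
      · exact ⟨.inr (Classical.arbitrary _), one_pos.trans_le (hB k _)⟩
      · exact ⟨.inl (Classical.arbitrary _), one_pos.trans_le (hA _ k)⟩)
    (fun i => by linarith [hq1 i]) hgen
  set x : Fin n → ℝ := fun i => z (.inl i) with hx
  set y : Fin m → ℝ := fun j => z (.inr j) with hy
  have hAy : ∀ i, (A *ᵥ y) i + s (.inl i) = q (.inl i) := by
    intro i
    rw [← hsum]
    simp [Fintype.sum_sum_type, Finset.sum_apply, Matrix.mulVec, dotProduct, hy, mul_comm]
  have hBx : ∀ j, (Bᵀ *ᵥ x) j + s (.inr j) = q (.inr j) := by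
    intro j
    rw [← hsum]
    simp [Fintype.sum_sum_type, Finset.sum_apply, Matrix.mulVec, dotProduct, hx, mul_comm]
  have hx_nn : ∀ i, 0 ≤ x i := fun i => hz _
  have hy_nn : ∀ j, 0 ≤ y j := fun j => hz _
  have hAn : ∀ i, 0 ≤ (A *ᵥ y) i := by
    intro i
    simp only [Matrix.mulVec, dotProduct]
    exact Finset.sum_nonneg fun j _ => mul_nonneg (zero_le_one.trans (hA i j)) (hy_nn j)
  have hBn : ∀ j, 0 ≤ (Bᵀ *ᵥ x) j := by
    intro j
    simp only [Matrix.mulVec, dotProduct, Matrix.transpose_apply]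
    exact Finset.sum_nonneg fun i _ => mul_nonneg (zero_le_one.trans (hB i j)) (hx_nn i)
  have hyA : ∀ i j, y j ≤ (A *ᵥ y) i := fun i j =>
    (le_mul_of_one_le_left (hz _) (hA i j)).trans
      (Finset.single_le_sum (f := fun j => A i j * y j)
        (fun j _ => mul_nonneg (zero_le_one.trans (hA i j)) (hz _)) (Finset.mem_univ j))
  have hxB : ∀ j i, x i ≤ (Bᵀ *ᵥ x) j := fun j i =>
    (le_mul_of_one_le_left (hz _) (hB i j)).trans
      (Finset.single_le_sum (f := fun i => B i j * x i)
        (fun i _ => mul_nonneg (zero_le_one.trans (hB i j)) (hz _)) (Finset.mem_univ i))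
  have hx0 : ∀ i, 0 < x i → 1 / 2 ≤ (A *ᵥ y) i := fun i hi => by
    have := (hzs (.inl i)).resolve_left hi.ne'
    have h2 := hAy i
    rw [this, add_zero] at h2
    rw [h2]; exact hq1 _
  have hy0 : ∀ j, 0 < y j → 1 / 2 ≤ (Bᵀ *ᵥ x) j := fun j hj => by
    have := (hzs (.inr j)).resolve_left hj.ne'
    have h2 := hBx j
    rw [this, add_zero] at h2
    rw [h2]; exact hq1 _
  have hposA : ∀ i, 1 / 2 ≤ (A *ᵥ y) i → ∃ j, 0 < y j := by
    intro i hi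
    by_contra hno
    push Not at hno
    have : y = 0 := funext fun j => le_antisymm (hno j) (hz _)
    rw [this, Matrix.mulVec_zero] at hi
    norm_num at hi
  have hposB : ∀ j, 1 / 2 ≤ (Bᵀ *ᵥ x) j → ∃ i, 0 < x i := by
    intro j hj
    by_contra hno
    push Not at hno
    have : x = 0 := funext fun i => le_antisymm (hno i) (hz _)
    rw [this, Matrix.mulVec_zero] at hj
    norm_num at hj
  have hboth : (∃ i, 0 < x i) ∧ ∃ j, 0 < y j := by
    rcases k with i | j
    · obtain ⟨j, hj⟩ := hposA i (hx0 i hk)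
      exact ⟨⟨i, hk⟩, j, hj⟩
    · obtain ⟨i, hi⟩ := hposB j (hy0 j hk)
      exact ⟨⟨i, hi⟩, j, hk⟩
  obtain ⟨⟨i₀, hi₀⟩, j₀, hj₀⟩ := hboth
  refine ⟨x, ⟨fun i => hz _, fun i => ?_⟩, y, ⟨fun j => hz _, fun j => ?_⟩,
    fun i => ⟨?_, ?_⟩, fun j => ⟨?_, ?_⟩, ?_, ?_⟩
  · have := hxB j₀ i
    have h2 := hBx j₀
    have h3 := hs (.inr j₀)
    have h4 := hq2 (.inr j₀)
    show x i ≤ 2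
    linarith
  · have := hyA i₀ j
    have h2 := hAy i₀
    have h3 := hs (.inl i₀)
    have h4 := hq2 (.inl i₀)
    show y j ≤ 2
    linarith
  · linarith [hAy i, hs (.inl i)]
  · rcases hzs (.inl i) with h | h
    · simp [hx, h]
    · simp [← hAy i, h]
  · linarith [hBx j, hs (.inr j)]
  · rcases hzs (.inr j) with h | h
    · simp [hy, h]
    · simp [← hBx j, h]
  · exact (hx0 i₀ hi₀).trans (Finset.single_le_sum (fun i _ => hAn i) (Finset.mem_univ i₀))
  · exact (hy0 j₀ hj₀).trans (Finset.single_le_sum (fun j _ => hBn j) (Finset.mem_univ j₀))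

/-- For right-hand side `1` the normalized solutions of the complementarity conditions are Nash
equilibria; they are limits of solutions for generic right-hand sides. -/
lemma exists_isNash_of_one_le {n m : ℕ} (hn : 0 < n) (hm : 0 < m)
    {A B : Matrix (Fin n) (Fin m) ℝ} (hA : ∀ i j, 1 ≤ A i j) (hB : ∀ i j, 1 ≤ B i j) :
    ∃ x y, IsNash A B x y := by
  -- Generic right-hand sides are dense and solvability is a closed condition.
  let K : Set ((Fin n ⊕ Fin m → ℝ) × ((Fin n → ℝ) × (Fin m → ℝ))) :=
    {t | IsComplementary A B (fun i => t.1 (.inl i)) (fun j => t.1 (.inr j)) t.2.1 t.2.2}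
  have hK : IsClosed K := by
    simp only [K, IsComplementary, ofPred_and, ofPred_forall]
    refine (isClosed_iInter fun i => (isClosed_le ?_ ?_).inter (isClosed_eq ?_ ?_)).inter
      ((isClosed_iInter fun j => (isClosed_le ?_ ?_).inter (isClosed_eq ?_ ?_)).inter
      ((isClosed_le ?_ ?_).inter (isClosed_le ?_ ?_)))
    all_goals fun_prop
  have hcl : IsClosed (Prod.fst '' (K ∩ univ ×ˢ (Icc 0 2 ×ˢ Icc 0 2))) := by
    have hc : IsCompact (Icc (0 : Fin n → ℝ) 2 ×ˢ Icc (0 : Fin m → ℝ) 2) :=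
      isCompact_Icc.prod isCompact_Icc
    convert isClosedMap_fst_of_compactSpace
      (Y := ↥(Icc (0 : Fin n → ℝ) 2 ×ˢ Icc (0 : Fin m → ℝ) 2))
      _ (hK.preimage (continuous_id.prodMap continuous_subtype_val)) using 1
    · ext q
      constructor
      · rintro ⟨⟨q, z⟩, ⟨h1, h2⟩, rfl⟩
        exact ⟨(q, ⟨z, h2.2⟩), h1, rfl⟩
      · rintro ⟨⟨q, z⟩, h1, rfl⟩
        exact ⟨(q, z.1), ⟨h1, mem_univ _, z.2⟩, rfl⟩
    · exact isCompact_iff_compactSpace.1 hc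
  have hmem : (1 : Fin n ⊕ Fin m → ℝ) ∈ Prod.fst '' (K ∩ univ ×ˢ (Icc 0 2 ×ˢ Icc 0 2)) := by
    rw [← hcl.closure_eq, Metric.mem_closure_iff]
    intro ε hε
    obtain ⟨q, hq, hqd⟩ := (dense_generic (slackCol
      (Sum.elim (fun i => Sum.elim 0 (B i)) fun j => Sum.elim (fun i => A i j) 0))).exists_dist_lt
      (1 : Fin n ⊕ Fin m → ℝ) (show 0 < min ε (1 / 2) by positivity)
    have hk : ∀ k, |1 - q k| < 1 / 2 := fun k =>
      (dist_le_pi_dist (1 : Fin n ⊕ Fin m → ℝ) q k).trans_lt (hqd.trans_le (min_le_right _ _))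
    obtain ⟨x, hx, y, hy, h⟩ := exists_isComplementary_of_generic hn hm hA hB
      (fun k => by linarith [(abs_lt.1 (hk k)).2]) (fun k => by linarith [(abs_lt.1 (hk k)).1]) hq
    exact ⟨q, ⟨(q, x, y), ⟨h, mem_univ _, hx, hy⟩, rfl⟩, hqd.trans_le (min_le_left _ _)⟩
  obtain ⟨⟨q, x, y⟩, ⟨⟨h1, h2, h3, h4⟩, -, hx, hy⟩, rfl : q = 1⟩ := hmem
  simp only [Pi.one_apply] at h1 h2 h3 h4
  have hpos : ∀ {k : ℕ} {v : Fin k → ℝ}, v ∈ Icc (0 : Fin k → ℝ) 2 → v ≠ 0 → 0 < ∑ i, v i := by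
    intro k v hv hv0
    obtain ⟨i, hi⟩ := Function.ne_iff.1 hv0
    exact Finset.sum_pos' (fun i _ => hv.1 i) ⟨i, Finset.mem_univ i, lt_of_le_of_ne (hv.1 i) (Ne.symm hi)⟩
  have hxs : 0 < ∑ i, x i := hpos hx (by rintro rfl; norm_num [Matrix.mulVec_zero] at h4)
  have hys : 0 < ∑ j, y j := hpos hy (by rintro rfl; norm_num [Matrix.mulVec_zero] at h3)
  have hnorm : ∀ {k : ℕ} {v : Fin k → ℝ}, v ∈ Icc (0 : Fin k → ℝ) 2 → 0 < ∑ i, v i →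
      (∑ i, v i)⁻¹ • v ∈ stdSimplex ℝ (Fin k) := by
    intro k v hv hs
    refine ⟨fun i => mul_nonneg (inv_nonneg.2 hs.le) (hv.1 i), ?_⟩
    simp only [Pi.smul_apply, smul_eq_mul, ← Finset.mul_sum]
    exact inv_mul_cancel₀ hs.ne'
  refine ⟨(∑ i, x i)⁻¹ • x, (∑ j, y j)⁻¹ • y, isNash_iff.2 ⟨hnorm hx hxs, hnorm hy hys, ?_, ?_⟩⟩
  · intro i hi l
    have hxi : x i ≠ 0 := fun h => hi (by simp [h])
    have := (mul_eq_zero.1 (h1 i).2).resolve_left hxi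
    rw [Matrix.mulVec_smul, Pi.smul_apply, Pi.smul_apply]
    exact mul_le_mul_of_nonneg_left (by linarith [(h1 l).1]) (inv_nonneg.2 hys.le)
  · intro j hj l
    have hyj : y j ≠ 0 := fun h => hj (by simp [h])
    have := (mul_eq_zero.1 (h2 j).2).resolve_left hyj
    rw [Matrix.mulVec_smul, Pi.smul_apply, Pi.smul_apply]
    exact mul_le_mul_of_nonneg_left (by linarith [(h2 l).1]) (inv_nonneg.2 hxs.le)

/-- Every bimatrix game has a Nash equilibrium. Adding constants to the payoffs makes them positive
without changing the equilibria. -/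
theorem exists_isNash {n m : ℕ} (hn : 0 < n) (hm : 0 < m) (A B : Matrix (Fin n) (Fin m) ℝ) :
    ∃ x y, IsNash A B x y := by
  have hshift : ∀ A : Matrix (Fin n) (Fin m) ℝ, ∃ c : ℝ, ∀ i j, 1 ≤ A i j + c := by
    intro A
    obtain ⟨c, hc⟩ := (Set.finite_range fun t : Fin n × Fin m => 1 - A t.1 t.2).bddAbove
    refine ⟨c, fun i j => ?_⟩
    have := hc ⟨(i, j), rfl⟩
    linarith
  obtain ⟨a, ha⟩ := hshift A
  obtain ⟨b, hb⟩ := hshift B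
  obtain ⟨x, y, h⟩ := exists_isNash_of_one_le (A := Matrix.of fun i j => A i j + a)
    (B := Matrix.of fun i j => B i j + b) hn hm ha hb
  obtain ⟨hx, hy, h1, h2⟩ := isNash_iff.1 h
  have hA : ∀ i, ((Matrix.of fun i j => A i j + a) *ᵥ y) i = (A *ᵥ y) i + a := fun i => by
    simp [Matrix.mulVec, dotProduct, add_mul, Finset.sum_add_distrib, ← Finset.mul_sum, hy.2]
  have hB : ∀ j, ((Matrix.of fun i j => B i j + b)ᵀ *ᵥ x) j = (Bᵀ *ᵥ x) j + b := fun j => by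
    simp [Matrix.mulVec, dotProduct, add_mul, Finset.sum_add_distrib, ← Finset.mul_sum, hx.2]
  refine ⟨x, y, isNash_iff.2 ⟨hx, hy, fun i hi l => ?_, fun j hj k => ?_⟩⟩
  · have := h1 i hi l
    rw [hA, hA] at this
    linarith
  · have := h2 j hj k
    rw [hB, hB] at this
    linarith

/-! ### Correlated equilibria versus Nash equilibria -/

lemma IsNash.isCorrelated {n m : ℕ} {A B : Matrix (Fin n) (Fin m) ℝ} {x : Fin n → ℝ}
    {y : Fin m → ℝ} (h : IsNash A B x y) : IsCorrelated A B fun i j => x i * y j := by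
  obtain ⟨hx, hy, hA, hB⟩ := isNash_iff.1 h
  refine ⟨fun i j => mul_nonneg (hx.1 i) (hy.1 j), ?_, fun i l => ?_, fun j k => ?_⟩
  · simp_rw [← Finset.mul_sum, hy.2, mul_one, hx.2]
  · have h1 : ∀ l, ∑ j, A l j * (x i * y j) = x i * (A *ᵥ y) l := fun l => by
      simp only [Matrix.mulVec, dotProduct, Finset.mul_sum]
      exact Finset.sum_congr rfl fun j _ => by ring
    rw [h1, h1]
    rcases eq_or_ne (x i) 0 with h0 | h0
    · simp [h0]
    · exact mul_le_mul_of_nonneg_left (hA i h0 l) (hx.1 i)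
  · have h1 : ∀ k, ∑ i, B i k * (x i * y j) = y j * (Bᵀ *ᵥ x) k := fun k => by
      simp only [Matrix.mulVec, dotProduct, Finset.mul_sum, Matrix.transpose_apply]
      exact Finset.sum_congr rfl fun j _ => by ring
    rw [h1, h1]
    rcases eq_or_ne (y j) 0 with h0 | h0
    · simp [h0]
    · exact mul_le_mul_of_nonneg_left (hB j h0 k) (hy.1 j)

/-- In a zero-sum game the marginals of a correlated equilibrium form a Nash equilibrium: no row
earns more than the value `∑ i, ∑ j, A i j * C i j` against the column marginal, and no column costs
less than that value against the row marginal. -/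
lemma IsCorrelated.isNash_marginals {n m : ℕ} {A C : Matrix (Fin n) (Fin m) ℝ}
    (h : IsCorrelated A (-A) C) : IsNash A (-A) (fun i => ∑ j, C i j) fun j => ∑ i, C i j := by
  obtain ⟨h0, h1, hA, hB⟩ := h
  set x : Fin n → ℝ := fun i => ∑ j, C i j with hx
  set y : Fin m → ℝ := fun j => ∑ i, C i j with hy
  set u : ℝ := ∑ i, ∑ j, A i j * C i j with hu
  have hxs : x ∈ stdSimplex ℝ (Fin n) := ⟨fun i => Finset.sum_nonneg fun j _ => h0 i j, h1⟩
  have hys : y ∈ stdSimplex ℝ (Fin m) :=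
    ⟨fun j => Finset.sum_nonneg fun i _ => h0 i j, by rw [← h1, Finset.sum_comm]⟩
  have hrow : ∀ l, (A *ᵥ y) l ≤ u := by
    intro l
    simp only [Matrix.mulVec, dotProduct, hy, Finset.mul_sum]
    rw [Finset.sum_comm]
    exact Finset.sum_le_sum fun i _ => hA i l
  have hcol : ∀ k, u ≤ (x ᵥ* A) k := by
    intro k
    simp only [Matrix.vecMul, dotProduct, hx, Finset.sum_mul]
    rw [hu, Finset.sum_comm, Finset.sum_comm (s := Finset.univ (α := Fin n))]
    refine Finset.sum_le_sum fun j _ => ?_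
    have := hB j k
    simp only [Matrix.neg_apply, neg_mul, Finset.sum_neg_distrib, neg_le_neg_iff] at this
    simpa only [mul_comm] using this
  have hle : ∀ x' ∈ stdSimplex ℝ (Fin n), x' ⬝ᵥ (A *ᵥ y) ≤ u := by
    intro x' hx'
    calc x' ⬝ᵥ (A *ᵥ y) ≤ ∑ i, x' i * u :=
          Finset.sum_le_sum fun i _ => mul_le_mul_of_nonneg_left (hrow i) (hx'.1 i)
      _ = u := by rw [← Finset.sum_mul, hx'.2, one_mul]
  have hge : ∀ y' ∈ stdSimplex ℝ (Fin m), u ≤ x ⬝ᵥ (A *ᵥ y') := by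
    intro y' hy'
    rw [Matrix.dotProduct_mulVec]
    calc u = ∑ j, u * y' j := by rw [← Finset.mul_sum, hy'.2, mul_one]
      _ ≤ (x ᵥ* A) ⬝ᵥ y' :=
          Finset.sum_le_sum fun j _ => mul_le_mul_of_nonneg_right (hcol j) (hy'.1 j)
  refine ⟨hxs, hys, fun x' hx' => (hle x' hx').trans (hge y hys), fun y' hy' => ?_⟩
  simp only [Matrix.neg_mulVec, dotProduct_neg, neg_le_neg_iff]
  exact (hle x hxs).trans (hge y' hy')

/-! ### A zero-sum game that performs divisions -/

lemma sum_update_bool {ι : Type*} [Fintype ι] [DecidableEq ι] (f : ι → Bool → ℝ) (v : ι → Bool)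
    (k : ι) (β : Bool) :
    ∑ l, f l (Function.update v k β l) = ∑ l, f l (v l) + (f k β - f k (v k)) := by
  rw [← sub_eq_iff_eq_add', ← Finset.sum_sub_distrib, Finset.sum_eq_single k]
  · simp
  · intro l _ hl
    simp [hl]
  · simp

/-- The sum of the zero-sum games with rows `(b k - a k, a k - b k)` and `(-a k, a k)`; a strategy
is a choice of a row, respectively a column, in every one of them, `true` standing for the first. -/
def divisionGame {ι : Type*} [Fintype ι] {N : ℕ} (e : Fin N ≃ (ι → Bool)) (a b : ι → ℝ) :
    Matrix (Fin N) (Fin N) ℝ := fun i j =>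
  ∑ k, ((if e i k then b k else 0) - a k) * if e j k then 1 else -1

/-- In equilibrium the row player chooses the first row of the `k`-th game with probability
`a k / b k`: with any other probability the column player has a strictly preferred column, and the
row player's only best response to that column makes the other column preferable or both equal. -/
lemma IsNash.division {ι : Type*} [Fintype ι] {N : ℕ} {e : Fin N ≃ (ι → Bool)}
    {a b : ι → ℝ} {x y : Fin N → ℝ}
    (h : IsNash (divisionGame e a b) (-divisionGame e a b) x y) {k : ι} (ha : 0 ≤ a k)
    (hab : a k ≤ b k) (hb : 0 < b k) : ∑ i, (if e i k then x i else 0) = a k / b k := by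
  classical
  obtain ⟨hx, hy, hA, hB⟩ := isNash_iff.1 h
  -- `u k` is the row player's expected payoff from the first column of the `k`-th game; the second
  -- column yields `-u k`. Against `t k` the rows of that game yield `(b k - a k) * t k` and
  -- `-a k * t k`.
  set t : ι → ℝ := fun k => ∑ j, (if e j k then 1 else -1) * y j with ht
  set u : ι → ℝ := fun k => ∑ i, ((if e i k then b k else 0) - a k) * x i with hu
  have hrow : ∀ i, (divisionGame e a b *ᵥ y) i =
      ∑ k, (fun k (β : Bool) => ((if β then b k else 0) - a k) * t k) k (e i k) := by
    intro i
    simp only [Matrix.mulVec, dotProduct, divisionGame, ht, Finset.sum_mul, Finset.mul_sum]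
    rw [Finset.sum_comm]
    exact Finset.sum_congr rfl fun _ _ => Finset.sum_congr rfl fun _ _ => by ring
  have hcol : ∀ j, ((-divisionGame e a b)ᵀ *ᵥ x) j =
      ∑ k, (fun k (β : Bool) => (if β then -1 else 1) * u k) k (e j k) := by
    intro j
    simp only [Matrix.mulVec, dotProduct, divisionGame, hu, Finset.sum_mul, Finset.mul_sum,
      Matrix.transpose_apply, Matrix.neg_apply, ← Finset.sum_neg_distrib]
    rw [Finset.sum_comm]
    refine Finset.sum_congr rfl fun _ _ => Finset.sum_congr rfl fun _ _ => ?_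
    split_ifs <;> ring
  have hdu : u k = (∑ i, if e i k then x i else 0) * b k - a k := by
    have h1 : a k = ∑ i, a k * x i := by rw [← Finset.mul_sum, hx.2, mul_one]
    rw [h1, Finset.sum_mul, ← Finset.sum_sub_distrib, hu]
    refine Finset.sum_congr rfl fun i _ => ?_
    split_ifs <;> ring
  -- Deviations in the `k`-th game alone.
  have hA' : ∀ i, x i ≠ 0 → ∀ β : Bool, ((if β then b k else 0) - a k) * t k ≤
      ((if e i k then b k else 0) - a k) * t k := by
    intro i hi β
    have := hA i hi (e.symm (Function.update (e i) k β))
    rw [hrow, hrow, Equiv.apply_symm_apply] at this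
    have hf := sum_update_bool (fun k β => ((if β then b k else 0) - a k) * t k) (e i) k β
    beta_reduce at this hf
    linarith
  have hB' : ∀ j, y j ≠ 0 → ∀ β : Bool, (if β then -1 else 1) * u k ≤
      (if e j k then -1 else 1) * u k := by
    intro j hj β
    have := hB j hj (e.symm (Function.update (e j) k β))
    rw [hcol, hcol, Equiv.apply_symm_apply] at this
    have hf := sum_update_bool (fun k β => (if β then -1 else 1) * u k) (e j) k β
    beta_reduce at this hf
    linarith
  have hu0 : u k = 0 := by
    rcases lt_trichotomy (u k) 0 with hlt | h0 | hgt
    · have ht1 : t k = 1 := by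
        rw [← hy.2, ht]
        refine Finset.sum_congr rfl fun j _ => ?_
        rcases eq_or_ne (y j) 0 with h0 | h0
        · simp [h0]
        · have := hB' j h0 true
          cases hj : e j k
          · simp only [hj, if_true, Bool.false_eq_true, if_false] at this
            linarith
          · simp
      have hd : (∑ i, if e i k then x i else 0) = 1 := by
        rw [← hx.2]
        refine Finset.sum_congr rfl fun i _ => ?_
        rcases eq_or_ne (x i) 0 with h0 | h0
        · simp [h0]
        · have := hA' i h0 true
          cases hj : e i k
          · simp only [hj, if_true, Bool.false_eq_true, if_false, ht1] at this
            linarith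
          · simp
      rw [hd] at hdu
      linarith
    · exact h0
    · have ht1 : t k = -1 := by
        rw [← hy.2, ht, ← Finset.sum_neg_distrib]
        refine Finset.sum_congr rfl fun j _ => ?_
        rcases eq_or_ne (y j) 0 with h0 | h0
        · simp [h0]
        · have := hB' j h0 false
          cases hj : e j k
          · simp
          · simp only [hj, if_true, Bool.false_eq_true, if_false] at this
            linarith
      have hd : (∑ i, if e i k then x i else 0) = 0 := by
        refine Finset.sum_eq_zero fun i _ => ?_
        rcases eq_or_ne (x i) 0 with h0 | h0
        · simp [h0]
        · have := hA' i h0 false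
          cases hj : e i k
          · simp
          · simp only [hj, if_true, Bool.false_eq_true, if_false, ht1] at this
            linarith
      rw [hd] at hdu
      linarith
  rw [eq_div_iff hb.ne']
  linarith

/-! ### The reductions between the equilibrium problems -/

lemma IsGameName.unique {ν : ℕ ≃ ℚ} {n m : ℕ} {w : Baire} {A B A' B' : Matrix (Fin n) (Fin m) ℝ}
    (h : IsGameName ν w A B) (h' : IsGameName ν w A' B') : A' = A ∧ B' = B :=
  Prod.ext_iff.1 (h'.gameVal_eq.symm.trans h.gameVal_eq)

lemma mem_nash_iff {ν : ℕ ≃ ℚ} {n m : ℕ} {w z : Baire} {A B : Matrix (Fin n) (Fin m) ℝ}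
    (h : IsGameName ν w A B) :
    z ∈ Nash ν w ↔ ∃ x y, IsNash A B x y ∧ IsProfileName ν z x y := by
  constructor
  · rintro ⟨n', m', A', B', x, y, h1, h2, h3⟩
    obtain ⟨rfl, rfl⟩ := h.1.unique h1.1
    obtain ⟨rfl, rfl⟩ := h.unique h1
    exact ⟨x, y, h2, h3⟩
  · rintro ⟨x, y, h2, h3⟩
    exact ⟨n, m, A, B, x, y, h, h2, h3⟩

lemma mem_zNash_iff {ν : ℕ ≃ ℚ} {n m : ℕ} {w z : Baire} {A : Matrix (Fin n) (Fin m) ℝ}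
    (h : IsGameName ν w A (-A)) :
    z ∈ ZNash ν w ↔ ∃ x y, IsNash A (-A) x y ∧ IsProfileName ν z x y := by
  constructor
  · rintro ⟨n', m', A', x, y, h1, h2, h3⟩
    obtain ⟨rfl, rfl⟩ := h.1.unique h1.1
    obtain ⟨rfl, -⟩ := h.unique h1
    exact ⟨x, y, h2, h3⟩
  · rintro ⟨x, y, h2, h3⟩
    exact ⟨n, m, A, x, y, h, h2, h3⟩

lemma mem_corr_iff {ν : ℕ ≃ ℚ} {n m : ℕ} {w z : Baire} {A B : Matrix (Fin n) (Fin m) ℝ}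
    (h : IsGameName ν w A B) :
    z ∈ Corr ν w ↔ ∃ C, IsCorrelated A B C ∧ IsJointName ν z C := by
  constructor
  · rintro ⟨n', m', A', B', C, h1, h2, h3⟩
    obtain ⟨rfl, rfl⟩ := h.1.unique h1.1
    obtain ⟨rfl, rfl⟩ := h.unique h1
    exact ⟨C, h2, h3⟩
  · rintro ⟨C, h2, h3⟩
    exact ⟨n, m, A, B, C, h, h2, h3⟩

lemma mem_zCorr_iff {ν : ℕ ≃ ℚ} {n m : ℕ} {w z : Baire} {A : Matrix (Fin n) (Fin m) ℝ}
    (h : IsGameName ν w A (-A)) :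
    z ∈ ZCorr ν w ↔ ∃ C, IsCorrelated A (-A) C ∧ IsJointName ν z C := by
  constructor
  · rintro ⟨n', m', A', C, h1, h2, h3⟩
    obtain ⟨rfl, rfl⟩ := h.1.unique h1.1
    obtain ⟨rfl, -⟩ := h.unique h1
    exact ⟨C, h2, h3⟩
  · rintro ⟨C, h2, h3⟩
    exact ⟨n, m, A, C, h, h2, h3⟩

lemma exists_profileName (ν : ℕ ≃ ℚ) {n m : ℕ} (hn : 0 < n) (hm : 0 < m) (x : Fin n → ℝ)
    (y : Fin m → ℝ) : ∃ z, IsProfileName ν z x y := by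
  obtain ⟨g, -, hg⟩ := (zeroDim_of_discrete Unit).exists_profileName ν hn hm
    (x := fun _ => x) (y := fun _ => y) continuous_const continuous_const
  exact ⟨g (), hg ()⟩

lemma exists_jointName (ν : ℕ ≃ ℚ) {n m : ℕ} (hn : 0 < n) (hm : 0 < m)
    (C : Matrix (Fin n) (Fin m) ℝ) : ∃ z, IsJointName ν z C := by
  obtain ⟨g, -, hg⟩ := (zeroDim_of_discrete Unit).exists_jointName ν hn hm
    (C := fun _ => C) continuous_const
  exact ⟨g (), hg ()⟩

lemma IsGameName.mem_dom_nash {ν : ℕ ≃ ℚ} {n m : ℕ} {w : Baire} {A B : Matrix (Fin n) (Fin m) ℝ}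
    (h : IsGameName ν w A B) : w ∈ dom (Nash ν) := by
  obtain ⟨x, y, hxy⟩ := exists_isNash h.1.1 h.1.2.1 A B
  obtain ⟨z, hz⟩ := exists_profileName ν h.1.1 h.1.2.1 x y
  exact ⟨z, (mem_nash_iff h).2 ⟨x, y, hxy, hz⟩⟩

lemma IsGameName.mem_dom_zNash {ν : ℕ ≃ ℚ} {n m : ℕ} {w : Baire} {A : Matrix (Fin n) (Fin m) ℝ}
    (h : IsGameName ν w A (-A)) : w ∈ dom (ZNash ν) := by
  obtain ⟨x, y, hxy⟩ := exists_isNash h.1.1 h.1.2.1 A (-A)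
  obtain ⟨z, hz⟩ := exists_profileName ν h.1.1 h.1.2.1 x y
  exact ⟨z, (mem_zNash_iff h).2 ⟨x, y, hxy, hz⟩⟩

lemma IsGameName.mem_dom_corr {ν : ℕ ≃ ℚ} {n m : ℕ} {w : Baire} {A B : Matrix (Fin n) (Fin m) ℝ}
    (h : IsGameName ν w A B) : w ∈ dom (Corr ν) := by
  obtain ⟨x, y, hxy⟩ := exists_isNash h.1.1 h.1.2.1 A B
  obtain ⟨z, hz⟩ := exists_jointName ν h.1.1 h.1.2.1 fun i j => x i * y j
  exact ⟨z, (mem_corr_iff h).2 ⟨_, hxy.isCorrelated, hz⟩⟩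

lemma IsGameName.mem_dom_zCorr {ν : ℕ ≃ ℚ} {n m : ℕ} {w : Baire} {A : Matrix (Fin n) (Fin m) ℝ}
    (h : IsGameName ν w A (-A)) : w ∈ dom (ZCorr ν) := by
  obtain ⟨x, y, hxy⟩ := exists_isNash h.1.1 h.1.2.1 A (-A)
  obtain ⟨z, hz⟩ := exists_jointName ν h.1.1 h.1.2.1 fun i j => x i * y j
  exact ⟨z, (mem_zCorr_iff h).2 ⟨_, hxy.isCorrelated, hz⟩⟩

theorem zNash_reducible_nash (ν : ℕ ≃ ℚ) : Reducible (ZNash ν) (Nash ν) := by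
  refine reducible_of_restriction ?_ ?_
  · rintro w ⟨z, n, m, A, x, y, h, -⟩
    exact h.mem_dom_nash
  · rintro w ⟨-, n, m, A, -, -, h, -⟩ z hz
    exact (mem_zNash_iff h).2 ((mem_nash_iff h).1 hz)

theorem zCorr_reducible_corr (ν : ℕ ≃ ℚ) : Reducible (ZCorr ν) (Corr ν) := by
  refine reducible_of_restriction ?_ ?_
  · rintro w ⟨z, n, m, A, C, h, -⟩
    exact h.mem_dom_corr
  · rintro w ⟨-, n, m, A, -, h, -⟩ z hz
    exact (mem_zCorr_iff h).2 ((mem_corr_iff h).1 hz)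

open scoped Classical in
/-- The dimensions announced by the header of a sequence, and `(0, 0)` without a header. -/
noncomputable def headerKey (w : Baire) : ℕ × ℕ :=
  if h : ∃ d : ℕ × ℕ, HasHeader d.1 d.2 w then h.choose else (0, 0)

lemma HasHeader.headerKey_eq {n m : ℕ} {w : Baire} (h : HasHeader n m w) :
    headerKey w = (n, m) := by
  have hex : ∃ d : ℕ × ℕ, HasHeader d.1 d.2 w := ⟨(n, m), h⟩
  rw [headerKey, dif_pos hex]
  exact Prod.ext (hex.choose_spec.unique h).1 (hex.choose_spec.unique h).2

/-- If all instances of a problem have headers, then a reduction may be given separately for all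
dimensions. -/
lemma reducible_of_headers {P Q : MultiFun} (hP : ∀ w ∈ dom P, ∃ n m, HasHeader n m w)
    (h : ∀ n m, 0 < n → 0 < m → ∃ G : {w // w ∈ dom P ∧ HasHeader n m w} → Baire,
      Continuous G ∧ (∀ w, G w ∈ dom Q) ∧
      ∃ F : {p : {w // w ∈ dom P ∧ HasHeader n m w} × Baire // p.2 ∈ Q (G p.1)} → Baire,
        Continuous F ∧ ∀ p, F p ∈ P p.1.1) : Reducible P Q := by
  refine reducible_of_pieces headerKey ?_ ?_
  · intro w hw
    obtain ⟨n, m, hnm⟩ := hP w hw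
    filter_upwards [(isOpen_hasHeader n m).mem_nhds hnm] with v hv
    rw [hnm.headerKey_eq, HasHeader.headerKey_eq hv]
  · rintro ⟨n, m⟩
    have heq : (fun w => w ∈ dom P ∧ headerKey w = (n, m)) =
        fun w => w ∈ dom P ∧ HasHeader n m w := by
      funext w
      refine propext ⟨fun hw => ⟨hw.1, ?_⟩, fun hw => ⟨hw.1, hw.2.headerKey_eq⟩⟩
      obtain ⟨n', m', hnm⟩ := hP w hw.1
      have := hw.2
      rw [hnm.headerKey_eq, Prod.mk.injEq] at this
      obtain ⟨rfl, rfl⟩ := this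
      exact hnm
    rw [heq]
    by_cases hnm : 0 < n ∧ 0 < m
    · exact h n m hnm.1 hnm.2
    · have hE : ∀ w : {w // w ∈ dom P ∧ HasHeader n m w}, False := fun w =>
        hnm ⟨w.2.2.1, w.2.2.2.1⟩
      have : IsEmpty {w // w ∈ dom P ∧ HasHeader n m w} := ⟨hE⟩
      exact ⟨fun _ => 0, continuous_const, fun w => (hE w).elim, fun _ => 0, continuous_const,
        fun p => (hE p.1.1).elim⟩

theorem corr_reducible_nash (ν : ℕ ≃ ℚ) : Reducible (Corr ν) (Nash ν) := by
  refine reducible_of_headers ?_ fun n m hn hm => ?_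
  · rintro w ⟨z, n, m, A, B, C, h, -⟩
    exact ⟨n, m, h.1⟩
  refine ⟨Subtype.val, continuous_subtype_val, ?_, ?_⟩
  · rintro ⟨w, ⟨z, n, m, A, B, C, h, -⟩, -⟩
    exact h.mem_dom_nash
  · obtain ⟨F, hF, hFC⟩ := ((zeroDim_baire.subtype _).prodMk zeroDim_baire |>.subtype
      fun p : {w // w ∈ dom (Corr ν) ∧ HasHeader n m w} × Baire => p.2 ∈ Nash ν p.1).exists_jointName
      ν hn hm (C := fun p => .of fun i j =>
        (profileVal ν n m p.1.2).1 i * (profileVal ν n m p.1.2).2 j) (by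
      have hc : Continuous fun p : {p : {w // w ∈ dom (Corr ν) ∧ HasHeader n m w} × Baire //
          p.2 ∈ Nash ν p.1} => profileVal ν n m p.1.2 :=
        (continuous_profileVal ν n m).comp (continuous_snd.comp continuous_subtype_val)
      refine continuous_pi fun i => continuous_pi fun j => ?_
      exact ((continuous_apply i).comp (continuous_fst.comp hc)).mul
        ((continuous_apply j).comp (continuous_snd.comp hc)))
    refine ⟨F, hF, ?_⟩
    rintro ⟨⟨⟨w, ⟨z', n', m', A, B, C, h, hC⟩, hw⟩, z⟩, hz⟩
    obtain ⟨rfl, rfl⟩ := hw.unique h.1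
    obtain ⟨x, y, hxy, hname⟩ := (mem_nash_iff h).1 hz
    refine (mem_corr_iff h).2 ⟨_, hxy.isCorrelated, ?_⟩
    have := hFC ⟨⟨⟨w, ⟨z', n, m, A, B, C, h, hC⟩, hw⟩, z⟩, hz⟩
    simp only [hname.profileVal_eq] at this
    exact this

theorem zNash_reducible_zCorr (ν : ℕ ≃ ℚ) : Reducible (ZNash ν) (ZCorr ν) := by
  refine reducible_of_headers ?_ fun n m hn hm => ?_
  · rintro w ⟨z, n, m, A, x, y, h, -⟩
    exact ⟨n, m, h.1⟩
  refine ⟨Subtype.val, continuous_subtype_val, ?_, ?_⟩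
  · rintro ⟨w, ⟨z, n, m, A, x, y, h, -⟩, -⟩
    exact h.mem_dom_zCorr
  · have hc : Continuous fun p : {p : {w // w ∈ dom (ZNash ν) ∧ HasHeader n m w} × Baire //
        p.2 ∈ ZCorr ν p.1} => jointVal ν n m p.1.2 :=
      (continuous_jointVal ν n m).comp (continuous_snd.comp continuous_subtype_val)
    obtain ⟨F, hF, hFC⟩ := ((zeroDim_baire.subtype _).prodMk zeroDim_baire |>.subtype
      fun p : {w // w ∈ dom (ZNash ν) ∧ HasHeader n m w} × Baire =>
        p.2 ∈ ZCorr ν p.1).exists_profileName ν hn hm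
      (x := fun p i => ∑ j, jointVal ν n m p.1.2 i j) (y := fun p j => ∑ i, jointVal ν n m p.1.2 i j)
      (continuous_pi fun i => continuous_finsetSum _ fun j _ => hc.matrix_elem i j)
      (continuous_pi fun j => continuous_finsetSum _ fun i _ => hc.matrix_elem i j)
    refine ⟨F, hF, ?_⟩
    rintro ⟨⟨⟨w, ⟨z', n', m', A, x, y, h, hC⟩, hw⟩, z⟩, hz⟩
    obtain ⟨rfl, rfl⟩ := hw.unique h.1
    obtain ⟨C, hCorr, hname⟩ := (mem_zCorr_iff h).1 hz
    refine (mem_zNash_iff h).2 ⟨_, _, hCorr.isNash_marginals, ?_⟩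
    have := hFC ⟨⟨⟨w, ⟨z', n, m, A, x, y, h, hC⟩, hw⟩, z⟩, hz⟩
    simp only [hname.jointVal_eq] at this
    exact this

/-! ### Parallel robust divisions as a zero-sum game -/

lemma mem_rDiv_iff {ν : ℕ ≃ ℚ} {w z : Baire} {a b : ℝ} (ha : IsRealName ν (component 2 0 w) a)
    (hb : IsRealName ν (component 2 1 w) b) :
    z ∈ rDiv ν w ↔ 0 ≤ a ∧ a ≤ b ∧ (0 < b → IsRealName ν z (a / b)) := by
  constructor
  · rintro ⟨a', b', ha', hb', h⟩
    rwa [ha.unique ha', hb.unique hb']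
  · exact fun h => ⟨a, b, ha, hb, h⟩

lemma pair_mem_dom_rDiv {ν : ℕ ≃ ℚ} {u v : Baire} {a b : ℝ} (ha : IsRealName ν u a)
    (hb : IsRealName ν v b) (h0 : 0 ≤ a) (hab : a ≤ b) : pair u v ∈ dom (rDiv ν) := by
  obtain ⟨z, hz⟩ := exists_realName ν (a / b)
  exact ⟨z, a, b, by simpa using ha, by simpa using hb, h0, hab, fun _ => hz⟩

/-- The instance of a supremum without its index. -/
def tail (w : Baire) : Baire := fun i => w (i + 1)

/-- The `j`-th real number (dividend or divisor) of the `k`-th division in an instance of parallel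
divisions. -/
noncomputable def divisionVal (ν : ℕ ≃ ℚ) (n k j : ℕ) (w : Baire) : ℝ :=
  realVal ν (component 2 j (part n k w))

lemma continuous_divisionVal (ν : ℕ ≃ ℚ) (n k j : ℕ) : Continuous (divisionVal ν n k j) :=
  (continuous_realVal ν).comp ((continuous_component 2 j).comp (continuous_part n k))

lemma continuous_divisionGame {X : Type*} [TopologicalSpace X] {ι : Type*} [Fintype ι] {N : ℕ}
    (e : Fin N ≃ (ι → Bool)) {a b : X → ι → ℝ} (ha : ∀ k, Continuous fun t => a t k)
    (hb : ∀ k, Continuous fun t => b t k) :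
    Continuous fun t => divisionGame e (a t) (b t) := by
  refine continuous_pi fun i => continuous_pi fun j => continuous_finsetSum _ fun k _ => ?_
  refine (Continuous.sub ?_ (ha k)).mul continuous_const
  split_ifs
  exacts [hb k, continuous_const]

/-- The reduction is carried out separately for every index `n`, which is constant near an instance.
The game has one pure strategy for every element of `Fin (n + 1) → Bool`. -/
theorem sup_rDiv_reducible_zNash (ν : ℕ ≃ ℚ) :
    Reducible (sup fun n => power (rDiv ν) n) (ZNash ν) := by
  refine reducible_of_pieces (fun w => w 0) (fun w _ => ?_) fun n => ?_
  · exact (continuous_apply 0).continuousAt.eventually (isOpen_discrete {w 0} |>.mem_nhds rfl)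
  set D := {w // w ∈ dom (sup fun n => power (rDiv ν) n) ∧ w 0 = n} with hD
  have htail : Continuous fun w : D => tail w.1 :=
    continuous_pi fun i => (continuous_apply (i + 1)).comp continuous_subtype_val
  have hval : ∀ k j, Continuous fun w : D => divisionVal ν n k j (tail w.1) := fun k j =>
    (continuous_divisionVal ν n k j).comp htail
  let e : Fin (Fintype.card (Fin (n + 1) → Bool)) ≃ (Fin (n + 1) → Bool) :=
    (Fintype.equivFin _).symm
  have hN : 0 < Fintype.card (Fin (n + 1) → Bool) := Fintype.card_pos
  have hM : Continuous fun w : D => divisionGame e (fun k => divisionVal ν n k 0 (tail w.1))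
      fun k => divisionVal ν n k 1 (tail w.1) :=
    continuous_divisionGame e (fun k => hval k 0) fun k => hval k 1
  obtain ⟨G, hG, hGname⟩ := (zeroDim_baire.subtype _).exists_gameName ν hN hN hM hM.neg
  refine ⟨G, hG, fun w => (hGname w).mem_dom_zNash, ?_⟩
  have hF : ∀ k : ℕ, ∃ F : {p : D × Baire // p.2 ∈ ZNash ν (G p.1)} → Baire, Continuous F ∧
      ∀ p, IsRealName ν (F p) (if hk : k < n + 1 then
        ∑ i, (if e i ⟨k, hk⟩ then (profileVal ν _ (Fintype.card (Fin (n + 1) → Bool)) p.1.2).1 i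
          else 0) else 0) := by
    intro k
    refine (((zeroDim_baire.subtype _).prodMk zeroDim_baire).subtype _).exists_realName ν ?_
    split_ifs with hk
    · refine continuous_finsetSum _ fun i _ => ?_
      split_ifs
      · exact (continuous_apply i).comp (continuous_fst.comp
          ((continuous_profileVal ν _ _).comp (continuous_snd.comp continuous_subtype_val)))
      · exact continuous_const
    · exact continuous_const
  choose F hFc hFname using hF
  refine ⟨fun p => join n fun k => F k p, (continuous_join n).comp (continuous_pi hFc), ?_⟩
  rintro ⟨⟨⟨w, hw, rfl⟩, z⟩, hz⟩
  obtain ⟨x, y, hxy, hname⟩ := (mem_zNash_iff (hGname _)).1 hz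
  refine (mem_power_iff _ _ _ _).2 fun k hk => ?_
  rw [part_join hk]
  obtain ⟨z', a, b, ha, hb, h0, hab, -⟩ := (power_nonempty_iff _ _ _).1 hw k hk
  refine ⟨a, b, ha, hb, h0, hab, fun hb0 => ?_⟩
  have h := hFname k ⟨⟨⟨w, hw, rfl⟩, z⟩, hz⟩
  have ha' : divisionVal ν (w 0) k 0 (tail w) = a := ha.realVal_eq
  have hb' : divisionVal ν (w 0) k 1 (tail w) = b := hb.realVal_eq
  have hk' : k < w 0 + 1 := Nat.lt_succ_of_le hk
  rw [dif_pos hk'] at h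
  simp only [hname.profileVal_eq] at h
  rw [hxy.division (k := ⟨k, hk'⟩) (by simpa only [ha'] using h0)
    (by simpa only [ha', hb'] using hab) (by simpa only [hb'] using hb0)] at h
  simpa only [ha', hb'] using h

/-! ### Nash equilibria by parallel robust divisions -/

/-- The instance of a supremum with index `n` that consists of the instance `w`. -/
def cons (n : ℕ) (w : Baire) : Baire := fun i => Nat.casesOn i n w

lemma continuous_cons (n : ℕ) : Continuous (cons n) := by
  refine continuous_pi fun i => ?_
  cases i with
  | zero => exact continuous_const
  | succ i => exact continuous_apply i

lemma continuous_minor {X Φ ι : Type*} [TopologicalSpace X] [Fintype ι] [DecidableEq ι]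
    {g : X → Φ → ι → ℝ} (hg : ∀ φ, Continuous fun t => g t φ) (τ : ι → Option Φ) :
    Continuous fun t => minor (g t) τ := by
  refine Continuous.matrix_det (continuous_pi fun k => ?_)
  show Continuous fun t => extForm (g t) (τ k)
  cases τ k with
  | none => exact continuous_const
  | some φ => exact hg φ

/-- The divisions for the games of size `n × m` are those of `exists_parallel_divisions` for the
equilibrium map, stratified by the minors of both systems of payoff forms. -/
theorem nash_reducible_sup_rDiv (ν : ℕ ≃ ℚ) :
    Reducible (Nash ν) (sup fun n => power (rDiv ν) n) := by
  refine reducible_of_headers ?_ fun n m hn hm => ?_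
  · rintro w ⟨z, n, m, A, B, x, y, h, -⟩
    exact ⟨n, m, h.1⟩
  have : Nonempty (Fin n) := ⟨⟨0, hn⟩⟩
  have : Nonempty (Fin m) := ⟨⟨0, hm⟩⟩
  set D : Set Baire := {w | w ∈ dom (Nash ν) ∧ HasHeader n m w} with hD
  have hval : Continuous fun w : D => gameVal ν n m w :=
    (continuous_gameVal ν n m).comp continuous_subtype_val
  have hDgame : ∀ w : D, ∃ A B : Matrix (Fin n) (Fin m) ℝ, IsGameName ν w.1 A B := by
    rintro ⟨w, ⟨z, n', m', A, B, x, y, h, -⟩, hw⟩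
    obtain ⟨rfl, rfl⟩ := hw.unique h.1
    exact ⟨A, B, h⟩
  obtain ⟨N, a, b, ha, hb, hab, hsolve⟩ := exists_parallel_divisions ν (D := D)
    (Z := stdSimplex ℝ (Fin n) × stdSimplex ℝ (Fin m))
    (κ := (Fin m → Option (Fin m ⊕ Fin n × Fin n)) ⊕ (Fin n → Option (Fin n ⊕ Fin m × Fin m)))
    (fun k w => Sum.elim (minor (payoffForms (gameVal ν n m w).1))
      (minor (payoffForms (gameVal ν n m w).2ᵀ)) k)
    (by
      rintro (τ | τ)
      · exact continuous_minor (continuous_payoffForms hval.fst) τ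
      · exact continuous_minor (continuous_payoffForms hval.snd.matrix_transpose) τ)
    (fun w => nashSet (gameVal ν n m w))
    (fun w => by
      obtain ⟨x, y, hxy⟩ := exists_isNash hn hm (gameVal ν n m w).1 (gameVal ν n m w).2
      exact ⟨(⟨x, hxy.1⟩, ⟨y, hxy.2.1⟩), hxy⟩)
    ((isClosed_graph_nashSet n m).preimage
      ((hval.comp continuous_fst).prodMk continuous_snd))
    (fun w z hz ε hε => by
      filter_upwards [eventually_exists_near_nash hval hz hε] with v hv hk
      exact hv ⟨fun τ => hk (.inl τ), fun τ => hk (.inr τ)⟩)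
  have hDz : ZeroDim D := zeroDim_baire.subtype _
  choose u hu hua using fun s => hDz.exists_realName ν (ha s)
  choose v hv hvb using fun s => hDz.exists_realName ν (hb s)
  have hdiv : ∀ (w : D), ∀ s ≤ N, part N s (join N fun s => pair (u s w) (v s w)) =
      pair (u s w) (v s w) := fun w s hs => part_join hs _
  refine ⟨fun w => cons N (join N fun s => pair (u s w) (v s w)),
    (continuous_cons N).comp ((continuous_join N).comp
      (continuous_pi fun s => Continuous.pair (hu s) (hv s))), ?_, ?_⟩
  · intro w
    refine (power_nonempty_iff _ N _).2 fun s hs => ?_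
    show part N s (join N fun s => pair (u s w) (v s w)) ∈ _
    rw [hdiv w s hs]
    exact pair_mem_dom_rDiv (hua s w) (hvb s w) (hab s w).1 (hab s w).2
  · have hE := ((hDz.prodMk zeroDim_baire).subtype fun p : D × Baire =>
      p.2 ∈ sup (fun n => power (rDiv ν) n) (cons N (join N fun s => pair (u s p.1) (v s p.1))))
    obtain ⟨z, hz, hzn⟩ := hsolve _ hE (fun p => p.1.1) (fun s p => part N s p.1.2)
      (continuous_fst.comp continuous_subtype_val)
      (fun s => (continuous_part N s).comp (continuous_snd.comp continuous_subtype_val))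
      (by
        rintro ⟨⟨w, z⟩, hp⟩ s hs hpos
        have h := (mem_power_iff (rDiv ν) N _ _).1 hp s hs
        change _ ∈ rDiv ν (part N s (join N fun s => pair (u s w) (v s w))) at h
        rw [hdiv w s hs, mem_rDiv_iff (a := a s w) (b := b s w) (by simpa using hua s w)
          (by simpa using hvb s w)] at h
        exact h.2.2 hpos)
    obtain ⟨F, hF, hFname⟩ := hE.exists_profileName ν hn hm
      (x := fun p => (z p).1.1) (y := fun p => (z p).2.1)
      (continuous_subtype_val.comp hz.fst) (continuous_subtype_val.comp hz.snd)
    refine ⟨F, hF, fun p => ?_⟩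
    obtain ⟨A, B, h⟩ := hDgame p.1.1
    have hnash := hzn p
    rw [h.gameVal_eq] at hnash
    exact (mem_nash_iff h).2 ⟨_, _, hnash, hFname p⟩

end TypeTwo

theorem corollary33 (ν : ℕ ≃ ℚ) :
    TypeTwo.Equivalent (TypeTwo.ZCorr ν) (TypeTwo.Corr ν) ∧
    TypeTwo.Equivalent (TypeTwo.Corr ν) (TypeTwo.ZNash ν) ∧
    TypeTwo.Equivalent (TypeTwo.ZNash ν) (TypeTwo.Nash ν) ∧
    TypeTwo.Equivalent (TypeTwo.Nash ν)
      (TypeTwo.sup (fun n : ℕ => TypeTwo.power (TypeTwo.rDiv ν) n)) := by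
  have h1 := TypeTwo.zCorr_reducible_corr ν
  have h2 := TypeTwo.corr_reducible_nash ν
  have h3 := TypeTwo.nash_reducible_sup_rDiv ν
  have h4 := TypeTwo.sup_rDiv_reducible_zNash ν
  have h5 := TypeTwo.zNash_reducible_zCorr ν
  have h6 := h3.trans h4
  exact ⟨⟨h1, (h2.trans h6).trans h5⟩, ⟨h2.trans h6, h5.trans h1⟩,
    ⟨TypeTwo.zNash_reducible_nash ν, h6⟩, ⟨h3, h4.trans (TypeTwo.zNash_reducible_nash ν)⟩⟩
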